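/- \textbf{Setting.} Let $\mathcal K$ be a CM field with maximal totally real subfield $F$, let $c$ be the non-trivial element of $\mathrm{Gal}(\mathcal K/F)$, let $D$ be a central simple $\mathcal K$-algebra of dimension $n^2$, and let $\star$ be an anti-involution of $D$ with $\star|_{\mathcal K}=c$. For an $F$-algebra $R$ put $U(R)=\{x\in (D\otimes_F R)^\times : xx^\star=1\}$, and put $G=\mathrm{Res}_{F/\mathbb Q}U$. Assume that $G(\mathbb R)=U(F\otimes_{\mathbb Q}\mathbb R)$ is compact. Let $p$ be a prime, $L/\mathbb Q_p$ a finite extension, $\mathcal O$ its ring of integers and $\varpi$ a uniformizer. Let $K^p=\prod_{v\nmid p}K_v\subset G(\mathbb A_f^p)$ be a compact open subgroup, with each $K_v\subset U(F_v)$ compact open, and let $S$ be a finite set of places of $F$ such that $K_v$ is hyperspecial for all $v\nmid p$ with $v\notin S$. Assume that $K^p$ is sufficiently small, in the sense that for every compact open subgroup $K'_p\subset G(\mathbb Q_p)$ and every $g\in G(\mathbb A_f)$ the finite group $G(\mathbb Q)\cap gK'_pK^pg^{-1}$ has no element of order $p$ (this holds, for example, if some $K_v$, $v\nmid p$, has no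 element of order $p$). For a compact open subgroup $K\subset G(\mathbb A_f)$ let $Y(K)=G(\mathbb Q)\backslash G(\mathbb A_f)/K$. Put $$H^0(K^p,\mathcal O/\varpi^s)=\varinjlim_{K'_p}H^0(Y(K'_pK^p),\mathcal O/\varpi^s),\qquad \tilde H^0(K^p)^\circ=\varprojlim_s H^0(K^p,\mathcal O/\varpi^s),$$ where $K'_p$ runs over the compact open subgroups of $G(\mathbb Q_p)$, each $H^0(K^p,\mathcal O/\varpi^s)$ is discrete, and $\tilde H^0(K^p)^\circ$ has the inverse limit topology. The group $G(\mathbb Q_p)$ acts on it by right translation, and a double coset $K^pgK^p=\bigsqcup_h hK^p$ with $g\in G(\mathbb A_f^p)$ acts by $f\mapsto\sum_h f(\,\cdot\,h)$. Let $\mathbb T(K^p)\subset \mathrm{End}_{\mathcal O}\,\tilde H^0(K^p)^\circ$ be the closure, for the topology of pointwise convergence, of the image of the spherical Hecke algebra $\bigotimes_{v\nmid p,\,v\notin S}\mathcal H_{\mathcal O}(U(F_v),K_v)$. \textbf{Proposition.} Let $K_p\subset G(\mathbb Q_p)$ be an open pro-$p$ subgroup. (1) There are an integer $r>0$ and a topological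 isomorphism of $\mathcal O[K_p]$-modules $\tilde H^0(K^p)^\circ\simeq \mathcal C(K_p,\mathcal O)^r$, where $\mathcal C(K_p,\mathcal O)$ is the module of continuous functions $K_p\to\mathcal O$ with the topology of uniform convergence, and $K_p$ acts by right translation. (2) The ring $\mathbb T(K^p)$ is commutative, and for every maximal ideal $\mathfrak m\subset\mathbb T(K^p)$ the localization $\tilde H^0(K^p)^\circ_{\mathfrak m}$ is a topological direct summand of $\tilde H^0(K^p)^\circ$, hence of $\mathcal C(K_p,\mathcal O)^r$: the localization map $\ell\colon\tilde H^0(K^p)^\circ\to\tilde H^0(K^p)^\circ_{\mathfrak m}$ has a $\mathbb T(K^p)$-linear section $j$ such that the projector $j\circ\ell$ is continuous and commutes with the action of $G(\mathbb Q_p)$. -/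

import Mathlib

open scoped TensorProduct NumberField
open IsDedekindDomain

noncomputable section

namespace DefiniteUnitary

/-! ### Unitary groups -/

section Unitary

variable {F K D : Type*} [Field F] [Field K] [Algebra F K] [Ring D] [Algebra F D] [Algebra K D]

/-- An `F`-linear anti-involution of the `K`-algebra `D` which restricts to `c` on `K`.
It is of the second kind when `c ≠ 1`. -/
structure AntiInvolution (D : Type*) [Ring D] [Algebra F D] [Algebra K D] (c : K ≃ₐ[F] K) where
  toLinearMap : D →ₗ[F] D
  map_mul' : ∀ x y, toLinearMap (x * y) = toLinearMap y * toLinearMap x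
  invol' : ∀ x, toLinearMap (toLinearMap x) = x
  map_algebraMap' : ∀ a : K, toLinearMap (algebraMap K D a) = algebraMap K D (c a)

variable {c : K ≃ₐ[F] K} (σ : AntiInvolution D c)

/-- The `R`-linear extension of the anti-involution to `R ⊗ D`. -/
def starR (R : Type*) [CommRing R] [Algebra F R] : (R ⊗[F] D) →ₗ[R] (R ⊗[F] D) :=
  σ.toLinearMap.baseChange R

@[simp] lemma starR_tmul (R : Type*) [CommRing R] [Algebra F R] (r : R) (d : D) :
    starR σ R (r ⊗ₜ d) = r ⊗ₜ σ.toLinearMap d := rfl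

lemma starR_mul (R : Type*) [CommRing R] [Algebra F R] (x y : R ⊗[F] D) :
    starR σ R (x * y) = starR σ R y * starR σ R x := by
  induction x using TensorProduct.induction_on with
  | zero => simp
  | add a b ha hb => simp [add_mul, mul_add, ha, hb]
  | tmul r d =>
    induction y using TensorProduct.induction_on with
    | zero => simp
    | add a b ha hb => simp [add_mul, mul_add, ha, hb]
    | tmul r' d' => simp [σ.map_mul', mul_comm]

lemma starR_starR (R : Type*) [CommRing R] [Algebra F R] (x : R ⊗[F] D) :
    starR σ R (starR σ R x) = x := by
  induction x using TensorProduct.induction_on with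
  | zero => simp
  | add a b ha hb => simp [ha, hb]
  | tmul r d => simp [σ.invol']

lemma toLinearMap_one : σ.toLinearMap 1 = 1 := by
  have h := σ.map_algebraMap' 1
  simpa using h

lemma starR_one (R : Type*) [CommRing R] [Algebra F R] : starR σ R 1 = 1 := by
  rw [Algebra.TensorProduct.one_def, starR_tmul, toLinearMap_one]

/-- `U(R) = {x ∈ (D ⊗_F R)ˣ : x x⋆ = 1}` as a subgroup of `(R ⊗[F] D)ˣ`. -/
def unitarySubgroup (R : Type*) [CommRing R] [Algebra F R] : Subgroup (R ⊗[F] D)ˣ where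
  carrier := {x | (x : R ⊗[F] D) * starR σ R x = 1}
  one_mem' := by simp [starR_one]
  mul_mem' := by
    intro a b ha hb
    simp only [Set.mem_ofPred_eq, Units.val_mul, starR_mul] at *
    calc (a : R ⊗[F] D) * b * (starR σ R b * starR σ R a)
        = a * (b * starR σ R b) * starR σ R a := by simp only [mul_assoc]
      _ = 1 := by rw [hb, mul_one, ha]
  inv_mem' := by
    intro a ha
    simp only [Set.mem_ofPred_eq] at *
    have h : ((a⁻¹ : (R ⊗[F] D)ˣ) : R ⊗[F] D) = starR σ R a := by
      rw [Units.inv_eq_of_mul_eq_one_right ha]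
    rw [h, starR_starR, ← h, Units.inv_mul]

/-- The group `U(R)` of `R`-points of the unitary group, for an `F`-algebra `R`. -/
def U (R : Type*) [CommRing R] [Algebra F R] : Type _ := unitarySubgroup σ R

instance (R : Type*) [CommRing R] [Algebra F R] : Group (U σ R) :=
  inferInstanceAs (Group (unitarySubgroup σ R))

/-- The underlying element of `R ⊗ D`. -/
def U.val {R : Type*} [CommRing R] [Algebra F R] (u : U σ R) : R ⊗[F] D :=
  ((show unitarySubgroup σ R from u).1 : R ⊗[F] D)

section val

variable {R : Type*} [CommRing R] [Algebra F R]

lemma U.ext {u v : U σ R} (h : U.val σ u = U.val σ v) : u = v :=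
  Subtype.ext (Units.ext h)

lemma U.val_mul (u v : U σ R) : U.val σ (u * v) = U.val σ u * U.val σ v := rfl

lemma U.val_inv (u : U σ R) : U.val σ u⁻¹ = starR σ R (U.val σ u) := by
  have hu : (u.1 : R ⊗[F] D) * starR σ R u.1 = 1 := u.2
  exact Units.inv_eq_of_mul_eq_one_right hu

end val

/-- Functoriality of `U` in the `F`-algebra. -/
def U.map {R S : Type*} [CommRing R] [Algebra F R] [CommRing S] [Algebra F S] (f : R →ₐ[F] S) :
    U σ R →* U σ S :=
  ((Units.map (Algebra.TensorProduct.map f (AlgHom.id F D) : R ⊗[F] D →* S ⊗[F] D)).comp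
    (unitarySubgroup σ R).subtype).codRestrict (unitarySubgroup σ S) (by
      have key : ∀ x : R ⊗[F] D, starR σ S (Algebra.TensorProduct.map f (AlgHom.id F D) x) =
          Algebra.TensorProduct.map f (AlgHom.id F D) (starR σ R x) := by
        intro x
        induction x using TensorProduct.induction_on with
        | zero => simp
        | add a b ha hb => simp [ha, hb]
        | tmul r d => simp
      rintro ⟨x, hx⟩
      change Algebra.TensorProduct.map f (AlgHom.id F D) (x : R ⊗[F] D) *
        starR σ S (Algebra.TensorProduct.map f (AlgHom.id F D) (x : R ⊗[F] D)) = 1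
      rw [key, ← map_mul, show (x : R ⊗[F] D) * starR σ R x = 1 from hx, map_one])

lemma U.val_map {R S : Type*} [CommRing R] [Algebra F R] [CommRing S] [Algebra F S]
    (f : R →ₐ[F] S) (u : U σ R) :
    U.val σ (U.map σ f u) = Algebra.TensorProduct.map f (AlgHom.id F D) (U.val σ u) := rfl

/-- For a topological `F`-algebra `R`, the finite free `R`-module `R ⊗ D` has its module topology
and `U(R)` the subspace topology (inversion is `x ↦ x⋆`, so the embedding in the unit group gives
the same topology). -/
instance (R : Type*) [CommRing R] [Algebra F R] [TopologicalSpace R] : TopologicalSpace (U σ R) :=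
  TopologicalSpace.induced (U.val σ) (moduleTopology R (R ⊗[F] D))

instance (R : Type*) [CommRing R] [Algebra F R] [TopologicalSpace R] [IsTopologicalRing R]
    [FiniteDimensional F D] : IsTopologicalGroup (U σ R) := by
  let : TopologicalSpace (R ⊗[F] D) := moduleTopology R (R ⊗[F] D)
  have : IsModuleTopology R (R ⊗[F] D) := ⟨rfl⟩
  have : IsTopologicalRing (R ⊗[F] D) := IsModuleTopology.isTopologicalRing R (R ⊗[F] D)
  have hv : Continuous (U.val σ : U σ R → R ⊗[F] D) := continuous_induced_dom
  refine { continuous_mul := ?_, continuous_inv := ?_ }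
  · refine continuous_induced_rng.2 ?_
    exact (hv.comp continuous_fst).mul (hv.comp continuous_snd)
  · refine continuous_induced_rng.2 ?_
    have : (U.val σ ∘ fun u : U σ R => u⁻¹) = fun u => starR σ R (U.val σ u) :=
      funext fun u => U.val_inv σ u
    rw [this]
    exact (IsModuleTopology.continuous_of_linearMap (starR σ R)).comp hv

end Unitary

/-! ### Adelic points -/

section Adelic

variable {F K D : Type*} [Field F] [NumberField F] [Field K] [Algebra F K]
  [Ring D] [Algebra F D] [Algebra K D] {c : K ≃ₐ[F] K} (σ : AntiInvolution D c)

/-- The component of a finite adele at `v`. -/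
def adeleEval (v : HeightOneSpectrum (𝓞 F)) : FiniteAdeleRing (𝓞 F) F →ₐ[F] v.adicCompletion F where
  toFun a := a v
  map_one' := rfl
  map_mul' _ _ := rfl
  map_zero' := rfl
  map_add' _ _ := rfl
  commutes' _ := rfl

/-- `U(𝔸_{F,f}) = G(𝔸_f)`, where `G = Res_{F/ℚ} U`. -/
abbrev GAf : Type _ := U σ (FiniteAdeleRing (𝓞 F) F)

/-- `U(F_v)`. -/
abbrev ULoc (v : HeightOneSpectrum (𝓞 F)) : Type _ := U σ (v.adicCompletion F)

/-- The component at `v` of a point of `G(𝔸_f)`. -/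
def component (v : HeightOneSpectrum (𝓞 F)) : GAf σ →* ULoc σ v := U.map σ (adeleEval v)

/-- `G(ℚ) = U(F)` embedded diagonally in `G(𝔸_f)`. -/
def rationalPoints : Subgroup (GAf σ) :=
  (U.map σ (Algebra.ofId F (FiniteAdeleRing (𝓞 F) F))).range

/-- The place `v` lies above `p`. -/
def Above (p : ℕ) (v : HeightOneSpectrum (𝓞 F)) : Prop := (p : 𝓞 F) ∈ v.asIdeal

/-- `G(ℚ_p) = ∏_{v ∣ p} U(F_v)`, as the subgroup of `G(𝔸_f)` of elements which are trivial at all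
places not above `p`. -/
def GQp (p : ℕ) : Subgroup (GAf σ) :=
  ⨅ v : {v : HeightOneSpectrum (𝓞 F) // ¬ Above p v}, (component σ v.1).ker

/-- `G(𝔸_f^p)`, as the subgroup of `G(𝔸_f)` of elements which are trivial at all places above
`p`. -/
def GAfp (p : ℕ) : Subgroup (GAf σ) :=
  ⨅ v : {v : HeightOneSpectrum (𝓞 F) // Above p v}, (component σ v.1).ker

lemma adele_tensor_ext [FiniteDimensional F D] {x y : FiniteAdeleRing (𝓞 F) F ⊗[F] D}
    (h : ∀ v, Algebra.TensorProduct.map (adeleEval v) (AlgHom.id F D) x =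
      Algebra.TensorProduct.map (adeleEval v) (AlgHom.id F D) y) : x = y := by
  let b := Module.finBasis F D
  apply (b.baseChange (FiniteAdeleRing (𝓞 F) F)).repr.injective
  ext1 i
  refine FiniteAdeleRing.ext _ fun v => ?_
  have key : ∀ z : FiniteAdeleRing (𝓞 F) F ⊗[F] D,
      adeleEval v ((b.baseChange (FiniteAdeleRing (𝓞 F) F)).repr z i) =
      (b.baseChange (v.adicCompletion F)).repr
        (Algebra.TensorProduct.map (adeleEval v) (AlgHom.id F D) z) i := by
    intro z
    induction z using TensorProduct.induction_on with
    | zero => simp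
    | add a b ha hb => simp [ha, hb]
    | tmul r d => simp [Module.Basis.baseChange_repr_tmul, Algebra.smul_def]
  have := key x
  rw [h v, ← key y] at this
  exact this

lemma GAf_ext [FiniteDimensional F D] {g h : GAf σ}
    (H : ∀ v, component σ v g = component σ v h) : g = h := by
  apply U.ext
  apply adele_tensor_ext
  intro v
  have := congrArg (U.val σ) (H v)
  exact this

lemma GQp_commute [FiniteDimensional F D] (p : ℕ) {a b : GAf σ} (ha : a ∈ GQp σ p)
    (hb : b ∈ GAfp σ p) : a * b = b * a := by
  apply GAf_ext
  intro v
  rw [map_mul, map_mul]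
  by_cases hv : Above p v
  · have : component σ v b = 1 := by
      have := (Subgroup.mem_iInf.1 hb) ⟨v, hv⟩
      exact this
    rw [this, one_mul, mul_one]
  · have : component σ v a = 1 := by
      have := (Subgroup.mem_iInf.1 ha) ⟨v, hv⟩
      exact this
    rw [this, one_mul, mul_one]

/-- A decomposable tame level `K^p = ∏_{v ∤ p} K_v`: every `K_v ⊂ U(F_v)` is a compact open
subgroup, and so is the product in `G(𝔸_f^p)`. -/
structure TameLevel (p : ℕ) where
  loc : ∀ v : {v : HeightOneSpectrum (𝓞 F) // ¬ Above p v}, Subgroup (ULoc σ v.1)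
  isCompact_loc : ∀ v, IsCompact (loc v : Set (ULoc σ v.1))
  isOpen_loc : ∀ v, IsOpen (loc v : Set (ULoc σ v.1))
  toSubgroup : Subgroup (GAf σ)
  mem_toSubgroup : ∀ g, g ∈ toSubgroup ↔ g ∈ GAfp σ p ∧ ∀ v, component σ v.1 g ∈ loc v
  isCompact_toSubgroup : IsCompact (toSubgroup : Set (GAf σ))
  isOpen_toSubgroup : IsOpen (toSubgroup.subgroupOf (GAfp σ p) : Set (GAfp σ p))

variable {σ} in
lemma TameLevel.le {p : ℕ} (Kp : TameLevel σ p) : Kp.toSubgroup ≤ GAfp σ p :=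
  fun g hg => ((Kp.mem_toSubgroup g).1 hg).1

/-- `v` is unramified in `K`. -/
def UnramifiedIn (K : Type*) [Field K] [Algebra F K] (v : HeightOneSpectrum (𝓞 F)) : Prop :=
  ∀ (w : Ideal (𝓞 K)) [w.IsPrime], w.LiesOver v.asIdeal → Algebra.IsUnramifiedAt (𝓞 F) w

/-- The map `c` on `K_v = F_v ⊗ K`. -/
def conjLoc (c : K ≃ₐ[F] K) (v : HeightOneSpectrum (𝓞 F)) :
    (v.adicCompletion F ⊗[F] K) →ₐ[v.adicCompletion F] (v.adicCompletion F ⊗[F] K) :=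
  Algebra.TensorProduct.map (AlgHom.id _ _) (c : K →ₐ[F] K)

/-- A subgroup of `U(F_v)` is hyperspecial if `v` is unramified in `K` and there is an isomorphism
of `(D_v, ⋆)` with the matrix algebra `M_n(K_v)` with its conjugate-transpose involution, which
identifies the subgroup with the integral points `{x ∈ M_n(𝒪_{K_v}) : x x* = 1}` of the standard
reductive model. -/
def IsHyperspecial (n : ℕ) (v : HeightOneSpectrum (𝓞 F)) (H : Subgroup (ULoc σ v)) : Prop :=
  UnramifiedIn K v ∧
  ∃ φ : (v.adicCompletion F ⊗[F] D) ≃ₐ[v.adicCompletion F]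
      Matrix (Fin n) (Fin n) (v.adicCompletion F ⊗[F] K),
    (∀ x, φ (starR σ (v.adicCompletion F) x) = (φ x).transpose.map (conjLoc c v)) ∧
    ∀ u : ULoc σ v, u ∈ H ↔ ∀ i j,
      φ (U.val σ u) i j ∈
        integralClosure (v.adicCompletionIntegers F) (v.adicCompletion F ⊗[F] K)

/-- `p` does not divide the orders of the (finite) arithmetic groups `G(ℚ) ∩ g K_p K^p g⁻¹`, for
`K_p` a compact open subgroup of `G(ℚ_p)` and `g ∈ G(𝔸_f)`: they have no element of order `p`. -/
def SufficientlySmall (p : ℕ) (Kp : TameLevel σ p) : Prop :=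
  ∀ H : Subgroup (GQp σ p), IsOpen (H : Set (GQp σ p)) → IsCompact (H : Set (GQp σ p)) →
    ∀ g γ : GAf σ, γ ∈ rationalPoints σ →
      g⁻¹ * γ * g ∈ H.map (GQp σ p).subtype ⊔ Kp.toSubgroup → orderOf γ ≠ p

/-- A compact open subgroup is pro-`p`: its open normal subgroups have `p`-power index. -/
def IsProP (p : ℕ) (H : Type*) [Group H] [TopologicalSpace H] : Prop :=
  ∀ N : Subgroup H, N.Normal → IsOpen (N : Set H) → ∃ k : ℕ, N.index = p ^ k

end Adelic

/-! ### Completed cohomology in degree zero -/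

section Completed

variable {F K D : Type*} [Field F] [NumberField F] [Field K] [Algebra F K]
  [Ring D] [Algebra F D] [Algebra K D] [FiniteDimensional F D] {c : K ≃ₐ[F] K}
  {σ : AntiInvolution D c} {p : ℕ} (Kp : TameLevel σ p) (O : Type*) [CommRing O]

section H0

variable (A : Type*) [AddCommGroup A] [Module O A]

/-- The functions `G(ℚ) \ G(𝔸_f) / K^p → A` which are right invariant under some open subgroup of
`G(ℚ_p)`. -/
def smoothForms : Submodule O (GAf σ → A) where
  carrier := {f | (∀ γ ∈ rationalPoints σ, ∀ x, f (γ * x) = f x) ∧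
    (∀ k ∈ Kp.toSubgroup, ∀ x, f (x * k) = f x) ∧
    ∃ H : Subgroup (GQp σ p), IsOpen (H : Set (GQp σ p)) ∧ ∀ k ∈ H, ∀ x, f (x * k) = f x}
  zero_mem' := ⟨fun _ _ _ => rfl, fun _ _ _ => rfl, ⊤, isOpen_univ, fun _ _ _ => rfl⟩
  add_mem' := by
    rintro f g ⟨hf1, hf2, H, hH, hf3⟩ ⟨hg1, hg2, H', hH', hg3⟩
    refine ⟨fun γ hγ x => ?_, fun k hk x => ?_, H ⊓ H', hH.inter hH', fun k hk x => ?_⟩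
    · simp [hf1 γ hγ x, hg1 γ hγ x]
    · simp [hf2 k hk x, hg2 k hk x]
    · simp [hf3 k hk.1 x, hg3 k hk.2 x]
  smul_mem' := by
    rintro a f ⟨hf1, hf2, H, hH, hf3⟩
    refine ⟨fun γ hγ x => ?_, fun k hk x => ?_, H, hH, fun k hk x => ?_⟩
    · simp [hf1 γ hγ x]
    · simp [hf2 k hk x]
    · simp [hf3 k hk x]

/-- `H⁰(K^p, A) = colim_{K_p} H⁰(Y(K_p K^p), A)` with `Y(K) = G(ℚ) \ G(𝔸_f) / K`; the transition
maps are the inclusions of spaces of functions on `G(𝔸_f)`. -/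
def H0 : Type _ := smoothForms Kp O A

instance : AddCommGroup (H0 Kp O A) := inferInstanceAs (AddCommGroup (smoothForms Kp O A))
instance : Module O (H0 Kp O A) := inferInstanceAs (Module O (smoothForms Kp O A))
/-- `H⁰(K^p, A)` is discrete. -/
instance : TopologicalSpace (H0 Kp O A) := ⊥
instance : DiscreteTopology (H0 Kp O A) := ⟨rfl⟩

variable {Kp O A}

/-- The underlying function on `G(𝔸_f)`. -/
def H0.fn : H0 Kp O A →ₗ[O] (GAf σ → A) := (smoothForms Kp O A).subtype

lemma H0.ext {f g : H0 Kp O A} (h : ∀ x, H0.fn f x = H0.fn g x) : f = g :=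
  Subtype.ext (funext h)

variable (Kp O A)

/-- Right translation by `g ∈ G(ℚ_p)` on `H⁰(K^p, A)`. -/
def H0.translate (g : GQp σ p) : H0 Kp O A →ₗ[O] H0 Kp O A :=
  LinearMap.codRestrict (smoothForms Kp O A)
    ((LinearMap.funLeft O A (fun x : GAf σ => x * (g : GAf σ))).comp H0.fn) (by
      rintro ⟨f, hf1, hf2, H, hH, hf3⟩
      refine ⟨fun γ hγ x => ?_, fun k hk x => ?_,
        H.comap (MulAut.conj g⁻¹).toMonoidHom, ?_, fun k hk x => ?_⟩
      · change f (γ * x * g) = f (x * g)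
        rw [mul_assoc, hf1 γ hγ]
      · change f (x * k * g) = f (x * g)
        rw [mul_assoc, ← GQp_commute σ p g.2 (Kp.le hk), ← mul_assoc, hf2 k hk]
      · refine hH.preimage (f := fun k : GQp σ p => g⁻¹ * k * g⁻¹⁻¹) ?_
        fun_prop
      · change f (x * k * g) = f (x * g)
        have h := hf3 (g⁻¹ * k * g⁻¹⁻¹) hk (x * g)
        rw [← h]
        congr 1
        simp [mul_assoc])

lemma H0.translate_fn (g : GQp σ p) (f : H0 Kp O A) (x : GAf σ) :
    H0.fn (H0.translate Kp O A g f) x = H0.fn f (x * g) := rfl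

/-- The set of left cosets `h K^p` contained in the double coset `K^p g K^p`. -/
def heckeCosets (g : GAf σ) : Set (GAf σ ⧸ Kp.toSubgroup) :=
  MulAction.orbit Kp.toSubgroup (g : GAf σ ⧸ Kp.toSubgroup)

lemma heckeCosets_finite {g : GAf σ} (hg : g ∈ GAfp σ p) : (heckeCosets Kp g).Finite := by
  have : CompactSpace Kp.toSubgroup := isCompact_iff_compactSpace.1 Kp.isCompact_toSubgroup
  let S : Subgroup Kp.toSubgroup :=
    MulAction.stabilizer Kp.toSubgroup (g : GAf σ ⧸ Kp.toSubgroup)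
  have hS : IsOpen (S : Set Kp.toSubgroup) := by
    let ψ : Kp.toSubgroup → GAfp σ p := fun k =>
      ⟨g⁻¹ * (k : GAf σ) * g, mul_mem (mul_mem (inv_mem hg) (Kp.le k.2)) hg⟩
    have hψ : Continuous ψ := by
      refine Continuous.subtype_mk ?_ _
      fun_prop
    have := Kp.isOpen_toSubgroup.preimage hψ
    convert! this using 1
    ext k
    change k • (g : GAf σ ⧸ Kp.toSubgroup) = g ↔ g⁻¹ * (k : GAf σ) * g ∈ Kp.toSubgroup
    change (((k : GAf σ) * g : GAf σ) : GAf σ ⧸ Kp.toSubgroup) = g ↔ _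
    rw [eq_comm, QuotientGroup.eq, mul_assoc]
  have : Finite (Kp.toSubgroup ⧸ S) := Subgroup.quotient_finite_of_isOpen S hS
  exact Set.finite_coe_iff.1 (Finite.of_equiv _
    (MulAction.orbitEquivQuotientStabilizer Kp.toSubgroup (g : GAf σ ⧸ Kp.toSubgroup)).symm)

lemma H0.fn_eq_of_coset (f : H0 Kp O A) (x : GAf σ) {a b : GAf σ}
    (h : (a : GAf σ ⧸ Kp.toSubgroup) = b) : H0.fn f (x * a) = H0.fn f (x * b) := by
  have := f.2.2.1 _ (QuotientGroup.eq.1 h) (x * a)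
  change H0.fn f (x * a * (a⁻¹ * b)) = H0.fn f (x * a) at this
  rw [← this]
  simp [mul_assoc]

/-- The operator of the double coset `K^p g K^p = ⊔ h K^p` on `H⁰(K^p, A)`, for `g ∈ G(𝔸_f^p)`:
`(T f)(x) = ∑_h f(x h)`. -/
def H0.hecke (g : GAfp σ p) : H0 Kp O A →ₗ[O] H0 Kp O A :=
  LinearMap.codRestrict (smoothForms Kp O A)
    (∑ q ∈ (heckeCosets_finite Kp g.2).toFinset,
      (LinearMap.funLeft O A (fun x : GAf σ => x * q.out)).comp H0.fn) (by
      intro f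
      have hfn : ∀ x, (∑ q ∈ (heckeCosets_finite Kp g.2).toFinset,
          (LinearMap.funLeft O A (fun x : GAf σ => x * q.out)).comp H0.fn) f x =
          ∑ q ∈ (heckeCosets_finite Kp g.2).toFinset, H0.fn f (x * q.out) := by
        intro x
        simp [LinearMap.funLeft_apply]
      obtain ⟨h1, h2, H, hH, h3⟩ := f.2
      refine ⟨fun γ hγ x => ?_, fun k hk x => ?_, H, hH, fun k hk x => ?_⟩
      · rw [hfn, hfn]
        refine Finset.sum_congr rfl fun q _ => ?_
        rw [mul_assoc]
        exact h1 γ hγ _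
      · rw [hfn, hfn]
        refine Finset.sum_bij (fun q _ => (⟨k, hk⟩ : Kp.toSubgroup) • q) ?_ ?_ ?_ ?_
        · intro q hq
          rw [Set.Finite.mem_toFinset] at hq ⊢
          exact (MulAction.mem_orbit_of_mem_orbit _ hq)
        · intro q _ q' _ h
          exact smul_left_cancel _ h
        · intro q hq
          rw [Set.Finite.mem_toFinset] at hq
          refine ⟨(⟨k, hk⟩ : Kp.toSubgroup)⁻¹ • q, ?_, by simp⟩
          rw [Set.Finite.mem_toFinset]
          exact MulAction.mem_orbit_of_mem_orbit _ hq
        · intro q _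
          rw [mul_assoc]
          apply H0.fn_eq_of_coset
          have e1 : ((((⟨k, hk⟩ : Kp.toSubgroup) • q).out : GAf σ) : GAf σ ⧸ Kp.toSubgroup) =
              (⟨k, hk⟩ : Kp.toSubgroup) • q := Quotient.out_eq' _
          have e2 : ((q.out : GAf σ) : GAf σ ⧸ Kp.toSubgroup) = q := Quotient.out_eq' _
          rw [e1]
          conv_rhs => rw [← e2]
          rfl
      · rw [hfn, hfn]
        refine Finset.sum_congr rfl fun q hq => ?_
        rw [Set.Finite.mem_toFinset] at hq
        obtain ⟨k', hk'⟩ := hq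
        have e : ((k' * g : GAf σ) : GAf σ ⧸ Kp.toSubgroup) = (q.out : GAf σ) := by
          rw [← hk']
          exact (Quotient.out_eq' _).symm
        rw [← H0.fn_eq_of_coset Kp O A f (x * k) e, ← H0.fn_eq_of_coset Kp O A f x e,
          mul_assoc x, GQp_commute σ p k.2 (mul_mem (Kp.le k'.2) g.2), ← mul_assoc]
        exact h3 k hk _)

lemma H0.hecke_fn (g : GAfp σ p) (f : H0 Kp O A) (x : GAf σ) :
    H0.fn (H0.hecke Kp O A g f) x =
      ∑ q ∈ (heckeCosets_finite Kp g.2).toFinset, H0.fn f (x * q.out) := by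
  change (∑ q ∈ (heckeCosets_finite Kp g.2).toFinset,
    (LinearMap.funLeft O A (fun x : GAf σ => x * q.out)).comp H0.fn) f x = _
  simp [LinearMap.funLeft_apply]

end H0

variable (I : Ideal O)

/-- Compatible families in `∏_s H⁰(K^p, 𝒪/I^s)`. -/
def compatibleForms : Submodule O (∀ s : ℕ, H0 Kp O (O ⧸ I ^ s)) where
  carrier := {f | ∀ (s t : ℕ) (h : s ≤ t) (x : GAf σ),
    Ideal.Quotient.factorPow I h (H0.fn (f t) x) = H0.fn (f s) x}
  zero_mem' := by intro s t h x; simp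
  add_mem' := by intro f g hf hg s t h x; simp [hf s t h x, hg s t h x]
  smul_mem' := by
    intro a f hf s t h x
    have := hf s t h x
    simp only [Pi.smul_apply, map_smul]
    rw [Algebra.smul_def, Algebra.smul_def, map_mul, this]
    rfl

/-- `H̃⁰(K^p)° = lim_s H⁰(K^p, 𝒪/I^s)`, with the inverse limit topology of the discrete
`H⁰(K^p, 𝒪/I^s)`. -/
def CompletedH0 : Type _ := compatibleForms Kp O I

instance : AddCommGroup (CompletedH0 Kp O I) := inferInstanceAs (AddCommGroup (compatibleForms Kp O I))
instance : Module O (CompletedH0 Kp O I) := inferInstanceAs (Module O (compatibleForms Kp O I))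
instance : TopologicalSpace (CompletedH0 Kp O I) :=
  inferInstanceAs (TopologicalSpace (compatibleForms Kp O I))

/-- The action of `G(ℚ_p)` on `H̃⁰(K^p)°` by right translation. -/
def translation : Representation O (GQp σ p) (CompletedH0 Kp O I) where
  toFun g := LinearMap.codRestrict (compatibleForms Kp O I)
    ((LinearMap.pi fun s => (H0.translate Kp O (O ⧸ I ^ s) g).comp (LinearMap.proj s)).comp
      (compatibleForms Kp O I).subtype) (fun f s t h x => f.2 s t h (x * g))
  map_one' := by
    refine LinearMap.ext fun f => Subtype.ext (funext fun s => H0.ext fun x => ?_)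
    change H0.fn (f.1 s) (x * 1) = _
    rw [mul_one]
    rfl
  map_mul' g g' := by
    refine LinearMap.ext fun f => Subtype.ext (funext fun s => H0.ext fun x => ?_)
    change H0.fn (f.1 s) (x * (g * g')) = H0.fn (f.1 s) (x * g * g')
    rw [mul_assoc]

/-- The double coset operator of `g ∈ G(𝔸_f^p)` on `H̃⁰(K^p)°`. -/
def heckeOperator (g : GAfp σ p) : Module.End O (CompletedH0 Kp O I) :=
  LinearMap.codRestrict (compatibleForms Kp O I)
    ((LinearMap.pi fun s => (H0.hecke Kp O (O ⧸ I ^ s) g).comp (LinearMap.proj s)).comp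
      (compatibleForms Kp O I).subtype) (by
      intro f s t h x
      change Ideal.Quotient.factorPow I h (H0.fn (H0.hecke Kp O _ g (f.1 t)) x) =
        H0.fn (H0.hecke Kp O _ g (f.1 s)) x
      rw [H0.hecke_fn, H0.hecke_fn, map_sum]
      exact Finset.sum_congr rfl fun q _ => f.2 s t h _)

/-- The image in `End_𝒪 H̃⁰(K^p)°` of the spherical Hecke algebra
`H_𝒪(K^p)^sph = ⨂_{v ∤ p, v ∉ S} H_𝒪(K_v)`, which has as an `𝒪`-basis the double cosets
`K^p g K^p` with `g ∈ G(𝔸_f^p)` trivial at the places in `S`. -/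
def sphericalImage (S : Finset (HeightOneSpectrum (𝓞 F))) :
    Subalgebra O (Module.End O (CompletedH0 Kp O I)) :=
  Algebra.adjoin O {T | ∃ g : GAfp σ p, (∀ v ∈ S, component σ v g = 1) ∧ T = heckeOperator Kp O I g}

lemma sphericalImage_continuous (S : Finset (HeightOneSpectrum (𝓞 F)))
    {T : Module.End O (CompletedH0 Kp O I)} (hT : T ∈ sphericalImage Kp O I S) : Continuous T := by
  have hsm : ∀ a : O, Continuous fun f : CompletedH0 Kp O I => a • f := fun a =>
    Continuous.subtype_mk (continuous_pi fun s =>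
      (continuous_of_discreteTopology (f := fun y : H0 Kp O (O ⧸ I ^ s) => a • y)).comp
        ((continuous_apply s).comp continuous_subtype_val)) _
  have hadd : Continuous fun f : CompletedH0 Kp O I × CompletedH0 Kp O I => f.1 + f.2 :=
    Continuous.subtype_mk (continuous_pi fun s =>
      (continuous_of_discreteTopology
        (f := fun y : H0 Kp O (O ⧸ I ^ s) × H0 Kp O (O ⧸ I ^ s) => y.1 + y.2)).comp
        (((continuous_apply s).comp (continuous_subtype_val.comp continuous_fst)).prodMk
          ((continuous_apply s).comp (continuous_subtype_val.comp continuous_snd)))) _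
  induction hT using Algebra.adjoin_induction with
  | mem T h =>
    obtain ⟨g, -, rfl⟩ := h
    exact Continuous.subtype_mk (continuous_pi fun s =>
      (continuous_of_discreteTopology (f := H0.hecke Kp O (O ⧸ I ^ s) g)).comp
        ((continuous_apply s).comp continuous_subtype_val)) _
  | algebraMap a => exact hsm a
  | add T T' _ _ h h' => exact hadd.comp (h.prodMk h')
  | mul T T' _ _ h h' => exact h.comp h'

/-- `𝕋(K^p) ⊂ End_𝒪 H̃⁰(K^p)°`, the closure of the image of the spherical Hecke algebra (for the
topology of pointwise convergence on `H̃⁰(K^p)°`). -/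
def bigHecke (S : Finset (HeightOneSpectrum (𝓞 F))) :
    Subalgebra O (Module.End O (CompletedH0 Kp O I)) where
  carrier := {T | (T : CompletedH0 Kp O I → CompletedH0 Kp O I) ∈
    closure ((fun t : Module.End O (CompletedH0 Kp O I) =>
      (t : CompletedH0 Kp O I → CompletedH0 Kp O I)) '' (sphericalImage Kp O I S))}
  algebraMap_mem' a := subset_closure ⟨_, (sphericalImage Kp O I S).algebraMap_mem a, rfl⟩
  add_mem' := by
    intro T T' hT hT'
    have hadd : Continuous fun f : CompletedH0 Kp O I × CompletedH0 Kp O I => f.1 + f.2 :=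
      Continuous.subtype_mk (continuous_pi fun s =>
        (continuous_of_discreteTopology
          (f := fun y : H0 Kp O (O ⧸ I ^ s) × H0 Kp O (O ⧸ I ^ s) => y.1 + y.2)).comp
          (((continuous_apply s).comp (continuous_subtype_val.comp continuous_fst)).prodMk
            ((continuous_apply s).comp (continuous_subtype_val.comp continuous_snd)))) _
    refine map_mem_closure₂ (f := fun a b : CompletedH0 Kp O I → CompletedH0 Kp O I =>
      fun x => a x + b x) ?_ hT hT' ?_
    · refine continuous_pi fun x => ?_
      exact hadd.comp (((continuous_apply x).comp continuous_fst).prodMk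
          ((continuous_apply x).comp continuous_snd) :
        Continuous fun q : (CompletedH0 Kp O I → CompletedH0 Kp O I) ×
          (CompletedH0 Kp O I → CompletedH0 Kp O I) => (q.1 x, q.2 x))
    · rintro _ ⟨t, ht, rfl⟩ _ ⟨t', ht', rfl⟩
      exact ⟨t + t', add_mem ht ht', rfl⟩
  mul_mem' := by
    intro T T' hT hT'
    have step : ∀ t ∈ sphericalImage Kp O I S, (fun x => t (T' x)) ∈
        closure ((fun t : Module.End O (CompletedH0 Kp O I) =>
          (t : CompletedH0 Kp O I → CompletedH0 Kp O I)) '' (sphericalImage Kp O I S)) := by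
      intro t ht
      refine map_mem_closure (f := fun b : CompletedH0 Kp O I → CompletedH0 Kp O I =>
        fun x => t (b x)) ?_ hT' ?_
      · exact continuous_pi fun x =>
          (sphericalImage_continuous Kp O I S ht).comp (continuous_apply x)
      · rintro _ ⟨t', ht', rfl⟩
        exact ⟨t * t', mul_mem ht ht', rfl⟩
    have := map_mem_closure (f := fun a : CompletedH0 Kp O I → CompletedH0 Kp O I =>
      fun x => a (T' x)) (continuous_pi fun x => continuous_apply (T' x)) hT
      (t := closure ((fun t : Module.End O (CompletedH0 Kp O I) =>
        (t : CompletedH0 Kp O I → CompletedH0 Kp O I)) '' (sphericalImage Kp O I S))) (by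
        rintro _ ⟨t, ht, rfl⟩
        exact step t ht)
    rwa [closure_closure] at this

/-- The ring of integers `𝒪` of a finite extension `L` of `ℚ_p`, with the subspace topology. -/
abbrev Int𝒪 (p : ℕ) [Fact p.Prime] (L : Type*) [Field L] [Algebra ℤ_[p] L] : Subalgebra ℤ_[p] L :=
  integralClosure ℤ_[p] L

/-- Right translation by `k` on `C(H, 𝒪)^r`. -/
def translateFun {H : Type*} [Group H] [TopologicalSpace H] [IsTopologicalGroup H]
    {O : Type*} [TopologicalSpace O] {r : ℕ} (k : H) (φ : Fin r → C(H, O)) : Fin r → C(H, O) :=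
  fun i => (φ i).comp ⟨fun x => x * k, by fun_prop⟩

end Completed

end DefiniteUnitary

end

open DefiniteUnitary

/-! Forms are functions on `X = G(ℚ)\G(𝔸_f)/K^p`. Part (1) rests on two facts. The set
`G(ℚ)\G(𝔸_f)/K_pK^p` is finite (`exists_finset_doubleCoset`), and `K_p` acts freely on `X`
(`eq_of_mul_eq_mul`). For the second: if `γ g k κ = g k' κ'`, then `γ` lies in an arithmetic group,
which is finite because the real points are compact. The order of `γ` is prime to `p` by smallness
of `K^p`, so `k' k⁻¹`, the `p`-component of `g⁻¹ γ g`, is killed by an integer prime to `p` in a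
pro-`p` group and is trivial. Hence `X` is `r ≥ 1` copies of `K_p`, and a compatible family of forms
modulo `ϖ^s` amounts to `r` continuous functions `K_p → 𝒪` (`exists_continuousLinearEquiv`).

Finiteness comes from the geometry of numbers in the adelic points of `D`, where `D` is discrete and
cocompact. Compactness at infinity makes the form `d⋆d` anisotropic (`eq_zero_of_star_mul_self`), so
one neighbourhood `W` of `0` has all its translates `gW` injecting modulo `D`. Comparing volumes,
`g` preserves Haar measure, and one compact set `C` is such that `D ∩ gC` spans `D` for every `g`. A
basis of `D` taken from `gC` has its Gram matrix `b_i⋆ b_j` in a finite set, and equality of Gram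
matrices produces a rational unitary element. So `G(𝔸_f)` is `G(ℚ)` times a compact set.

In part (2), commutativity is Gelfand's trick: at a hyperspecial place, transposition is an
anti-automorphism of `U(F_v)` preserving every `K_v`-double coset. In the split case this is the
Smith normal form. In the inert case it needs an isometry, from a Hermitian form to its conjugate,
which interchanges two self-dual lattices; it is built by splitting off lines and planes
(`IsUnimodular.hasSwap`).

For the direct summand, `𝕋` is compact for pointwise convergence, so the closed semigroup generated
by any element contains an idempotent. An idempotent is determined by its action modulo `ϖ` on forms
whose reduction is `K_p`-invariant, since a nonzero smooth `p`-power torsion representation of a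
pro-`p` group has nonzero invariants (`eq_of_idempotent`). These reductions are finite in number, so
there are finitely many idempotents, and the product of those outside `𝔪` is the projector onto the
localization at `𝔪`. -/

noncomputable section

namespace DefiniteUnitary

/-! ### Adeles of a number field: compactness, strong approximation, discreteness -/

section Adeles

open NumberField HeightOneSpectrum Filter Topology WithZero RestrictedProduct

variable {F : Type*} [Field F] [NumberField F]

lemma exists_integer_approx (v : HeightOneSpectrum (𝓞 F)) {x : v.adicCompletion F}
    (hx : x ∈ v.adicCompletionIntegers F) (γ : (ℤᵐ⁰)ˣ) :
    ∃ r : 𝓞 F, Valued.v (x - algebraMap (𝓞 F) (v.adicCompletion F) r) < (γ : ℤᵐ⁰) := by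
  -- The radius is at most `1`, so an approximating element of `F` is again `v`-integral and can
  -- then be replaced by an element of `𝓞 F`.
  have hopen : IsOpen {y : v.adicCompletion F | Valued.v (x - y) < min (γ : ℤᵐ⁰) 1} := by
    have h : IsOpen {y : v.adicCompletion F | Valued.v y < min (γ : ℤᵐ⁰) 1} := by
      obtain ⟨z, hz⟩ := valuedAdicCompletion_surjective (K := F) v (min (γ : ℤᵐ⁰) 1)
      rw [← hz]
      have := Valued.isOpen_ball (v.adicCompletion F)
        ((Valued.v : Valuation (v.adicCompletion F) ℤᵐ⁰).restrict z)
      simpa only [Valuation.restrict_lt_iff] using this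
    exact h.preimage (continuous_const.sub continuous_id)
  obtain ⟨k, hk⟩ := (HeightOneSpectrum.denseRange_algebraMap (R := 𝓞 F) (K := F) (v := v)).exists_mem_open hopen
    ⟨x, by simp⟩
  have hk' : Valued.v (x - algebraMap F (v.adicCompletion F) k) < min (γ : ℤᵐ⁰) 1 := hk
  have hk1 : v.valuation F k ≤ 1 := by
    rw [← valuedAdicCompletion_eq_valuation' v k]
    have : (k : v.adicCompletion F) = x - (x - algebraMap F (v.adicCompletion F) k) := by
      rw [sub_sub_cancel]; rfl
    rw [this]
    refine (Valuation.map_sub _ _ _).trans (max_le hx ?_)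
    exact (hk'.trans_le (min_le_right _ _)).le
  obtain ⟨r, hr⟩ := exists_valuation_sub_lt_of_integer v hk1 γ
  refine ⟨r, ?_⟩
  have h2 : Valued.v (algebraMap F (v.adicCompletion F) k - algebraMap (𝓞 F) (v.adicCompletion F) r)
      < (γ : ℤᵐ⁰) := by
    rw [Valuation.map_sub_swap, IsScalarTower.algebraMap_apply (𝓞 F) F, ← map_sub]
    rw [← valuedAdicCompletion_eq_valuation' v] at hr
    exact hr
  have := Valuation.map_add_lt _ (hk'.trans_le (min_le_left _ _)) h2
  simpa using this

/-- A complete discrete valuation ring with finite residue field is compact. The residue field is a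
quotient of `𝓞 F ⧸ v` because integral elements are approximated by `𝓞 F`. -/
instance compactSpace_integers (v : HeightOneSpectrum (𝓞 F)) :
    CompactSpace (v.adicCompletionIntegers F) := by
  have h := (Valued.integer.compactSpace_iff_completeSpace_and_isDiscreteValuationRing_and_finite_residueField
    (K := v.adicCompletion F) (Γ₀ := ℤᵐ⁰)).2
  refine h ⟨?_, inferInstanceAs (IsDiscreteValuationRing (v.adicCompletionIntegers F)), ?_⟩
  · exact (Valued.isClosed_integer (v.adicCompletion F)).completeSpace_coe
  · have hfin : Finite (𝓞 F ⧸ v.asIdeal) := Ideal.finiteQuotientOfFreeOfNeBot v.asIdeal v.ne_bot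
    let f : 𝓞 F →+* IsLocalRing.ResidueField (v.adicCompletionIntegers F) :=
      (IsLocalRing.residue _).comp (algebraMap (𝓞 F) (v.adicCompletionIntegers F))
    have hlt : ∀ y : v.adicCompletionIntegers F, IsLocalRing.residue _ y = 0 ↔
        Valued.v (y : v.adicCompletion F) < 1 := by
      intro y
      rw [IsLocalRing.residue_eq_zero_iff, IsLocalRing.mem_maximalIdeal, mem_nonunits_iff,
        adicCompletionIntegers.isUnit_iff_valued_eq_one]
      have : Valued.v (y : v.adicCompletion F) ≤ 1 := y.2
      exact ⟨fun h => lt_of_le_of_ne this h, ne_of_lt⟩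
    have hf : Function.Surjective (Ideal.Quotient.lift v.asIdeal f (by
        intro a ha
        refine (hlt _).2 ?_
        rw [algebraMap_adicCompletionIntegers_apply]
        rw [valuedAdicCompletion_eq_valuation']
        exact (valuation_lt_one_iff_mem v a).2 ha)) := by
      intro z
      obtain ⟨y, rfl⟩ := IsLocalRing.residue_surjective z
      obtain ⟨r, hr⟩ := exists_integer_approx v y.2 1
      refine ⟨Ideal.Quotient.mk _ r, ?_⟩
      rw [Ideal.Quotient.lift_mk, eq_comm, ← sub_eq_zero]
      change IsLocalRing.residue _ y - IsLocalRing.residue _ _ = 0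
      rw [← map_sub, hlt]
      exact hr
    exact Finite.of_surjective _ hf

instance factIsOpen_integers :
    Fact (∀ v : HeightOneSpectrum (𝓞 F),
      IsOpen (v.adicCompletionIntegers F : Set (v.adicCompletion F))) :=
  ⟨fun _ => Valued.isOpen_valuationSubring _⟩

instance : LocallyCompactSpace (FiniteAdeleRing (𝓞 F) F) :=
  inferInstanceAs (LocallyCompactSpace
    (Πʳ v : HeightOneSpectrum (𝓞 F), [v.adicCompletion F, v.adicCompletionIntegers F]))

instance : T2Space (FiniteAdeleRing (𝓞 F) F) :=
  inferInstanceAs (T2Space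
    (Πʳ v : HeightOneSpectrum (𝓞 F), [v.adicCompletion F, v.adicCompletionIntegers F]))

lemma continuous_adeleEval (v : HeightOneSpectrum (𝓞 F)) : Continuous (adeleEval v) :=
  RestrictedProduct.continuous_eval v

/-- A continuous injection into the product of the completions suffices; it need not be an
embedding. -/
instance : TotallyDisconnectedSpace (FiniteAdeleRing (𝓞 F) F) := by
  let f : FiniteAdeleRing (𝓞 F) F → ∀ v : HeightOneSpectrum (𝓞 F), v.adicCompletion F :=
    fun a v => adeleEval v a
  have hf : Continuous f := continuous_pi fun v => continuous_adeleEval v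
  have hi : Function.Injective f := fun a b h => FiniteAdeleRing.ext _ fun v => congrFun h v
  refine ⟨fun t _ ht => ?_⟩
  have := (isTotallyDisconnected_of_totallyDisconnectedSpace (f '' t)) _ subset_rfl
    (ht.image f hf.continuousOn)
  exact fun x hx y hy => hi (this ⟨x, hx, rfl⟩ ⟨y, hy, rfl⟩)

variable (F) in
/-- The integral finite adeles. -/
def integralAdeles : Subring (FiniteAdeleRing (𝓞 F) F) :=
  ⨅ v : HeightOneSpectrum (𝓞 F),
    (v.adicCompletionIntegers F).toSubring.comap (adeleEval v).toRingHom

lemma mem_integralAdeles {a : FiniteAdeleRing (𝓞 F) F} :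
    a ∈ integralAdeles F ↔ ∀ v, a v ∈ v.adicCompletionIntegers F := by
  simp only [integralAdeles, Subring.mem_iInf]
  rfl

lemma integralAdeles_eq_range : (integralAdeles F : Set (FiniteAdeleRing (𝓞 F) F)) =
    Set.range (RestrictedProduct.structureMap
      (fun v : HeightOneSpectrum (𝓞 F) => v.adicCompletion F)
      (fun v => (v.adicCompletionIntegers F : Set (v.adicCompletion F))) cofinite) := by
  rw [RestrictedProduct.range_structureMap]
  ext a
  exact mem_integralAdeles

lemma isCompact_integralAdeles : IsCompact (integralAdeles F : Set (FiniteAdeleRing (𝓞 F) F)) := by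
  rw [integralAdeles_eq_range]
  have : ∀ v : HeightOneSpectrum (𝓞 F),
      CompactSpace (v.adicCompletionIntegers F : Set (v.adicCompletion F)) :=
    fun v => compactSpace_integers v
  exact isCompact_range (RestrictedProduct.isEmbedding_structureMap).continuous

lemma isOpen_integralAdeles : IsOpen (integralAdeles F : Set (FiniteAdeleRing (𝓞 F) F)) := by
  rw [integralAdeles_eq_range]
  exact (RestrictedProduct.isOpenEmbedding_structureMap (factIsOpen_integers (F := F)).out).isOpen_range

lemma eventually_mem_integers (a : FiniteAdeleRing (𝓞 F) F) :
    ∀ᶠ v in cofinite, a v ∈ v.adicCompletionIntegers F := a.2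

/-- Every neighbourhood of `0` in the finite adeles contains the integral adeles which vanish at
finitely many places. -/
lemma exists_finset_of_mem_nhds_zero {W : Set (FiniteAdeleRing (𝓞 F) F)} (hW : W ∈ 𝓝 0) :
    ∃ T : Finset (HeightOneSpectrum (𝓞 F)), ∀ a : FiniteAdeleRing (𝓞 F) F,
      a ∈ integralAdeles F → (∀ v ∈ T, a v = 0) → a ∈ W := by
  let s := RestrictedProduct.structureMap
      (fun v : HeightOneSpectrum (𝓞 F) => v.adicCompletion F)
      (fun v => (v.adicCompletionIntegers F : Set (v.adicCompletion F))) cofinite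
  let z : ∀ v : HeightOneSpectrum (𝓞 F), (v.adicCompletionIntegers F : Set (v.adicCompletion F)) :=
    fun v => ⟨0, zero_mem _⟩
  have hs : Continuous s := (RestrictedProduct.isEmbedding_structureMap).continuous
  have h0 : s z = (0 : FiniteAdeleRing (𝓞 F) F) := rfl
  have hW' : s ⁻¹' W ∈ 𝓝 z := hs.continuousAt.preimage_mem_nhds (by rw [h0]; exact hW)
  rw [nhds_pi, Filter.mem_pi] at hW'
  obtain ⟨I, hI, t, ht, hsub⟩ := hW'
  refine ⟨hI.toFinset, fun a ha haT => ?_⟩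
  have : a = s (fun v => ⟨a v, mem_integralAdeles.1 ha v⟩) := rfl
  rw [this]
  refine hsub fun v hv => ?_
  have : (⟨a v, mem_integralAdeles.1 ha v⟩ :
      (v.adicCompletionIntegers F : Set (v.adicCompletion F))) = z v :=
    Subtype.ext (haT v (hI.mem_toFinset.2 hv))
  change (⟨a v, mem_integralAdeles.1 ha v⟩ :
      (v.adicCompletionIntegers F : Set (v.adicCompletion F))) ∈ t v
  rw [this]
  exact mem_of_mem_nhds (ht v)

/-- A common denominator. -/
lemma exists_smul_mem_integralAdeles (a : FiniteAdeleRing (𝓞 F) F) :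
    ∃ d : 𝓞 F, d ≠ 0 ∧ algebraMap F (FiniteAdeleRing (𝓞 F) F) d * a ∈ integralAdeles F := by
  classical
  have hfin := eventually_mem_integers a
  rw [Filter.eventually_cofinite] at hfin
  choose b hb hab using fun v : HeightOneSpectrum (𝓞 F) =>
    adicCompletion.mul_nonZeroDivisor_mem_adicCompletionIntegers v (a v)
  refine ⟨∏ v ∈ hfin.toFinset, b v,
    Finset.prod_ne_zero_iff.2 fun v _ => nonZeroDivisors.ne_zero (hb v), ?_⟩
  rw [mem_integralAdeles]
  intro v
  change algebraMap F (v.adicCompletion F) (algebraMap (𝓞 F) F (∏ v ∈ hfin.toFinset, b v)) * a v ∈ _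
  rw [← IsScalarTower.algebraMap_apply]
  by_cases hv : v ∈ hfin.toFinset
  · rw [← Finset.mul_prod_erase _ _ hv, map_mul, mul_assoc, mul_left_comm, mul_comm _ (a v)]
    exact mul_mem (coe_mem_adicCompletionIntegers v _) (hab v)
  · refine mul_mem (coe_mem_adicCompletionIntegers v _) ?_
    simpa using hv

/-- Strong approximation: `𝔸_f = F + 𝒪̂`. -/
lemma exists_sub_mem_integralAdeles (a : FiniteAdeleRing (𝓞 F) F) :
    ∃ x : F, a - algebraMap F (FiniteAdeleRing (𝓞 F) F) x ∈ integralAdeles F := by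
  classical
  obtain ⟨d, hd0, hd⟩ := exists_smul_mem_integralAdeles a
  have hd0' : (d : F) ≠ 0 := by exact_mod_cast hd0
  have hfin : {v : HeightOneSpectrum (𝓞 F) | v.intValuation d ≠ 1}.Finite := by
    refine (HeightOneSpectrum.Support.finite (𝓞 F) ((d : F)⁻¹)).subset fun v hv => ?_
    change 1 < v.valuation F _
    rw [map_inv₀, valuation_of_algebraMap]
    exact (one_lt_inv₀ (zero_lt_iff.2 (intValuation_ne_zero v d hd0))).2
      (lt_of_le_of_ne (intValuation_le_one v d) hv)
  have hex : ∀ v : HeightOneSpectrum (𝓞 F), ∃ n : ℕ, v.intValuation d = exp (-(n : ℤ)) := by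
    intro v
    exact ⟨_, intValuation_eq_exp_neg_multiplicity v hd0⟩
  choose n hn using hex
  choose r hr using fun v : HeightOneSpectrum (𝓞 F) =>
    exists_integer_approx v (mem_integralAdeles.1 hd v)
      (Units.mk0 (v.intValuation d) (intValuation_ne_zero v d hd0))
  -- Chinese remainder theorem at the finitely many places dividing `d`. There `b` is congruent to
  -- `d a` modulo `d`, so `b / d` differs from `a` by an integral element. At the other places `d`
  -- is a unit and nothing is required of `b`.
  obtain ⟨b, hb⟩ := IsDedekindDomain.exists_forall_sub_mem_ideal (s := hfin.toFinset)
    (fun v : HeightOneSpectrum (𝓞 F) => v.asIdeal) n (fun v _ => v.prime)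
    (fun v _ w _ h h' => h (HeightOneSpectrum.ext h')) (fun v => r v)
  refine ⟨b / d, mem_integralAdeles.2 fun v => ?_⟩
  change a v - algebraMap F (v.adicCompletion F) (b / d) ∈ _
  have key : Valued.v (algebraMap F (v.adicCompletion F) d * a v -
      algebraMap (𝓞 F) (v.adicCompletion F) b) ≤ v.intValuation d := by
    by_cases hv : v.intValuation d = 1
    · rw [hv]
      exact (v.adicCompletionIntegers F).toSubring.sub_mem (mem_integralAdeles.1 hd v)
        (coe_mem_adicCompletionIntegers v b)
    · have h1 := hb v (hfin.mem_toFinset.2 hv)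
      rw [← intValuation_le_pow_iff_mem, ← hn, ← valuation_of_algebraMap (K := F),
        ← valuedAdicCompletion_eq_valuation' v] at h1
      have h2 := (hr v).le
      have : algebraMap F (v.adicCompletion F) d * a v - algebraMap (𝓞 F) (v.adicCompletion F) b =
        (algebraMap F (v.adicCompletion F) d * a v - algebraMap (𝓞 F) (v.adicCompletion F) (r v)) -
        algebraMap F (v.adicCompletion F) (algebraMap (𝓞 F) F (b - r v)) := by
        rw [← IsScalarTower.algebraMap_apply (𝓞 F) F (v.adicCompletion F) (b - r v), map_sub]
        ring
      rw [this]
      exact (Valuation.map_sub _ _ _).trans (max_le h2 h1)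
  have hd0v : algebraMap F (v.adicCompletion F) d ≠ 0 := by simpa using hd0'
  have : a v - algebraMap F (v.adicCompletion F) (b / d) =
      (algebraMap F (v.adicCompletion F) d)⁻¹ * (algebraMap F (v.adicCompletion F) d * a v -
      algebraMap (𝓞 F) (v.adicCompletion F) b) := by
    rw [IsScalarTower.algebraMap_apply (𝓞 F) F, map_div₀]
    field_simp
  rw [this, mem_adicCompletionIntegers, map_mul, map_inv₀]
  have hvd : Valued.v (algebraMap F (v.adicCompletion F) d) = v.intValuation d := by
    rw [← valuation_of_algebraMap (K := F)]
    exact valuedAdicCompletion_eq_valuation' v _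
  rw [hvd]
  have h0 := intValuation_ne_zero v d hd0
  calc _ ≤ (v.intValuation d)⁻¹ * v.intValuation d := by gcongr
    _ = 1 := inv_mul_cancel₀ h0

lemma mem_ringOfIntegers_of_integralAdeles {x : F}
    (hx : algebraMap F (FiniteAdeleRing (𝓞 F) F) x ∈ integralAdeles F) : ∃ r : 𝓞 F, r = x := by
  obtain ⟨r, hr⟩ := mem_integers_of_valuation_le_one (R := 𝓞 F) F x fun v => by
    have := mem_integralAdeles.1 hx v
    rw [← valuedAdicCompletion_eq_valuation' v]
    exact this
  exact ⟨r, hr⟩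

lemma finite_integral_bounded (B : ℝ) :
    {x : F | algebraMap F (FiniteAdeleRing (𝓞 F) F) x ∈ integralAdeles F ∧
      ∀ w : InfinitePlace F, ‖(algebraMap F (InfiniteAdeleRing F) x) w‖ ≤ B}.Finite := by
  refine (Embeddings.finite_of_norm_le F ℂ B).subset fun x hx => ⟨?_, fun φ => ?_⟩
  · obtain ⟨r, rfl⟩ := mem_ringOfIntegers_of_integralAdeles hx.1
    exact r.2
  · have := hx.2 (InfinitePlace.mk φ)
    rw [InfiniteAdeleRing.algebraMap_apply] at this
    have h2 : ‖((x : F) : (InfinitePlace.mk φ).Completion)‖ = (InfinitePlace.mk φ) x :=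
      InfinitePlace.Completion.norm_coe _ _
    rwa [h2, InfinitePlace.apply] at this

/-- The open sets `d⁻¹ 𝒪̂` cover the finite adeles and are directed by divisibility, so a compact
set lies in one of them. -/
lemma exists_smul_subset_integralAdeles {C : Set (FiniteAdeleRing (𝓞 F) F)} (hC : IsCompact C) :
    ∃ d : 𝓞 F, d ≠ 0 ∧ ∀ a ∈ C, algebraMap F (FiniteAdeleRing (𝓞 F) F) d * a ∈ integralAdeles F := by
  let U : {d : 𝓞 F // d ≠ 0} → Set (FiniteAdeleRing (𝓞 F) F) := fun d =>
    {a | algebraMap F (FiniteAdeleRing (𝓞 F) F) (d.1 : F) * a ∈ integralAdeles F}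
  have : Nonempty {d : 𝓞 F // d ≠ 0} := ⟨1, one_ne_zero⟩
  have hU : ∀ d a, a ∈ U d ↔
    algebraMap F (FiniteAdeleRing (𝓞 F) F) (d.1 : F) * a ∈ integralAdeles F := fun _ _ => Iff.rfl
  obtain ⟨d, hd⟩ := hC.elim_directed_cover U
    (fun d => isOpen_integralAdeles.preimage (continuous_const.mul continuous_id))
    (fun a _ => by
      obtain ⟨d, hd0, hd⟩ := exists_smul_mem_integralAdeles a
      exact Set.mem_iUnion.2 ⟨⟨d, hd0⟩, hd⟩)
    (by
      have hint : ∀ d : 𝓞 F, algebraMap F (FiniteAdeleRing (𝓞 F) F) d ∈ integralAdeles F :=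
        fun d => mem_integralAdeles.2 fun v => coe_algebraMap_mem _ _ v d
      rintro ⟨d, hd⟩ ⟨e, he⟩
      refine ⟨⟨d * e, mul_ne_zero hd he⟩, fun a ha => ?_, fun a ha => ?_⟩
      · have := mul_mem (hint e) ha
        rw [hU]
        rwa [show (algebraMap F (FiniteAdeleRing (𝓞 F) F)) ((d * e : 𝓞 F) : F) * a =
          algebraMap F (FiniteAdeleRing (𝓞 F) F) e * (algebraMap F (FiniteAdeleRing (𝓞 F) F) d * a) by
          rw [show ((d * e : 𝓞 F) : F) = d * e from map_mul (algebraMap (𝓞 F) F) d e, map_mul]; ring]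
      · have := mul_mem (hint d) ha
        rw [hU]
        rwa [show (algebraMap F (FiniteAdeleRing (𝓞 F) F)) ((d * e : 𝓞 F) : F) * a =
          algebraMap F (FiniteAdeleRing (𝓞 F) F) d * (algebraMap F (FiniteAdeleRing (𝓞 F) F) e * a) by
          rw [show ((d * e : 𝓞 F) : F) = d * e from map_mul (algebraMap (𝓞 F) F) d e, map_mul]; ring])
  exact ⟨d.1, d.2, fun a ha => hd ha⟩

/-- `F` is discrete in the adeles. -/
lemma finite_rational_of_isCompact {C : Set (InfiniteAdeleRing F)}
    {C' : Set (FiniteAdeleRing (𝓞 F) F)} (hC : IsCompact C) (hC' : IsCompact C') :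
    {x : F | algebraMap F (InfiniteAdeleRing F) x ∈ C ∧
      algebraMap F (FiniteAdeleRing (𝓞 F) F) x ∈ C'}.Finite := by
  -- A common denominator `d` makes `d x` an algebraic integer with bounded archimedean absolute
  -- values, and there are finitely many of these.
  obtain ⟨d, hd0, hd⟩ := exists_smul_subset_integralAdeles hC'
  have hd0' : (d : F) ≠ 0 := by exact_mod_cast hd0
  have hb : ∃ B : ℝ, ∀ a ∈ C, ∀ w : InfinitePlace F,
      ‖(algebraMap F (InfiniteAdeleRing F) d * a) w‖ ≤ B := by
    have : ∀ w : InfinitePlace F, ∃ B : ℝ, ∀ a ∈ C,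
        ‖(algebraMap F (InfiniteAdeleRing F) d * a) w‖ ≤ B := fun w => by
      have hc : Continuous fun a : InfiniteAdeleRing F =>
          (algebraMap F (InfiniteAdeleRing F) d * a) w :=
        (continuous_apply (A := fun w : InfinitePlace F => w.Completion) w).comp
          (continuous_const.mul continuous_id)
      exact hC.exists_bound_of_continuousOn hc.continuousOn
    choose B hB using this
    refine ⟨∑ w, |B w|, fun a ha w => (hB w a ha).trans ((le_abs_self _).trans ?_)⟩
    exact Finset.single_le_sum (f := fun w => |B w|) (fun w _ => abs_nonneg _) (Finset.mem_univ w)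
  obtain ⟨B, hB⟩ := hb
  refine ((finite_integral_bounded (F := F) B).preimage
    (f := fun x : F => d * x) (mul_right_injective₀ hd0').injOn).subset ?_
  rintro x ⟨hx, hx'⟩
  refine ⟨?_, fun w => ?_⟩
  · rw [map_mul]; exact hd _ hx'
  · rw [map_mul]; exact hB _ hx w

/-- The constant `B` below bounds the fundamental parallelepiped of the lattice `𝓞 F`; the norm of
the mixed space is the maximum of the norms at the places. -/
lemma exists_compact_infinite : ∃ P : Set (InfiniteAdeleRing F), IsCompact P ∧
    ∀ a : InfiniteAdeleRing F, ∃ r : 𝓞 F, a - algebraMap F (InfiniteAdeleRing F) r ∈ P := by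
  classical
  let b := mixedEmbedding.latticeBasis F
  let B : ℝ := ∑ i, ‖b i‖
  refine ⟨{a | ∀ w, ‖a w‖ ≤ B}, ?_, fun a => ?_⟩
  · have : {a : InfiniteAdeleRing F | ∀ w, ‖a w‖ ≤ B} =
        Set.univ.pi fun w : InfinitePlace F => Metric.closedBall (0 : w.Completion) B := by
      ext a
      exact (forall_congr' fun w => mem_closedBall_zero_iff.symm).trans Set.mem_univ_pi.symm
    rw [this]
    refine isCompact_univ_pi fun w => ?_
    have hw := InfinitePlace.Completion.isometry_extensionEmbedding w
    have := hw.isClosedEmbedding.isCompact_preimage (isCompact_closedBall (0 : ℂ) B)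
    rwa [← map_zero (InfinitePlace.Completion.extensionEmbedding w), hw.preimage_closedBall] at this
  · let m := InfiniteAdeleRing.ringEquiv_mixedSpace F a
    have hm := (ZSpan.floor b m).2
    rw [mixedEmbedding.mem_span_latticeBasis] at hm
    obtain ⟨r, hr⟩ := hm
    refine ⟨r, ?_⟩
    have hfr : InfiniteAdeleRing.ringEquiv_mixedSpace F (a - algebraMap F (InfiniteAdeleRing F) r) =
        ZSpan.fract b m := by
      rw [map_sub, ZSpan.fract_apply, ← hr]
      congr 1
      rw [← InfiniteAdeleRing.mixedEmbedding_eq_algebraMap_comp]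
      rfl
    have hn : ‖ZSpan.fract b m‖ ≤ B := ZSpan.norm_fract_le b m
    rw [← hfr, InfiniteAdeleRing.ringEquiv_mixedSpace_apply, Prod.norm_def, max_le_iff] at hn
    intro w
    by_cases hw : InfinitePlace.IsReal w
    · have := (norm_le_pi_norm _ ⟨w, hw⟩).trans hn.1
      rwa [(InfinitePlace.Completion.isometry_extensionEmbeddingOfIsReal hw).norm_map_of_map_zero
        (map_zero _)] at this
    · have := (norm_le_pi_norm _ ⟨w, InfinitePlace.not_isReal_iff_isComplex.1 hw⟩).trans hn.2
      rwa [(InfinitePlace.Completion.isometry_extensionEmbedding w).norm_map_of_map_zero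
        (map_zero _)] at this

end Adeles

end DefiniteUnitary
end

noncomputable section

namespace DefiniteUnitary

/-! ### Topology of `R ⊗ D` and of `U(R)` -/

section TensorTopology

variable {F K D : Type*} [Field F] [Field K] [Algebra F K] [Ring D] [Algebra F D] [Algebra K D]

/-- The module topology on `R ⊗ D`. -/
abbrev tensorTopology (F D : Type*) [Field F] [Ring D] [Algebra F D]
    (R : Type*) [CommRing R] [Algebra F R] [TopologicalSpace R] :
    TopologicalSpace (R ⊗[F] D) := moduleTopology R (R ⊗[F] D)

attribute [local instance] tensorTopology

section

variable {R : Type*} [CommRing R] [Algebra F R] {c : K ≃ₐ[F] K} (σ : AntiInvolution D c)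

lemma U.val_mul_star (u : U σ R) : U.val σ u * starR σ R (U.val σ u) = 1 := u.2

lemma U.val_one : U.val σ (1 : U σ R) = 1 := rfl

lemma U.star_mul_val (u : U σ R) : starR σ R (U.val σ u) * U.val σ u = 1 := by
  rw [← U.val_inv, ← U.val_mul, inv_mul_cancel, U.val_one]

/-- The element of `U(R)` given by `x` with `x x⋆ = x⋆ x = 1`. -/
def U.mk (x : R ⊗[F] D) (h : x * starR σ R x = 1) (h' : starR σ R x * x = 1) : U σ R :=
  (⟨⟨x, starR σ R x, h, h'⟩, h⟩ : unitarySubgroup σ R)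

@[simp] lemma U.val_mk (x : R ⊗[F] D) (h : x * starR σ R x = 1) (h' : starR σ R x * x = 1) :
    U.val σ (U.mk σ x h h') = x := rfl

end

variable (R : Type*) [CommRing R] [Algebra F R] [TopologicalSpace R]

instance isModuleTopology_tensor : IsModuleTopology R (R ⊗[F] D) := ⟨rfl⟩

lemma U.isEmbedding_val {c : K ≃ₐ[F] K} (σ : AntiInvolution D c) : Topology.IsEmbedding (U.val σ : U σ R → R ⊗[F] D) :=
  ⟨⟨rfl⟩, fun _ _ h => U.ext σ h⟩

variable [IsTopologicalRing R] [FiniteDimensional F D]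

instance isTopologicalRing_tensor : IsTopologicalRing (R ⊗[F] D) :=
  IsModuleTopology.isTopologicalRing R (R ⊗[F] D)

variable (F D) in
/-- Coordinates on `R ⊗ D` with respect to an `F`-basis of `D`. -/
def coordinates : (R ⊗[F] D) ≃L[R] (Fin (Module.finrank F D) → R) :=
  let e : (R ⊗[F] D) ≃ₗ[R] (Fin (Module.finrank F D) → R) :=
    ((Module.finBasis F D).baseChange R).equivFun
  { e with
    continuous_toFun := IsModuleTopology.continuous_of_linearMap e.toLinearMap
    continuous_invFun := IsModuleTopology.continuous_of_linearMap e.symm.toLinearMap }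

lemma coordinates_tmul (r : R) (d : D) (i : Fin (Module.finrank F D)) :
    coordinates F D R (r ⊗ₜ d) i = r * algebraMap F R ((Module.finBasis F D).repr d i) := by
  change ((Module.finBasis F D).baseChange R).repr (r ⊗ₜ d) i = _
  rw [Module.Basis.baseChange_repr_tmul, Algebra.smul_def, mul_comm]

lemma coordinates_map {S : Type*} [CommRing S] [Algebra F S] [TopologicalSpace S]
    [IsTopologicalRing S] (f : R →ₐ[F] S) (x : R ⊗[F] D) (i : Fin (Module.finrank F D)) :
    coordinates F D S (Algebra.TensorProduct.map f (AlgHom.id F D) x) i =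
      f (coordinates F D R x i) := by
  induction x using TensorProduct.induction_on with
  | zero => simp
  | add a b ha hb => simp [ha, hb]
  | tmul r d => simp [coordinates_tmul]

instance [T2Space R] : T2Space (R ⊗[F] D) := (coordinates F D R).toHomeomorph.isEmbedding.t2Space

instance [LocallyCompactSpace R] : LocallyCompactSpace (R ⊗[F] D) :=
  (coordinates F D R).toHomeomorph.isClosedEmbedding.locallyCompactSpace

instance [TotallyDisconnectedSpace R] : TotallyDisconnectedSpace (R ⊗[F] D) :=
  (coordinates F D R).toHomeomorph.isEmbedding.isTotallyDisconnected_range.1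
    (isTotallyDisconnected_of_totallyDisconnectedSpace _)

variable {c : K ≃ₐ[F] K} (σ : AntiInvolution D c)

variable {R} in
lemma continuous_starR : Continuous (starR σ R) :=
  IsModuleTopology.continuous_of_linearMap (starR σ R)

/-- Closedness of the range makes the preimage in `U(R)` of a compact subset of `R ⊗ D` compact. -/
lemma U.isClosedEmbedding_val [T2Space R] :
    Topology.IsClosedEmbedding (U.val σ : U σ R → R ⊗[F] D) := by
  refine ⟨U.isEmbedding_val R σ, ?_⟩
  have : Set.range (U.val σ : U σ R → R ⊗[F] D) =
      {x | x * starR σ R x = 1} ∩ {x | starR σ R x * x = 1} := by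
    ext x
    constructor
    · rintro ⟨u, rfl⟩
      exact ⟨U.val_mul_star σ u, U.star_mul_val σ u⟩
    · rintro ⟨h, h'⟩
      exact ⟨U.mk σ x h h', rfl⟩
  rw [this]
  exact (isClosed_eq (continuous_id.mul (continuous_starR σ)) continuous_const).inter
    (isClosed_eq ((continuous_starR σ).mul continuous_id) continuous_const)

instance [T2Space R] : T2Space (U σ R) := (U.isEmbedding_val R σ).t2Space

instance [TotallyDisconnectedSpace R] : TotallyDisconnectedSpace (U σ R) :=
  (U.isEmbedding_val R σ).isTotallyDisconnected_range.1
    (isTotallyDisconnected_of_totallyDisconnectedSpace _)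

end TensorTopology

/-! ### `D` as a discrete cocompact subgroup of its adelic points -/

section AdelicLattice

open NumberField

attribute [local instance] tensorTopology

variable {F K D : Type*} [Field F] [NumberField F] [Field K] [Algebra F K]
  [Ring D] [Algebra F D] [Algebra K D]

variable (F D) in
/-- The adelic points of `D`. -/
abbrev DAdele : Type _ := (InfiniteAdeleRing F ⊗[F] D) × (FiniteAdeleRing (𝓞 F) F ⊗[F] D)

variable (F) in
/-- The diagonal embedding. -/
def diag : D →+* DAdele F D :=
  (Algebra.TensorProduct.includeRight : D →ₐ[F] InfiniteAdeleRing F ⊗[F] D).toRingHom.prod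
    (Algebra.TensorProduct.includeRight : D →ₐ[F] FiniteAdeleRing (𝓞 F) F ⊗[F] D).toRingHom

lemma diag_apply (d : D) : diag F d = (1 ⊗ₜ d, 1 ⊗ₜ d) := rfl

variable [FiniteDimensional F D]

variable (F D) in
-- Coordinatewise, strong approximation first makes the finite part integral. Then an element of `𝓞
-- F` bounds the infinite part without spoiling that integrality.
lemma exists_isCompact_add_diag :
    ∃ Ω : Set (DAdele F D), IsCompact Ω ∧ ∀ x, ∃ d : D, x - diag F d ∈ Ω := by
  obtain ⟨P, hP, hPF⟩ := exists_compact_infinite (F := F)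
  refine ⟨((coordinates F D (InfiniteAdeleRing F)) ⁻¹' (Set.univ.pi fun _ => P)) ×ˢ
    ((coordinates F D (FiniteAdeleRing (𝓞 F) F)) ⁻¹'
      (Set.univ.pi fun _ => (integralAdeles F : Set (FiniteAdeleRing (𝓞 F) F)))), ?_, ?_⟩
  · refine IsCompact.prod ?_ ?_
    · exact (coordinates F D (InfiniteAdeleRing F)).toHomeomorph.isCompact_preimage.2
        (isCompact_univ_pi fun _ => hP)
    · exact (coordinates F D (FiniteAdeleRing (𝓞 F) F)).toHomeomorph.isCompact_preimage.2
        (isCompact_univ_pi fun _ => isCompact_integralAdeles)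
  · rintro ⟨x, y⟩
    have : ∀ i, ∃ a : F, coordinates F D _ x i - algebraMap F _ a ∈ P ∧
        coordinates F D _ y i - algebraMap F _ a ∈ integralAdeles F := by
      intro i
      obtain ⟨a, ha⟩ := exists_sub_mem_integralAdeles (coordinates F D _ y i)
      obtain ⟨r, hr⟩ := hPF (coordinates F D _ x i - algebraMap F _ a)
      refine ⟨a + r, ?_, ?_⟩
      · rwa [map_add, ← sub_sub]
      · rw [map_add, ← sub_sub]
        exact sub_mem ha (mem_integralAdeles.2 fun v =>
          HeightOneSpectrum.coe_algebraMap_mem _ _ v r)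
    choose a ha ha' using this
    refine ⟨(Module.finBasis F D).equivFun.symm a, ?_, ?_⟩
    · refine fun i _ => ?_
      change coordinates F D _ (x - 1 ⊗ₜ _) i ∈ P
      rw [map_sub, Pi.sub_apply, coordinates_tmul, one_mul, ← Module.Basis.equivFun_apply,
        LinearEquiv.apply_symm_apply]
      exact ha i
    · refine fun i _ => ?_
      change coordinates F D _ (y - 1 ⊗ₜ _) i ∈ integralAdeles F
      rw [map_sub, Pi.sub_apply, coordinates_tmul, one_mul, ← Module.Basis.equivFun_apply,
        LinearEquiv.apply_symm_apply]
      exact ha' i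

/-- Discreteness of `D`, deduced from that of `F` in each coordinate. -/
lemma finite_diag_mem_of_isCompact {C : Set (DAdele F D)} (hC : IsCompact C) :
    {d : D | diag F d ∈ C}.Finite := by
  have h1 := fun i : Fin (Module.finrank F D) => finite_rational_of_isCompact
    ((hC.image continuous_fst).image ((continuous_apply i).comp
      (coordinates F D (InfiniteAdeleRing F)).continuous))
    ((hC.image continuous_snd).image ((continuous_apply i).comp
      (coordinates F D (FiniteAdeleRing (𝓞 F) F)).continuous))
  refine ((Set.Finite.pi' h1).preimage
    (f := (Module.finBasis F D).equivFun) (LinearEquiv.injective _).injOn).subset ?_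
  intro d hd i
  refine ⟨⟨_, ⟨_, hd, rfl⟩, ?_⟩, ⟨_, ⟨_, hd, rfl⟩, ?_⟩⟩
  · simp [diag_apply, coordinates_tmul]
  · simp [diag_apply, coordinates_tmul]

end AdelicLattice

end DefiniteUnitary
end

noncomputable section

namespace DefiniteUnitary

/-! ### Comparing volumes in a compact quotient -/

section Packing

open MeasureTheory Topology Pointwise

variable {A D : Type*} [AddCommGroup A] [TopologicalSpace A] [IsTopologicalAddGroup A] [T2Space A]
  [MeasurableSpace A] [BorelSpace A] [AddCommGroup D] {δ : D →+ A}

/-- Blichfeldt's principle. Cut `E` along the translates `δ d + Ω` and move the pieces back into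
`Ω`; injectivity modulo `D` keeps them disjoint there. -/
lemma measure_le_of_injOn_quotient (μ : Measure A) [μ.IsAddLeftInvariant]
    (hfin : ∀ C : Set A, IsCompact C → {d | δ d ∈ C}.Finite)
    {Ω : Set A} (hΩ : IsCompact Ω) (hcov : ∀ x, ∃ d, x - δ d ∈ Ω)
    {E Q : Set A} (hE : IsOpen E) (hQ : IsCompact Q) (hEQ : E ⊆ Q)
    (hinj : ∀ x ∈ E, ∀ y ∈ E, ∀ d, x - y = δ d → d = 0) : μ E ≤ μ Ω := by
  classical
  -- Only the `d` with `δ d ∈ Q - Ω` contribute, which makes the decomposition finite.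
  have hd := hfin _ ((hQ.prod hΩ).image continuous_sub)
  let X : D → Set A := fun d => (fun x => δ d + x) ⁻¹' E ∩ Ω
  have hX : ∀ d, MeasurableSet (X d) := fun d =>
    ((hE.preimage (continuous_const.add continuous_id)).measurableSet).inter hΩ.measurableSet
  have h1 : E ⊆ ⋃ d ∈ hd.toFinset, (fun x => -δ d + x) ⁻¹' (X d) := by
    intro x hx
    obtain ⟨d, hdx⟩ := hcov x
    refine Set.mem_biUnion (x := d) ?_ ⟨?_, ?_⟩
    · rw [Finset.mem_coe, hd.mem_toFinset]
      exact ⟨(x, x - δ d), ⟨hEQ hx, hdx⟩, by simp⟩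
    · simpa using hx
    · change -δ d + x ∈ Ω
      rwa [neg_add_eq_sub]
  have h2 : (↑hd.toFinset : Set D).PairwiseDisjoint X := by
    intro d _ d' _ hne
    rw [Function.onFun, Set.disjoint_left]
    rintro x ⟨hx, -⟩ ⟨hx', -⟩
    apply hne
    refine sub_eq_zero.1 (hinj _ hx _ hx' (d - d') ?_)
    rw [map_sub, add_sub_add_right_eq_sub]
  calc μ E ≤ μ (⋃ d ∈ hd.toFinset, (fun x => -δ d + x) ⁻¹' (X d)) := measure_mono h1
    _ ≤ ∑ d ∈ hd.toFinset, μ ((fun x => -δ d + x) ⁻¹' (X d)) := measure_biUnion_finset_le _ _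
    _ = ∑ d ∈ hd.toFinset, μ (X d) := by simp only [measure_preimage_add]
    _ = μ (⋃ d ∈ hd.toFinset, X d) := (measure_biUnion_finset h2 fun d _ => hX d).symm
    _ ≤ μ Ω := measure_mono (Set.iUnion₂_subset fun d _ => Set.inter_subset_right)

variable [LocallyCompactSpace A]

/-- An automorphism all of whose powers map a nonempty open set `W` injectively to the compact
quotient `A / D` does not expand the Haar measure. -/
lemma addHaarChar_le_one_of_injOn_quotient
    (hfin : ∀ C : Set A, IsCompact C → {d | δ d ∈ C}.Finite)
    {Ω : Set A} (hΩ : IsCompact Ω) (hcov : ∀ x, ∃ d, x - δ d ∈ Ω)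
    {W Q : Set A} (hW : IsOpen W) (hQ : IsCompact Q) (hWQ : W ⊆ Q) (hne : W.Nonempty)
    (φ : A ≃ₜ+ A)
    (hinj : ∀ n : ℕ, ∀ x ∈ W, ∀ y ∈ W, ∀ d, φ^[n] x - φ^[n] y = δ d → d = 0) :
    addEquivAddHaarChar φ ≤ 1 := by
  let μ : Measure A := Measure.addHaar
  have hvol : ∀ X : Set A, μ (φ '' X) = addEquivAddHaarChar φ • μ X := by
    intro X
    rw [← addEquivAddHaarChar_smul_preimage μ φ, Set.preimage_image_eq _ φ.injective]
  have hit : ∀ n : ℕ, μ (φ^[n] '' W) = (addEquivAddHaarChar φ) ^ n • μ W := by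
    intro n
    induction n with
    | zero => simp
    | succ n ih =>
      rw [Function.iterate_succ', Set.image_comp, hvol, ih, smul_smul, pow_succ']
  have hcont : ∀ n : ℕ, Continuous (φ^[n]) := fun n => φ.continuous.iterate n
  have hopen : ∀ n : ℕ, IsOpen (φ^[n] '' W) := by
    intro n
    induction n with
    | zero => simpa using hW
    | succ n ih =>
      rw [Function.iterate_succ', Set.image_comp]
      exact φ.toHomeomorph.isOpenMap _ ih
  have hbound : ∀ n : ℕ, (addEquivAddHaarChar φ) ^ n • μ W ≤ μ Ω := by
    intro n
    rw [← hit]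
    refine measure_le_of_injOn_quotient μ hfin hΩ hcov (hopen n) (hQ.image (hcont n))
      (Set.image_mono hWQ) ?_
    rintro _ ⟨x, hx, rfl⟩ _ ⟨y, hy, rfl⟩ d h
    exact hinj n x hx y hy d h
  -- The volume of `φⁿ W` is that of `W` times the `n`-th power of the modulus, yet stays below that
  -- of `Ω`.
  by_contra! hgt
  have hWpos : μ W ≠ 0 := (hW.measure_pos μ hne).ne'
  have hΩfin : μ Ω ≠ ⊤ := hΩ.measure_ne_top
  have hWfin : μ W ≠ ⊤ := ((measure_mono hWQ).trans_lt hQ.measure_lt_top).ne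
  lift μ W to NNReal using hWfin with w hw
  lift μ Ω to NNReal using hΩfin with o ho
  have hw0 : 0 < w := pos_iff_ne_zero.2 (by simpa using hWpos)
  obtain ⟨n, hn⟩ := pow_unbounded_of_one_lt (o / w) hgt
  have := hbound n
  rw [ENNReal.smul_def, smul_eq_mul, ← ENNReal.coe_mul, ENNReal.coe_le_coe] at this
  exact absurd ((div_lt_iff₀ hw0).1 hn) (not_lt.2 this)

end Packing

/-! ### Compactness at infinity makes the Hermitian form anisotropic -/

section Anisotropic

open NumberField

attribute [local instance] tensorTopology

variable {F K D : Type*} [Field F] [NumberField F] [Field K] [Algebra F K]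
  [Ring D] [Algebra K D] [Algebra F D] [IsScalarTower F K D] [FiniteDimensional F D]
  {c : K ≃ₐ[F] K} (σ : AntiInvolution D c)

/-- The elements `1 + N y` are unitary with inverse `1 - N y`. They form an unbounded sequence in
the compact group of real points unless `y = 0`; one coordinate at one infinite place detects this.
-/
lemma eq_zero_of_skew_of_sq_eq_zero (hdef : CompactSpace (U σ (InfiniteAdeleRing F))) {y : D}
    (hy : σ.toLinearMap y = -y) (hy2 : y * y = 0) : y = 0 := by
  have h0 : ∀ N : ℕ, (N • y) * (N • y) = 0 := fun N => by
    rw [smul_mul_smul_comm, hy2, smul_zero]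
  have h1 : ∀ N : ℕ, (1 + N • y) * (1 - N • y) = 1 := fun N => by
    rw [add_mul, mul_sub, mul_sub, h0, one_mul, one_mul, mul_one]; abel
  have h2 : ∀ N : ℕ, (1 - N • y) * (1 + N • y) = 1 := fun N => by
    rw [sub_mul, mul_add, mul_add, h0, one_mul, one_mul, mul_one]; abel
  have hs : ∀ N : ℕ, σ.toLinearMap (1 + N • y) = 1 - N • y := fun N => by
    rw [map_add, toLinearMap_one, map_nsmul, hy, smul_neg, sub_eq_add_neg]
  let u : ℕ → U σ (InfiniteAdeleRing F) := fun N => U.mk σ (1 ⊗ₜ (1 + N • y))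
    (by rw [starR_tmul, hs, Algebra.TensorProduct.tmul_mul_tmul, h1, one_mul]; rfl)
    (by rw [starR_tmul, hs, Algebra.TensorProduct.tmul_mul_tmul, h2, one_mul]; rfl)
  obtain ⟨w⟩ : Nonempty (InfinitePlace F) := inferInstance
  apply (Module.finBasis F D).repr.injective
  rw [map_zero]
  ext i
  have hcont : Continuous fun x : U σ (InfiniteAdeleRing F) =>
      (coordinates F D (InfiniteAdeleRing F) (U.val σ x) i) w :=
    (continuous_apply (A := fun w : InfinitePlace F => w.Completion) w).comp
      ((continuous_apply i).comp ((coordinates F D (InfiniteAdeleRing F)).continuous.comp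
        (U.isEmbedding_val (InfiniteAdeleRing F) σ).continuous))
  obtain ⟨B, hB⟩ := isCompact_univ.exists_bound_of_continuousOn hcont.continuousOn
  set a := (Module.finBasis F D).repr 1 i
  set r := (Module.finBasis F D).repr y i with hr
  have hbd : ∀ N : ℕ, w (a + N * r) ≤ B := by
    intro N
    have := hB (u N) (Set.mem_univ _)
    rw [show U.val σ (u N) = 1 ⊗ₜ (1 + N • y) from rfl, coordinates_tmul, one_mul, map_add,
      map_nsmul, InfiniteAdeleRing.algebraMap_apply, Finsupp.add_apply, Finsupp.smul_apply,
      nsmul_eq_mul] at this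
    have h2 : ‖((a + N * r : F) : w.Completion)‖ = w (a + N * r) :=
      InfinitePlace.Completion.norm_coe _ _
    rwa [← h2]
  have hbd' : ∀ N : ℕ, N * w r ≤ B + w a := by
    intro N
    have hwN : w (N : F) = N := by
      rw [← InfinitePlace.norm_embedding_eq w (N : F), map_natCast, Complex.norm_natCast]
    calc N * w r = w ((a + N * r) - a) := by rw [add_sub_cancel_left, map_mul, hwN]
      _ ≤ w (a + N * r) + w a := by
        rw [sub_eq_add_neg]
        refine (w.1.add_le _ _).trans ?_
        rw [w.1.map_neg]; rfl
      _ ≤ B + w a := by gcongr; exact hbd N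
  have : w r = 0 := by
    by_contra hne
    have hpos : 0 < w r := lt_of_le_of_ne (apply_nonneg _ _) (Ne.symm hne)
    obtain ⟨N, hN⟩ := exists_nat_gt ((B + w a) / w r)
    exact absurd ((div_lt_iff₀ hpos).1 hN) (not_lt.2 (hbd' N))
  simpa using this

/-- A positive definite form is anisotropic. -/
lemma eq_zero_of_star_mul_self [IsSimpleRing D] (hc : c ≠ 1)
    (hdef : CompactSpace (U σ (InfiniteAdeleRing F))) {d : D}
    (hd : σ.toLinearMap d * d = 0) : d = 0 := by
  have hc2 : ∀ a, c (c a) = a := by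
    intro a
    apply (algebraMap K D).injective
    rw [← σ.map_algebraMap', ← σ.map_algebraMap', σ.invol']
  -- For skew `e` the element `d e d⋆` is skew, and its square contains the factor `d⋆ d = 0`.
  have hskew : ∀ e, σ.toLinearMap e = -e → d * e * σ.toLinearMap d = 0 := by
    intro e he
    refine eq_zero_of_skew_of_sq_eq_zero σ hdef ?_ ?_
    · rw [σ.map_mul', σ.map_mul', σ.invol', he]
      noncomm_ring
    · calc d * e * σ.toLinearMap d * (d * e * σ.toLinearMap d)
          = d * e * (σ.toLinearMap d * d) * e * σ.toLinearMap d := by noncomm_ring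
        _ = 0 := by rw [hd]; simp
  obtain ⟨i, hi⟩ : ∃ i, c i ≠ i := by
    by_contra! h
    exact hc (AlgEquiv.ext h)
  have ha0 : i - c i ≠ 0 := sub_ne_zero.2 hi.symm
  have hca : c (i - c i) = -(i - c i) := by rw [map_sub, hc2]; ring
  set a := i - c i
  -- Multiplication by the scalar `a`, for which `c a = -a`, exchanges symmetric and skew elements.
  have hsym : ∀ e, σ.toLinearMap e = e → d * e * σ.toLinearMap d = 0 := by
    intro e he
    have h := hskew (algebraMap K D a * e) (by
      rw [σ.map_mul', he, σ.map_algebraMap', hca, map_neg, mul_neg, Algebra.commutes])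
    rw [← mul_assoc, ← Algebra.commutes, mul_assoc, mul_assoc, ← Algebra.smul_def,
      smul_eq_zero_iff_right ha0, ← mul_assoc] at h
    exact h
  have hall : ∀ e, d * e * σ.toLinearMap d = 0 := by
    intro e
    have h1 := hskew (e - σ.toLinearMap e) (by rw [map_sub, σ.invol']; abel)
    have h2 := hsym (e + σ.toLinearMap e) (by rw [map_add, σ.invol']; abel)
    have h3 : (2 : F) • (d * e * σ.toLinearMap d) = 0 := by
      rw [two_smul]
      calc _ = d * (e - σ.toLinearMap e) * σ.toLinearMap d +
          d * (e + σ.toLinearMap e) * σ.toLinearMap d := by noncomm_ring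
        _ = 0 := by rw [h1, h2, add_zero]
    exact (smul_eq_zero_iff_right two_ne_zero).1 h3
  -- The elements `z` with `z D d⋆ = 0` form a two-sided ideal containing `d`. As `D` is simple,
  -- either this ideal is `0` and `d = 0`, or it contains `1` and `d⋆ = 0`.
  let I : TwoSidedIdeal D := TwoSidedIdeal.mk' {z | ∀ e, z * e * σ.toLinearMap d = 0}
    (by simp) (by intro x y hx hy e; simp [add_mul, hx e, hy e])
    (by intro x hx e; simp [neg_mul, hx e])
    (by intro x y hy e; rw [mul_assoc x, mul_assoc x, hy e, mul_zero])
    (by intro x y hx e; rw [mul_assoc x, hx])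
  have hI : ∀ z, z ∈ I ↔ ∀ e, z * e * σ.toLinearMap d = 0 := fun z => by
    simp [I, TwoSidedIdeal.mem_mk']
  rcases eq_bot_or_eq_top I with h | h
  · have := (hI d).2 hall
    rw [h] at this
    simpa using this
  · have h1 : (1 : D) ∈ I := by rw [h]; trivial
    have := (hI 1).1 h1 1
    rw [one_mul, one_mul] at this
    rw [← σ.invol' d, this, map_zero]

end Anisotropic

end DefiniteUnitary
end

noncomputable section

namespace DefiniteUnitary

/-! ### Volume estimates for translates by `G(𝔸_f)` -/

section ClassNumber

open NumberField MeasureTheory Topology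

attribute [local instance] tensorTopology

variable {F K D : Type*} [Field F] [NumberField F] [Field K] [Algebra F K]
  [Ring D] [Algebra K D] [Algebra F D] [IsScalarTower F K D] [FiniteDimensional F D]
  {c : K ≃ₐ[F] K} (σ : AntiInvolution D c)

instance : T2Space (InfiniteAdeleRing F) :=
  inferInstanceAs (T2Space (∀ w : InfinitePlace F, w.Completion))

/-- The anti-involution on the adelic points of `D`. -/
def starAdele (x : DAdele F D) : DAdele F D := (starR σ _ x.1, starR σ _ x.2)

lemma continuous_starAdele : Continuous (starAdele σ) :=
  ((continuous_starR σ).comp continuous_fst).prodMk ((continuous_starR σ).comp continuous_snd)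

lemma starAdele_mul (x y : DAdele F D) :
    starAdele σ (x * y) = starAdele σ y * starAdele σ x :=
  Prod.ext (starR_mul σ _ _ _) (starR_mul σ _ _ _)

lemma starAdele_diag (d : D) : starAdele σ (diag F d) = diag F (σ.toLinearMap d) := rfl

lemma diag_injective : Function.Injective (diag F : D → DAdele F D) := by
  intro x y h
  have h2 := congrArg Prod.fst h
  apply (Module.finBasis F D).repr.injective
  ext i
  have := congrArg (fun z => coordinates F D (InfiniteAdeleRing F) z i) h2
  simp only [diag_apply, coordinates_tmul, one_mul] at this
  exact (algebraMap F (InfiniteAdeleRing F)).injective this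

/-- Left multiplication by `(1, g)` on the adelic points of `D`. -/
def leftMul (g : GAf σ) : DAdele F D := (1, U.val σ g)

lemma leftMul_mul (g h : GAf σ) : leftMul σ (g * h) = leftMul σ g * leftMul σ h :=
  Prod.ext (one_mul 1).symm (U.val_mul σ g h)

lemma leftMul_one : leftMul σ (1 : GAf σ) = 1 := rfl

lemma star_leftMul_mul (g : GAf σ) : starAdele σ (leftMul σ g) * leftMul σ g = 1 := by
  refine Prod.ext ?_ (U.star_mul_val σ g)
  change starR σ _ 1 * 1 = 1
  rw [starR_one, one_mul]

lemma star_mul_leftMul (g : GAf σ) (x y : DAdele F D) :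
    starAdele σ (leftMul σ g * x) * (leftMul σ g * y) = starAdele σ x * y := by
  rw [starAdele_mul, mul_assoc, ← mul_assoc _ _ y, star_leftMul_mul, one_mul]

/-- Left multiplication by `(1, g)` as an automorphism. -/
def leftMulEquiv (g : GAf σ) : DAdele F D ≃ₜ+ DAdele F D where
  toFun x := leftMul σ g * x
  invFun x := leftMul σ g⁻¹ * x
  left_inv x := by beta_reduce; rw [← mul_assoc, ← leftMul_mul, inv_mul_cancel, leftMul_one, one_mul]
  right_inv x := by beta_reduce; rw [← mul_assoc, ← leftMul_mul, mul_inv_cancel, leftMul_one, one_mul]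
  map_add' x y := mul_add _ _ _
  continuous_toFun := continuous_const.mul continuous_id
  continuous_invFun := continuous_const.mul continuous_id

lemma leftMulEquiv_iterate (g : GAf σ) (n : ℕ) (x : DAdele F D) :
    (leftMulEquiv σ g)^[n] x = leftMul σ (g ^ n) * x := by
  induction n with
  | zero => rw [pow_zero, leftMul_one, one_mul]; rfl
  | succ n ih =>
    rw [Function.iterate_succ_apply', ih, pow_succ', leftMul_mul, mul_assoc]
    rfl

/-- A neighbourhood of `0` all of whose translates by `(1, g)` inject in the quotient by `D`. -/
lemma exists_open_injOn_quotient [IsSimpleRing D] (hc : c ≠ 1)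
    (hdef : CompactSpace (U σ (InfiniteAdeleRing F))) :
    ∃ W Q : Set (DAdele F D), IsOpen W ∧ IsCompact Q ∧ W ⊆ Q ∧ (0 : DAdele F D) ∈ W ∧
      ∀ (g : GAf σ), ∀ x ∈ W, ∀ y ∈ W, ∀ d,
        leftMul σ g * x - leftMul σ g * y = diag F d → d = 0 := by
  obtain ⟨C, hC, hC0⟩ := exists_compact_mem_nhds (0 : DAdele F D)
  have hfin : {d : D | diag F d ∈ C ∧ d ≠ 0}.Finite :=
    (finite_diag_mem_of_isCompact hC).subset fun d h => h.1
  have hV : (diag F '' {d : D | diag F d ∈ C ∧ d ≠ 0})ᶜ ∈ 𝓝 (0 : DAdele F D) := by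
    refine (hfin.image _).isClosed.isOpen_compl.mem_nhds ?_
    rintro ⟨d, ⟨-, hd⟩, h⟩
    exact hd (diag_injective (h.trans (map_zero _).symm))
  -- The value `(x - y)⋆ (x - y)` does not change when `x` and `y` are multiplied by `g`. If `g x -
  -- g y = d` is rational, it equals `d⋆ d`, a rational point near `0`, hence `0`; anisotropy then
  -- gives `d = 0`. So `W` can be chosen independently of `g`.
  let f : DAdele F D × DAdele F D → DAdele F D := fun q =>
    starAdele σ (q.1 - q.2) * (q.1 - q.2)
  have hf : Continuous f := ((continuous_starAdele σ).comp continuous_sub).mul continuous_sub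
  have hf0 : f (0, 0) = 0 := by simp [f]
  have hpre : f ⁻¹' (C ∩ (diag F '' {d : D | diag F d ∈ C ∧ d ≠ 0})ᶜ) ∈
      𝓝 ((0, 0) : DAdele F D × DAdele F D) :=
    hf.continuousAt.preimage_mem_nhds (by rw [hf0]; exact Filter.inter_mem hC0 hV)
  rw [nhds_prod_eq, Filter.mem_prod_self_iff] at hpre
  obtain ⟨V, hV0, hVsub⟩ := hpre
  refine ⟨interior (V ∩ C), C, isOpen_interior, hC, interior_subset.trans Set.inter_subset_right,
    mem_interior_iff_mem_nhds.2 (Filter.inter_mem hV0 hC0), ?_⟩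
  intro g x hx y hy d hd
  have hxV := (interior_subset hx).1
  have hyV := (interior_subset hy).1
  have h := hVsub (Set.mk_mem_prod hxV hyV)
  rw [← mul_sub] at hd
  have heq : f (x, y) = diag F (σ.toLinearMap d * d) := by
    rw [map_mul, ← starAdele_diag σ, ← hd, star_mul_leftMul]
  rw [Set.mem_preimage, heq] at h
  have : σ.toLinearMap d * d = 0 := by
    by_contra hne
    exact h.2 ⟨_, ⟨h.1, hne⟩, rfl⟩
  exact eq_zero_of_star_mul_self σ hc hdef this

/-- The translates of `W` by all powers of `g` inject modulo `D`, so the modulus is at most `1`; the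
same holds for `g⁻¹`. -/
lemma addHaarChar_leftMul_eq_one [IsSimpleRing D] (hc : c ≠ 1)
    (hdef : CompactSpace (U σ (InfiniteAdeleRing F))) (g : GAf σ) :
    letI : MeasurableSpace (DAdele F D) := borel _
    haveI : BorelSpace (DAdele F D) := ⟨rfl⟩
    addEquivAddHaarChar (leftMulEquiv σ g) = 1 := by
  letI : MeasurableSpace (DAdele F D) := borel _
  haveI : BorelSpace (DAdele F D) := ⟨rfl⟩
  obtain ⟨W, Q, hW, hQ, hWQ, h0, hinj⟩ := exists_open_injOn_quotient σ hc hdef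
  obtain ⟨Ω, hΩ, hcov⟩ := exists_isCompact_add_diag F D
  have key : ∀ g : GAf σ, addEquivAddHaarChar (leftMulEquiv σ g) ≤ 1 := by
    intro g
    refine addHaarChar_le_one_of_injOn_quotient (δ := (diag F : D →+* DAdele F D).toAddMonoidHom)
      (fun C hC => finite_diag_mem_of_isCompact hC) hΩ hcov hW hQ hWQ ⟨0, h0⟩ _ ?_
    intro n x hx y hy d hd
    rw [leftMulEquiv_iterate, leftMulEquiv_iterate] at hd
    exact hinj _ x hx y hy d hd
  refine le_antisymm (key g) ?_
  have h := key g⁻¹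
  have hs : leftMulEquiv σ g⁻¹ = (leftMulEquiv σ g).symm := by
    ext x <;> rfl
  rw [hs, addEquivAddHaarChar_symm] at h
  exact (inv_le_one₀ (addEquivAddHaarChar_pos _)).1 h

/-- There is a compact set whose translates by `(1, g)` contain a generating set of the
`F`-vector space `D`. -/
lemma exists_isCompact_span_eq_top [IsSimpleRing D] (hc : c ≠ 1)
    (hdef : CompactSpace (U σ (InfiniteAdeleRing F))) :
    ∃ C : Set (DAdele F D), IsCompact C ∧ ∀ g : GAf σ,
      Submodule.span F {d : D | ∃ x ∈ C, diag F d = leftMul σ g * x} = ⊤ := by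
  classical
  letI : MeasurableSpace (DAdele F D) := borel _
  haveI : BorelSpace (DAdele F D) := ⟨rfl⟩
  obtain ⟨W, Q, hW, hQ, hWQ, h0, hinj⟩ := exists_open_injOn_quotient σ hc hdef
  obtain ⟨Ω, hΩ, hcov⟩ := exists_isCompact_add_diag F D
  let μ : Measure (DAdele F D) := Measure.addHaar
  obtain ⟨w⟩ : Nonempty (InfinitePlace F) := inferInstance
  have hbd : ∃ M : ℝ, ∀ i, ∀ x ∈ Q, ‖(coordinates F D (InfiniteAdeleRing F) x.1 i) w‖ ≤ M := by
    have : ∀ i, ∃ M : ℝ, ∀ x ∈ Q, ‖(coordinates F D (InfiniteAdeleRing F) x.1 i) w‖ ≤ M := by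
      intro i
      have hcont : Continuous fun x : DAdele F D =>
          (coordinates F D (InfiniteAdeleRing F) x.1 i) w :=
        (continuous_apply (A := fun w : InfinitePlace F => w.Completion) w).comp
          ((continuous_apply i).comp ((coordinates F D (InfiniteAdeleRing F)).continuous.comp
            continuous_fst))
      exact hQ.exists_bound_of_continuousOn hcont.continuousOn
    choose M hM using this
    refine ⟨∑ i, |M i|, fun i x hx => (hM i x hx).trans ((le_abs_self _).trans ?_)⟩
    exact Finset.single_le_sum (f := fun i => |M i|) (fun i _ => abs_nonneg _) (Finset.mem_univ i)
  obtain ⟨M, hM⟩ := hbd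
  set m := Module.finrank F D
  -- `T` is the spacing of the translates below, larger than anything that coordinates of
  -- differences of points of `Q` can compensate.
  obtain ⟨T, hT⟩ := exists_nat_gt (m * (2 * M))
  have hWpos : μ W ≠ 0 := (hW.measure_pos μ ⟨0, h0⟩).ne'
  have hWfin : μ W ≠ ⊤ := ((measure_mono hWQ).trans_lt (hQ.measure_lt_top (μ := μ))).ne
  -- `N` copies of `W` have more volume than `Ω`, hence cannot be disjoint modulo `D`.
  obtain ⟨N, hN⟩ := ENNReal.exists_nat_mul_gt hWpos (hΩ.measure_lt_top (μ := μ)).ne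
  -- These shifts live at the infinite places only, so `(1, g)` fixes them.
  let Y : Fin m → ℤ → DAdele F D := fun i t => ((t : InfiniteAdeleRing F) ⊗ₜ Module.finBasis F D i, 0)
  have hYadd : ∀ i s t, Y i (s - t) = Y i s - Y i t := by
    intro i s t
    simp [Y, TensorProduct.sub_tmul]
  have hgY : ∀ g i t, leftMul σ g * Y i t = Y i t := by
    intro g i t
    refine Prod.ext (one_mul _) (mul_zero _)
  -- The range contains all differences `(j - k) T` with `j, k < N`.
  let Yset : Set (DAdele F D) := ⋃ i, Y i '' (Set.Icc (-(N * T : ℤ)) (N * T))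
  have hYfin : Yset.Finite := Set.finite_iUnion fun i => (Set.finite_Icc _ _).image _
  let Cmap : DAdele F D × DAdele F D × DAdele F D → DAdele F D := fun q => q.1 + (q.2.1 - q.2.2)
  refine ⟨Cmap '' (Yset ×ˢ Q ×ˢ Q), (hYfin.isCompact.prod (hQ.prod hQ)).image (by fun_prop), ?_⟩
  intro g
  -- Otherwise some nonzero functional `l` kills all rational points in `g C`. In the direction `i`
  -- where `l` is largest at `w`, the `N` translates of `g W` by multiples of `T` are disjoint
  -- modulo `D`, against the choice of `N`.
  by_contra hne
  obtain ⟨l, hl0, hl⟩ := Submodule.exists_le_ker_of_lt_top _ (lt_top_iff_ne_top.2 hne)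
  have hmne : (Finset.univ : Finset (Fin m)).Nonempty := by
    by_contra hemp
    apply hl0
    apply (Module.finBasis F D).ext
    intro i
    exact absurd ⟨i, Finset.mem_univ i⟩ hemp
  obtain ⟨i, -, hi⟩ := Finset.exists_max_image Finset.univ
    (fun i => w (l (Module.finBasis F D i))) hmne
  have hipos : 0 < w (l (Module.finBasis F D i)) := by
    by_contra! hle
    apply hl0
    apply (Module.finBasis F D).ext
    intro j
    have := (hi j (Finset.mem_univ j)).trans hle
    have := le_antisymm this (apply_nonneg _ _)
    simpa using this
  -- the translates of `W` in the direction `i` are disjoint modulo `D`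
  have hdisj : ∀ j k : ℕ, j < N → k < N → ∀ x ∈ W, ∀ y ∈ W, ∀ d,
      (Y i (j * T) + leftMul σ g * x) - (Y i (k * T) + leftMul σ g * y) = diag F d →
        j = k ∧ d = 0 := by
    intro j k hj hk x hx y hy d hd
    have hd2 : diag F d = leftMul σ g * Cmap (Y i ((j * T : ℤ) - (k * T : ℤ)), x, y) := by
      rw [← hd]
      simp only [Cmap]
      rw [mul_add, hgY, hYadd, mul_sub]
      abel
    -- The difference `d` of two points of the translates is itself `g` times an element of `C`.
    have hld : l d = 0 := by
      refine LinearMap.mem_ker.1 (hl (Submodule.subset_span ⟨_, ⟨_, ⟨?_, hWQ hx, hWQ hy⟩, rfl⟩, hd2⟩))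
      refine Set.mem_iUnion.2 ⟨i, _, ⟨?_, ?_⟩, rfl⟩
      · have : (k : ℤ) * T ≤ N * T := by gcongr
        have : (0 : ℤ) ≤ j * T := by positivity
        omega
      · have : (j : ℤ) * T ≤ N * T := by gcongr
        have : (0 : ℤ) ≤ k * T := by positivity
        omega
    have hjk : j = k := by
      by_contra hjk
      have h1 := congrArg Prod.fst hd2
      have hco : ∀ n : Fin m,
          (((Module.finBasis F D).repr d n : F) : w.Completion) =
            (if i = n then ((j * T - k * T : ℤ) : w.Completion) else 0) +
            ((coordinates F D (InfiniteAdeleRing F) x.1 n) w -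
            (coordinates F D (InfiniteAdeleRing F) y.1 n) w) := by
        intro n
        have h2 := congrArg (fun z => (coordinates F D (InfiniteAdeleRing F) z n) w) h1
        have h3 : (leftMul σ g * Cmap (Y i ((j * T : ℤ) - (k * T : ℤ)), x, y)).1 =
            (((j * T : ℤ) - (k * T : ℤ) : ℤ) : InfiniteAdeleRing F) ⊗ₜ Module.finBasis F D i +
              (x.1 - y.1) := one_mul _
        rw [h3] at h2
        simp only [diag_apply, map_add, map_sub, Pi.add_apply, Pi.sub_apply, coordinates_tmul,
          one_mul, Module.Basis.repr_self, Finsupp.single_apply] at h2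
        refine Eq.trans ?_ (h2.trans ?_)
        · rfl
        · refine congrArg₂ (fun a b : w.Completion => a + b) ?_ rfl
          split_ifs
          · rw [map_one, mul_one]
            exact map_intCast (Pi.evalRingHom (fun w : InfinitePlace F => w.Completion) w) _
          · rw [map_zero, mul_zero]
            rfl
      have hn1 : ∀ a : F, ‖(a : w.Completion)‖ = w a := fun a => InfinitePlace.Completion.norm_coe _ _
      let ι : F →+* w.Completion := algebraMap F w.Completion
      have hsum : ∑ n, ι ((Module.finBasis F D).repr d n) * ι (l (Module.finBasis F D n)) = 0 := by
        have h4 : l d = ∑ n, (Module.finBasis F D).repr d n * l (Module.finBasis F D n) := by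
          conv_lhs => rw [← (Module.finBasis F D).sum_repr d]
          rw [map_sum]
          simp only [map_smul, smul_eq_mul]
        rw [hld] at h4
        rw [← map_zero ι, h4, map_sum]
        simp only [map_mul]
      have hsum2 : ((j * T - k * T : ℤ) : w.Completion) * ι (l (Module.finBasis F D i)) =
          - ∑ n, ((coordinates F D (InfiniteAdeleRing F) x.1 n) w -
            (coordinates F D (InfiniteAdeleRing F) y.1 n) w) * ι (l (Module.finBasis F D n)) := by
        rw [eq_neg_iff_add_eq_zero, ← hsum]
        have h5 : ∀ n, ι ((Module.finBasis F D).repr d n) =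
          (if i = n then ((j * T - k * T : ℤ) : w.Completion) else 0) +
            ((coordinates F D (InfiniteAdeleRing F) x.1 n) w -
            (coordinates F D (InfiniteAdeleRing F) y.1 n) w) := hco
        simp only [h5, add_mul, Finset.sum_add_distrib, ite_mul, zero_mul, Finset.sum_ite_eq,
          Finset.mem_univ, if_true]
      -- In `l d = 0` the shift must be cancelled by `m` terms, each of size at most `2 M` times the
      -- largest value of `l`; this bounds `|j - k| T` by `2 m M < T`.
      have hle1 : ‖((j * T - k * T : ℤ) : w.Completion) * ι (l (Module.finBasis F D i))‖ ≤
          m * ((2 * M) * w (l (Module.finBasis F D i))) := by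
        rw [hsum2, norm_neg]
        refine (norm_sum_le_of_le (f := _) (n := fun _ => (2 * M) * w (l (Module.finBasis F D i)))
          Finset.univ ?_).trans ?_
        · intro n _
          rw [norm_mul]
          have h6 : ‖ι (l (Module.finBasis F D n))‖ = w (l (Module.finBasis F D n)) := hn1 _
          rw [h6]
          refine mul_le_mul ?_ (hi n (Finset.mem_univ n)) (apply_nonneg _ _) ?_
          · refine (norm_sub_le _ _).trans ?_
            rw [two_mul]
            exact add_le_add (hM n x (hWQ hx)) (hM n y (hWQ hy))
          · have := (norm_nonneg _).trans (hM n x (hWQ hx))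
            positivity
        · rw [Finset.sum_const, Finset.card_univ, Fintype.card_fin, nsmul_eq_mul]
      have hge : (T : ℝ) ≤ ‖((j * T - k * T : ℤ) : w.Completion)‖ := by
        have h7 : ((j * T - k * T : ℤ) : w.Completion) = ι ((j * T - k * T : ℤ) : F) :=
          (map_intCast ι _).symm
        have h8 : ‖ι ((j * T - k * T : ℤ) : F)‖ = w ((j * T - k * T : ℤ) : F) := hn1 _
        rw [h7, h8, ← InfinitePlace.norm_embedding_eq w, map_intCast, Complex.norm_intCast,
          ← sub_mul, Int.cast_mul, abs_mul]
        have h9 : (1 : ℝ) ≤ |(((j : ℤ) - k : ℤ) : ℝ)| := by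
          have : (1 : ℤ) ≤ |(j : ℤ) - k| := Int.one_le_abs (by omega)
          exact_mod_cast this
        have h10 : |((T : ℤ) : ℝ)| = T := by simp
        rw [h10]
        exact le_mul_of_one_le_left (Nat.cast_nonneg _) h9
      rw [norm_mul] at hle1
      have h6 : ‖ι (l (Module.finBasis F D i))‖ = w (l (Module.finBasis F D i)) := hn1 _
      rw [h6, ← mul_assoc] at hle1
      have := le_of_mul_le_mul_right hle1 hipos
      linarith
    refine ⟨hjk, hinj g x hx y hy d ?_⟩
    rw [← hd, hjk]
    abel
  let E : ℕ → Set (DAdele F D) := fun j => (fun x => Y i (j * T) + leftMulEquiv σ g x) '' W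
  have hEopen : ∀ j, IsOpen (E j) := fun j =>
    ((Homeomorph.addLeft (Y i (j * T))).isOpenMap.comp
      (leftMulEquiv σ g).toHomeomorph.isOpenMap) _ hW
  have hEmeas : ∀ j, μ (E j) = μ W := by
    intro j
    have h1 : E j = (fun x => -Y i (j * T) + x) ⁻¹' (leftMulEquiv σ g '' W) := by
      ext x
      constructor
      · rintro ⟨y, hy, rfl⟩
        exact ⟨y, hy, by simp⟩
      · rintro ⟨y, hy, h⟩
        exact ⟨y, hy, by simp [h]⟩
    rw [h1, measure_preimage_add, ← addEquivAddHaarChar_smul_preimage μ (leftMulEquiv σ g),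
      Set.preimage_image_eq _ (leftMulEquiv σ g).injective, addHaarChar_leftMul_eq_one σ hc hdef,
      one_smul]
  have hle := measure_le_of_injOn_quotient (δ := (diag F : D →+* DAdele F D).toAddMonoidHom) μ
    (fun C hC => finite_diag_mem_of_isCompact hC) hΩ hcov
    (E := ⋃ j ∈ Finset.range N, E j)
    (Q := ⋃ j ∈ Finset.range N, (fun x => Y i (j * T) + leftMulEquiv σ g x) '' Q)
    (isOpen_biUnion fun j _ => hEopen j)
    ((Finset.range N).isCompact_biUnion fun j _ => hQ.image
      (continuous_const.add (leftMulEquiv σ g).continuous))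
    (Set.iUnion₂_mono fun j _ => Set.image_mono hWQ) (by
      intro a ha b hb d hd
      simp only [Set.mem_iUnion] at ha hb
      obtain ⟨j, hj, x, hx, rfl⟩ := ha
      obtain ⟨k, hk, y, hy, rfl⟩ := hb
      exact (hdisj j k (Finset.mem_range.1 hj) (Finset.mem_range.1 hk) x hx y hy d hd).2)
  rw [measure_biUnion_finset (by
      intro j hj k hk hjk
      rw [Function.onFun, Set.disjoint_left]
      rintro _ ⟨x, hx, rfl⟩ ⟨y, hy, hxy⟩
      apply hjk
      refine (hdisj j k (Finset.mem_range.1 hj) (Finset.mem_range.1 hk) x hx y hy 0 ?_).1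
      rw [map_zero, sub_eq_zero]
      exact hxy.symm) (fun j _ => (hEopen j).measurableSet)] at hle
  simp only [hEmeas, Finset.sum_const, Finset.card_range, nsmul_eq_mul] at hle
  exact absurd hN (not_lt.2 hle)

end ClassNumber

end DefiniteUnitary
end

noncomputable section

namespace DefiniteUnitary

/-! ### Finiteness of the class number -/

section DoubleCosets

open NumberField MeasureTheory Topology

attribute [local instance] tensorTopology

variable {F K D : Type*} [Field F] [NumberField F] [Field K] [Algebra F K]
  [Ring D] [Algebra K D] [Algebra F D] [IsScalarTower F K D] [FiniteDimensional F D]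
  {c : K ≃ₐ[F] K} (σ : AntiInvolution D c)

/-- The rational point defined by a unitary element of `D`. -/
def rationalPoint (u : D) (h : u * σ.toLinearMap u = 1) (h' : σ.toLinearMap u * u = 1) : GAf σ :=
  U.map σ (Algebra.ofId F (FiniteAdeleRing (𝓞 F) F))
    (U.mk σ (1 ⊗ₜ u) (by simp [h, Algebra.TensorProduct.one_def])
      (by simp [h', Algebra.TensorProduct.one_def]))

lemma rationalPoint_mem (u : D) (h : u * σ.toLinearMap u = 1) (h' : σ.toLinearMap u * u = 1) :
    rationalPoint σ u h h' ∈ rationalPoints σ := ⟨_, rfl⟩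

lemma val_rationalPoint (u : D) (h : u * σ.toLinearMap u = 1) (h' : σ.toLinearMap u * u = 1) :
    U.val σ (rationalPoint σ u h h') = (diag F u).2 := by
  rw [rationalPoint, U.val_map, U.val_mk]
  simp [diag_apply]

/-- `G(𝔸_f)` is the product of `G(ℚ)` and a compact set. -/
lemma exists_isCompact_rationalPoints_mul [IsSimpleRing D] (hc : c ≠ 1)
    (hdef : CompactSpace (U σ (InfiniteAdeleRing F))) :
    ∃ C : Set (GAf σ), IsCompact C ∧ ∀ g : GAf σ, ∃ γ ∈ rationalPoints σ, γ⁻¹ * g ∈ C := by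
  classical
  obtain ⟨C, hC, hspan⟩ := exists_isCompact_span_eq_top σ hc hdef
  set m := Module.finrank F D
  -- Each `g` gets a basis of `D` lying in `g C`.
  have hbasis : ∀ g : GAf σ, ∃ (b : Fin m → D) (x : Fin m → DAdele F D),
      LinearIndependent F b ∧ ⊤ ≤ Submodule.span F (Set.range b) ∧ ∀ i, x i ∈ C ∧
        diag F (b i) = leftMul σ g * x i := by
    intro g
    have := Submodule.exists_fun_fin_finrank_span_eq F
      {d : D | ∃ x ∈ C, diag F d = leftMul σ g * x}
    rw [hspan g, finrank_top] at this
    obtain ⟨b, hb, hs, hli⟩ := this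
    choose x hx using hb
    exact ⟨b, x, hli, hs.ge, hx⟩
  choose b x hli hs hx using hbasis
  let B : ∀ g, Module.Basis (Fin m) F D := fun g => Module.Basis.mk (hli g) (hs g)
  have hB : ∀ g i, B g i = b g i := fun g i => Module.Basis.mk_apply _ _ i
  let G : GAf σ → Fin m → Fin m → D := fun g i j => σ.toLinearMap (b g i) * b g j
  -- The Gram entries `b_i⋆ b_j = x_i⋆ x_j` are rational points of the compact set `C⋆ C`.
  have hGfin : (Set.range G).Finite := by
    have h1 := finite_diag_mem_of_isCompact (F := F) (D := D) ((hC.prod hC).image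
      (f := fun q : DAdele F D × DAdele F D => starAdele σ q.1 * q.2)
      (((continuous_starAdele σ).comp continuous_fst).mul continuous_snd))
    refine (Set.Finite.pi' fun _ : Fin m => Set.Finite.pi' fun _ : Fin m => h1).subset ?_
    rintro _ ⟨g, rfl⟩ i j
    refine ⟨(x g i, x g j), ⟨(hx g i).1, (hx g j).1⟩, ?_⟩
    simp only [G]
    rw [map_mul, ← starAdele_diag σ, (hx g i).2, (hx g j).2, star_mul_leftMul]
  -- One reference point is fixed for every Gram matrix that occurs.
  have hrep : ∃ rep : (Fin m → Fin m → D) → GAf σ, ∀ g, G (rep (G g)) = G g :=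
    ⟨fun a => if h : ∃ g, G g = a then h.choose else 1, fun g => by
      have h : ∃ g', G g' = G g := ⟨g, rfl⟩
      simp only [dif_pos h]
      exact h.choose_spec⟩
  obtain ⟨rep, hrep⟩ := hrep
  -- The combinations `∑ c_i y_i` with `y_i ∈ C`, where the `c_i` are the coordinates of `1` in the
  -- basis attached to `g`. The inverse of the element `γ⁻¹ g` found below lies in such a set.
  let Q : GAf σ → Set (FiniteAdeleRing (𝓞 F) F ⊗[F] D) := fun g =>
    (fun y : Fin m → DAdele F D => ∑ i, (1 ⊗ₜ[F] (1 : D)) * ((B g).repr 1 i • (y i).2)) ''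
      Set.univ.pi fun _ => C
  have hQ : ∀ g, IsCompact (Q g) := fun g =>
    (isCompact_univ_pi fun _ => hC).image (by
      refine continuous_finsetSum _ fun i _ => continuous_const.mul ?_
      have : ∀ (a : F) (z : FiniteAdeleRing (𝓞 F) F ⊗[F] D), a • z =
          (algebraMap F (FiniteAdeleRing (𝓞 F) F) a) ⊗ₜ (1 : D) * z := by
        intro a z
        rw [Algebra.smul_def]
        rfl
      simp only [this]
      exact continuous_const.mul (continuous_snd.comp (continuous_apply i)))
  refine ⟨⋃ a ∈ hGfin.toFinset, (fun g => g⁻¹) '' (U.val σ ⁻¹' Q (rep a)),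
    hGfin.toFinset.isCompact_biUnion fun a _ =>
      ((U.isClosedEmbedding_val _ σ).isCompact_preimage (hQ _)).image continuous_inv, ?_⟩
  intro g
  set g₀ := rep (G g) with hg₀
  have hG : ∀ i j, σ.toLinearMap (b g₀ i) * b g₀ j = σ.toLinearMap (b g i) * b g j := fun i j =>
    congrFun (congrFun (hrep g) i) j
  -- Mapping the basis of `g₀` to that of `g` preserves the `D`-valued form `y⋆ z`, because the Gram
  -- matrices agree. Such a map is left multiplication by the unitary element `φ 1`.
  let φ : D →ₗ[F] D := (B g₀).constr F (b g)
  have hφb : ∀ i, φ (b g₀ i) = b g i := fun i => by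
    rw [← hB g₀ i]
    exact Module.Basis.constr_basis _ _ _ _
  have hφ : ∀ y z, σ.toLinearMap (φ y) * φ z = σ.toLinearMap y * z := by
    intro y z
    rw [← (B g₀).sum_repr y, ← (B g₀).sum_repr z]
    simp only [map_sum, map_smul, Finset.sum_mul, Finset.mul_sum, hB, hφb, smul_mul_assoc,
      mul_smul_comm, hG]
  have hu' : σ.toLinearMap (φ 1) * φ 1 = 1 := by rw [hφ, toLinearMap_one, one_mul]
  have : IsNoetherianRing D := isNoetherian_of_tower F inferInstance
  have hu : φ 1 * σ.toLinearMap (φ 1) = 1 := mul_eq_one_comm.1 hu'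
  have hφu : ∀ y, φ y = φ 1 * y := by
    intro y
    have := hφ 1 y
    rw [toLinearMap_one, one_mul] at this
    calc φ y = φ 1 * σ.toLinearMap (φ 1) * φ y := by rw [hu, one_mul]
      _ = φ 1 * y := by rw [mul_assoc, this]
  refine ⟨_, rationalPoint_mem σ (φ 1) hu hu', ?_⟩
  set γ := rationalPoint σ (φ 1) hu hu' with hγ
  refine Set.mem_biUnion (x := G g) (hGfin.mem_toFinset.2 ⟨g, rfl⟩) ⟨(γ⁻¹ * g)⁻¹, ?_, inv_inv _⟩
  refine ⟨x g, fun i _ => (hx g i).1, ?_⟩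
  have h1 : ∀ i, U.val σ (γ⁻¹ * g) * (x g i).2 = (diag F (b g₀ i)).2 := by
    intro i
    have h2 : U.val σ g * (x g i).2 = U.val σ γ * (diag F (b g₀ i)).2 := by
      have h3 := congrArg Prod.snd (hx g i).2
      rw [val_rationalPoint, ← Prod.snd_mul, ← map_mul, ← hφu, hφb, h3]
      rfl
    rw [U.val_mul, mul_assoc, h2, ← mul_assoc, ← U.val_mul, inv_mul_cancel, U.val_one, one_mul]
  -- Since `γ⁻¹ g` sends `x_i` to the `i`-th basis vector of `g₀`, it sends `∑ c_i x_i` to `∑ c_i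
  -- b_i = 1`.
  have h4 : U.val σ (γ⁻¹ * g) * ∑ i, (1 ⊗ₜ[F] (1 : D)) * ((B g₀).repr 1 i • (x g i).2) = 1 := by
    rw [← Algebra.TensorProduct.one_def]
    simp only [one_mul, Finset.mul_sum, mul_smul_comm, h1]
    have h5 : (diag F (∑ i, (B g₀).repr 1 i • B g₀ i)).2 = 1 := by
      rw [(B g₀).sum_repr, map_one]
      rfl
    rw [← h5]
    simp only [diag_apply, TensorProduct.tmul_sum, hB, TensorProduct.tmul_smul]
  change _ = U.val σ (γ⁻¹ * g)⁻¹
  rw [← mul_one (U.val σ (γ⁻¹ * g)⁻¹), ← h4, ← mul_assoc, ← U.val_mul, inv_mul_cancel, U.val_one,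
    one_mul]

/-- Finiteness of the class number. -/
lemma exists_finset_doubleCoset [IsSimpleRing D] (hc : c ≠ 1)
    (hdef : CompactSpace (U σ (InfiniteAdeleRing F))) (H : Subgroup (GAf σ))
    (hH : IsOpen (H : Set (GAf σ))) :
    ∃ T : Finset (GAf σ), ∀ g, ∃ γ ∈ rationalPoints σ, ∃ t ∈ T, ∃ k ∈ H, g = γ * t * k := by
  obtain ⟨C, hC, h⟩ := exists_isCompact_rationalPoints_mul σ hc hdef
  obtain ⟨T, hT⟩ := hC.elim_finite_subcover (fun t : GAf σ => (fun x => t⁻¹ * x) ⁻¹' (H : Set (GAf σ)))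
    (fun t => hH.preimage (continuous_const.mul continuous_id))
    (fun t _ => Set.mem_iUnion.2 ⟨t, by simp [H.one_mem]⟩)
  refine ⟨T, fun g => ?_⟩
  obtain ⟨γ, hγ, hg⟩ := h g
  obtain ⟨t, ht, hk⟩ := Set.mem_iUnion₂.1 (hT hg)
  exact ⟨γ, hγ, t, ht, _, hk, by group⟩

end DoubleCosets

end DefiniteUnitary
end

noncomputable section

namespace DefiniteUnitary

/-! ### Gluing local points; the decomposition `G(𝔸_f) = G(ℚ_p) × G(𝔸_f^p)` -/

section Gluing

open NumberField Topology Filter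

attribute [local instance] tensorTopology

variable {F K D : Type*} [Field F] [NumberField F] [Field K] [Algebra F K]
  [Ring D] [Algebra F D] [Algebra K D] [FiniteDimensional F D]
  {c : K ≃ₐ[F] K} (σ : AntiInvolution D c)

/-- The coordinates of `y` and `z` are integral almost everywhere, hence so are those of `x`. Two
sources are allowed because truncation mixes a point with `1`. -/
lemma exists_tensor_glue (x : ∀ v : HeightOneSpectrum (𝓞 F), v.adicCompletion F ⊗[F] D)
    (y z : FiniteAdeleRing (𝓞 F) F ⊗[F] D)
    (h : ∀ᶠ v in cofinite, x v = Algebra.TensorProduct.map (adeleEval v) (AlgHom.id F D) y ∨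
      x v = Algebra.TensorProduct.map (adeleEval v) (AlgHom.id F D) z) :
    ∃ w, ∀ v, Algebra.TensorProduct.map (adeleEval v) (AlgHom.id F D) w = x v := by
  have hint : ∀ i, ∀ᶠ v : HeightOneSpectrum (𝓞 F) in cofinite,
      coordinates F D (v.adicCompletion F) (x v) i ∈ v.adicCompletionIntegers F := by
    intro i
    filter_upwards [h, eventually_mem_integers (coordinates F D (FiniteAdeleRing (𝓞 F) F) y i),
      eventually_mem_integers (coordinates F D (FiniteAdeleRing (𝓞 F) F) z i)] with v hv hy hz
    rcases hv with hv | hv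
    · rw [hv, coordinates_map]; exact hy
    · rw [hv, coordinates_map]; exact hz
  let a : Fin (Module.finrank F D) → FiniteAdeleRing (𝓞 F) F := fun i => ⟨_, hint i⟩
  refine ⟨(coordinates F D (FiniteAdeleRing (𝓞 F) F)).symm a, fun v => ?_⟩
  apply (coordinates F D (v.adicCompletion F)).injective
  ext i
  rw [coordinates_map, ContinuousLinearEquiv.apply_symm_apply]
  rfl

lemma starR_map {R S : Type*} [CommRing R] [Algebra F R] [CommRing S] [Algebra F S]
    (f : R →ₐ[F] S) (x : R ⊗[F] D) :
    starR σ S (Algebra.TensorProduct.map f (AlgHom.id F D) x) =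
      Algebra.TensorProduct.map f (AlgHom.id F D) (starR σ R x) := by
  induction x using TensorProduct.induction_on with
  | zero => simp
  | add a b ha hb => simp [ha, hb]
  | tmul r d => simp

/-- Families of local points which almost everywhere come from one of two adelic points glue. -/
lemma exists_glue (u : ∀ v, ULoc σ v) (y z : GAf σ)
    (h : ∀ᶠ v in cofinite, u v = component σ v y ∨ u v = component σ v z) :
    ∃ w : GAf σ, ∀ v, component σ v w = u v := by
  obtain ⟨w, hw⟩ := exists_tensor_glue (fun v => U.val σ (u v)) (U.val σ y) (U.val σ z) (by
    filter_upwards [h] with v hv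
    exact hv.imp (fun e => by rw [e]; rfl) (fun e => by rw [e]; rfl))
  refine ⟨U.mk σ w ?_ ?_, fun v => U.ext σ (hw v)⟩
  · refine adele_tensor_ext fun v => ?_
    rw [map_mul, ← starR_map, hw, U.val_mul_star, map_one]
  · refine adele_tensor_ext fun v => ?_
    rw [map_mul, ← starR_map, hw, U.star_mul_val, map_one]

open Classical in
lemma exists_truncate (P : Set (HeightOneSpectrum (𝓞 F))) (g : GAf σ) :
    ∃ w : GAf σ, ∀ v, component σ v w = if v ∈ P then component σ v g else 1 :=
  exists_glue σ _ g 1 (Eventually.of_forall fun v => by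
    by_cases hv : v ∈ P
    · simp [hv]
    · simp [hv])

open Classical in
/-- The homomorphism which makes the components outside `P` trivial. -/
def truncate (P : Set (HeightOneSpectrum (𝓞 F))) : GAf σ →* GAf σ where
  toFun g := (exists_truncate σ P g).choose
  map_one' := GAf_ext σ fun v => by
    rw [(exists_truncate σ P 1).choose_spec v, map_one, ite_self]
  map_mul' g h := GAf_ext σ fun v => by
    rw [map_mul, (exists_truncate σ P (g * h)).choose_spec v,
      (exists_truncate σ P g).choose_spec v, (exists_truncate σ P h).choose_spec v]
    split_ifs
    · rw [map_mul]
    · rw [one_mul]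

lemma component_truncate_of_mem {P : Set (HeightOneSpectrum (𝓞 F))} (g : GAf σ)
    {v : HeightOneSpectrum (𝓞 F)} (hv : v ∈ P) :
    component σ v (truncate σ P g) = component σ v g :=
  ((exists_truncate σ P g).choose_spec v).trans (if_pos hv)

lemma component_truncate_of_notMem {P : Set (HeightOneSpectrum (𝓞 F))} (g : GAf σ)
    {v : HeightOneSpectrum (𝓞 F)} (hv : v ∉ P) :
    component σ v (truncate σ P g) = 1 :=
  ((exists_truncate σ P g).choose_spec v).trans (if_neg hv)

open Classical in
lemma continuous_truncate (P : Set (HeightOneSpectrum (𝓞 F))) : Continuous (truncate σ P) := by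
  -- With the idempotent adele `e` of `P`, truncation is the map `g ↦ e g + (1 - e)`.
  let e : FiniteAdeleRing (𝓞 F) F := ⟨fun v => if v ∈ P then 1 else 0,
    Eventually.of_forall fun v => by
      change (if v ∈ P then (1 : v.adicCompletion F) else 0) ∈ v.adicCompletionIntegers F
      split_ifs
      · exact one_mem _
      · exact zero_mem _⟩
  have he : ∀ v, adeleEval v e = if v ∈ P then 1 else 0 := fun v => rfl
  refine continuous_induced_rng.2 ?_
  have : (U.val σ ∘ truncate σ P : GAf σ → FiniteAdeleRing (𝓞 F) F ⊗[F] D) =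
      fun g => (e ⊗ₜ 1) * U.val σ g + ((1 - e) ⊗ₜ 1) := by
    funext g
    refine adele_tensor_ext fun v => ?_
    have h1 : Algebra.TensorProduct.map (adeleEval v) (AlgHom.id F D)
        (U.val σ (truncate σ P g)) = U.val σ (component σ v (truncate σ P g)) := rfl
    have h2 : Algebra.TensorProduct.map (adeleEval v) (AlgHom.id F D) (U.val σ g) =
      U.val σ (component σ v g) := rfl
    rw [Function.comp_apply, h1, map_add, map_mul, h2, Algebra.TensorProduct.map_tmul,
      Algebra.TensorProduct.map_tmul, map_sub, he, map_one, map_one]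
    by_cases hv : v ∈ P
    · rw [component_truncate_of_mem σ g hv, if_pos hv, sub_self, TensorProduct.zero_tmul, add_zero,
        ← Algebra.TensorProduct.one_def, one_mul]
    · rw [component_truncate_of_notMem σ g hv, if_neg hv, sub_zero, TensorProduct.zero_tmul,
        zero_mul, zero_add, ← Algebra.TensorProduct.one_def, U.val_one]
  exact this ▸ (continuous_const.mul (U.isEmbedding_val _ σ).continuous).add continuous_const

variable (p : ℕ)

lemma mem_GQp {g : GAf σ} : g ∈ GQp σ p ↔ ∀ v, ¬ Above p v → component σ v g = 1 := by
  simp only [GQp, Subgroup.mem_iInf, Subtype.forall]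
  rfl

lemma mem_GAfp {g : GAf σ} : g ∈ GAfp σ p ↔ ∀ v, Above p v → component σ v g = 1 := by
  simp only [GAfp, Subgroup.mem_iInf, Subtype.forall]
  rfl

/-- The projection `G(𝔸_f) → G(ℚ_p)`. -/
def projQp : GAf σ →* GQp σ p :=
  (truncate σ {v | Above p v}).codRestrict (GQp σ p) fun g =>
    (mem_GQp σ p).2 fun _ hv => component_truncate_of_notMem σ g hv

/-- The projection `G(𝔸_f) → G(𝔸_f^p)`. -/
def projAfp : GAf σ →* GAfp σ p :=
  (truncate σ {v | ¬ Above p v}).codRestrict (GAfp σ p) fun g =>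
    (mem_GAfp σ p).2 fun _ hv => component_truncate_of_notMem σ g (not_not.2 hv)

lemma continuous_projQp : Continuous (projQp σ p) := (continuous_truncate σ _).subtype_mk _

lemma continuous_projAfp : Continuous (projAfp σ p) := (continuous_truncate σ _).subtype_mk _

lemma projQp_mul_projAfp (g : GAf σ) : (projQp σ p g : GAf σ) * projAfp σ p g = g := by
  refine GAf_ext σ fun v => ?_
  rw [map_mul]
  by_cases hv : Above p v
  · rw [(mem_GAfp σ p).1 (projAfp σ p g).2 v hv, mul_one]
    exact component_truncate_of_mem σ g hv
  · rw [(mem_GQp σ p).1 (projQp σ p g).2 v hv, one_mul]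
    exact component_truncate_of_mem σ g hv

lemma projQp_coe (k : GQp σ p) : projQp σ p k = k := by
  refine Subtype.ext (GAf_ext σ fun v => ?_)
  by_cases hv : Above p v
  · exact component_truncate_of_mem σ _ hv
  · rw [(mem_GQp σ p).1 k.2 v hv]
    exact component_truncate_of_notMem σ _ hv

lemma projQp_eq_one {g : GAf σ} (hg : g ∈ GAfp σ p) : projQp σ p g = 1 := by
  refine Subtype.ext (GAf_ext σ fun v => ?_)
  by_cases hv : Above p v
  · refine (component_truncate_of_mem σ _ hv).trans ?_
    rw [(mem_GAfp σ p).1 hg v hv]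
    rfl
  · exact component_truncate_of_notMem σ _ hv

lemma projAfp_eq_one (k : GQp σ p) : projAfp σ p k = 1 := by
  have h := projQp_mul_projAfp σ p (k : GAf σ)
  rw [projQp_coe, mul_eq_left] at h
  exact Subtype.ext h

lemma projAfp_coe {g : GAf σ} (hg : g ∈ GAfp σ p) : (projAfp σ p g : GAf σ) = g := by
  have h := projQp_mul_projAfp σ p g
  rwa [projQp_eq_one σ p hg, Subgroup.coe_one, one_mul] at h

end Gluing

/-! ### Free action of `K_p` on `G(ℚ)\G(𝔸_f)/K^p` -/

section Freeness

open NumberField Topology Filter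

attribute [local instance] tensorTopology

variable {F K D : Type*} [Field F] [NumberField F] [Field K] [Algebra F K]
  [Ring D] [Algebra K D] [Algebra F D] [IsScalarTower F K D] [FiniteDimensional F D]
  {c : K ≃ₐ[F] K} {σ : AntiInvolution D c} {p : ℕ} (Kt : TameLevel σ p)

/-- The level `K_p K^p`. -/
def level (H : Subgroup (GQp σ p)) : Subgroup (GAf σ) :=
  H.comap (projQp σ p) ⊓ (Kt.toSubgroup.subgroupOf (GAfp σ p)).comap (projAfp σ p)

lemma mem_level {H : Subgroup (GQp σ p)} {g : GAf σ} :
    g ∈ level Kt H ↔ projQp σ p g ∈ H ∧ (projAfp σ p g : GAf σ) ∈ Kt.toSubgroup := Iff.rfl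

lemma isOpen_level {H : Subgroup (GQp σ p)} (hH : IsOpen (H : Set (GQp σ p))) :
    IsOpen (level Kt H : Set (GAf σ)) :=
  (hH.preimage (continuous_projQp σ p)).inter
    (Kt.isOpen_toSubgroup.preimage (continuous_projAfp σ p))

lemma mul_mem_level {H : Subgroup (GQp σ p)} {k : GQp σ p} (hk : k ∈ H) {κ : GAf σ}
    (hκ : κ ∈ Kt.toSubgroup) : (k : GAf σ) * κ ∈ level Kt H := by
  rw [mem_level, map_mul, map_mul, projQp_coe, projQp_eq_one σ p (Kt.le hκ), projAfp_eq_one,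
    mul_one, one_mul, projAfp_coe σ p (Kt.le hκ)]
  exact ⟨hk, hκ⟩

lemma level_le {H : Subgroup (GQp σ p)} :
    level Kt H ≤ H.map (GQp σ p).subtype ⊔ Kt.toSubgroup := by
  intro g hg
  rw [← projQp_mul_projAfp σ p g]
  exact Subgroup.mul_mem_sup ⟨_, hg.1, rfl⟩ hg.2

lemma isCompact_level {H : Subgroup (GQp σ p)} (hH : IsCompact (H : Set (GQp σ p))) :
    IsCompact (level Kt H : Set (GAf σ)) := by
  have h := (hH.prod Kt.isCompact_toSubgroup).image (f := fun q : GQp σ p × GAf σ =>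
    (q.1 : GAf σ) * q.2) (by fun_prop)
  convert h using 1
  ext g
  constructor
  · intro hg
    exact ⟨(projQp σ p g, projAfp σ p g), ⟨hg.1, hg.2⟩, projQp_mul_projAfp σ p g⟩
  · rintro ⟨⟨k, κ⟩, ⟨hk, hκ⟩, rfl⟩
    exact mul_mem_level Kt hk hκ

/-- The arithmetic groups of a definite unitary group are finite. -/
lemma finite_rationalPoints_inter (hdef : CompactSpace (U σ (InfiniteAdeleRing F)))
    {C : Set (GAf σ)} (hC : IsCompact C) : {γ ∈ (rationalPoints σ : Set (GAf σ)) | γ ∈ C}.Finite := by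
  -- The infinite components of rational points stay in a compact group, so these points come from
  -- elements of `D` in a compact subset of its adelic points; `D` is discrete there.
  have hinf : IsCompact (Set.range (U.val σ : U σ (InfiniteAdeleRing F) → _)) :=
    isCompact_range (U.isEmbedding_val _ σ).continuous
  have hfin := hC.image (U.isEmbedding_val _ σ).continuous
  have h := finite_diag_mem_of_isCompact (F := F) (D := D) (hinf.prod hfin)
  refine Set.Finite.of_finite_image (f := U.val σ) ((h.image (fun d => (diag F d).2)).subset ?_)
    (fun a _ b _ hab => U.ext σ hab)
  rintro _ ⟨_, ⟨⟨u, rfl⟩, hu⟩, rfl⟩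
  let d : D := Algebra.TensorProduct.lid F D (U.val σ u)
  have hd : U.val σ u = (1 : F) ⊗ₜ d := by
    apply (Algebra.TensorProduct.lid F D).injective
    simp [d]
  have hmap : ∀ (R : Type _) [CommRing R] [Algebra F R],
      U.val σ (U.map σ (Algebra.ofId F R) u) = (1 : R) ⊗ₜ d := by
    intro R _ _
    rw [U.val_map, hd]
    simp
  refine ⟨d, ⟨⟨U.map σ (Algebra.ofId F _) u, hmap _⟩, ⟨_, hu, hmap _⟩⟩, (hmap _).symm⟩

/-- In each finite quotient by an open normal subgroup the order of `a` divides both `N` and a power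
of `p`; open normal subgroups separate points of a profinite group. -/
lemma eq_one_of_pow_eq_one {G : Type*} [Group G] [TopologicalSpace G] [IsTopologicalGroup G]
    [CompactSpace G] [T2Space G] [TotallyDisconnectedSpace G] [hp : Fact p.Prime] (hG : IsProP p G)
    {N : ℕ} (hN : ¬ p ∣ N) {a : G} (ha : a ^ N = 1) : a = 1 := by
  by_contra hne
  obtain ⟨H, hH⟩ := ProfiniteGrp.exist_openNormalSubgroup_sub_open_nhds_of_one
    (isOpen_compl_singleton (x := a)) (by simpa using Ne.symm hne)
  obtain ⟨k, hk⟩ := hG H.toSubgroup inferInstance H.isOpen'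
  have h1 : a ^ (p ^ k) ∈ H.toSubgroup := by
    rw [← hk]
    exact Subgroup.pow_index_mem _ _
  have hcop : Nat.Coprime (p ^ k) N := (Nat.Coprime.pow_left _ ((hp.out.coprime_iff_not_dvd).2 hN))
  have h2 : a ∈ H.toSubgroup := by
    have h3 : (QuotientGroup.mk a : G ⧸ H.toSubgroup) = 1 := by
      rw [← orderOf_eq_one_iff, ← Nat.dvd_one, ← hcop]
      refine Nat.dvd_gcd (orderOf_dvd_of_pow_eq_one ?_) (orderOf_dvd_of_pow_eq_one ?_)
      · rw [← QuotientGroup.mk_pow]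
        exact (QuotientGroup.eq_one_iff _).2 h1
      · rw [← QuotientGroup.mk_pow, ha]
        rfl
    exact (QuotientGroup.eq_one_iff _).1 h3
  exact hH h2 rfl

variable {Kp : Subgroup (GQp σ p)}

/-- `K_p` acts freely on `G(ℚ) \ G(𝔸_f) / K^p`. -/
lemma eq_of_mul_eq_mul [Fact p.Prime] (hdef : CompactSpace (U σ (InfiniteAdeleRing F)))
    (hsmall : SufficientlySmall σ p Kt) (hKp_open : IsOpen (Kp : Set (GQp σ p)))
    (hKp_compact : IsCompact (Kp : Set (GQp σ p))) (hKp_pro : IsProP p Kp) {g γ κ κ' : GAf σ}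
    {k k' : Kp} (hγ : γ ∈ rationalPoints σ) (hκ : κ ∈ Kt.toSubgroup) (hκ' : κ' ∈ Kt.toSubgroup)
    (h : γ * g * k * κ = g * k' * κ') : k = k' := by
  have : CompactSpace Kp := isCompact_iff_compactSpace.1 hKp_compact
  -- `a` is the `p`-component of `g⁻¹ γ g`, which belongs to `K_p K^p`.
  set a : Kp := k' * k⁻¹ with ha
  have h1 : g⁻¹ * γ * g = (a : GQp σ p) * (κ' * κ⁻¹) := by
    have hc : (k : GAf σ)⁻¹ * (κ' * κ⁻¹) = (κ' * κ⁻¹) * (k : GAf σ)⁻¹ :=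
      GQp_commute σ p (inv_mem k.1.2) (mul_mem (Kt.le hκ') (inv_mem (Kt.le hκ)))
    have h2 : γ = g * k' * κ' * κ⁻¹ * (k : GAf σ)⁻¹ * g⁻¹ := by
      rw [← h]; group
    have h3 : ((a : GQp σ p) : GAf σ) = k' * (k : GAf σ)⁻¹ := rfl
    rw [h2, h3, mul_assoc (k' : GAf σ), hc]
    group
  have hmem : ∀ n : ℕ, g⁻¹ * γ ^ n * g ∈ level Kt Kp ∧ projQp σ p (g⁻¹ * γ ^ n * g) = a ^ n := by
    intro n
    have h2 : g⁻¹ * γ ^ n * g = (g⁻¹ * γ * g) ^ n := by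
      have := conj_pow (i := n) (a := g⁻¹) (b := γ)
      rw [inv_inv] at this
      exact this.symm
    rw [h2]
    have h3 : g⁻¹ * γ * g ∈ level Kt Kp := by
      rw [h1]
      exact mul_mem_level Kt a.2 (mul_mem hκ' (inv_mem hκ))
    refine ⟨pow_mem h3 n, ?_⟩
    rw [map_pow, h1, map_mul, projQp_coe,
      projQp_eq_one σ p (mul_mem (Kt.le hκ') (inv_mem (Kt.le hκ))), mul_one]
  -- All powers of `γ` lie in one finite arithmetic group.
  have hfin : IsOfFinOrder γ := by
    have hf := finite_rationalPoints_inter hdef ((isCompact_level Kt hKp_compact).image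
      (f := fun x => g * x * g⁻¹) (by fun_prop))
    have : ¬ Function.Injective (fun n : ℕ => γ ^ n) := by
      intro hinj
      refine Set.infinite_range_of_injective hinj (hf.subset ?_)
      rintro _ ⟨n, rfl⟩
      exact ⟨pow_mem hγ n, ⟨_, (hmem n).1, by group⟩⟩
    by_contra hnf
    exact this (injective_pow_iff_not_isOfFinOrder.2 hnf)
  have hpos := hfin.orderOf_pos
  have hndvd : ¬ p ∣ orderOf γ := by
    rintro ⟨n, hn⟩
    have hn0 : n ≠ 0 := by
      rintro rfl
      simp [hn] at hpos
    -- If `γ` has order `p n`, then `γ ^ n` has the forbidden order `p`.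
    refine hsmall Kp hKp_open hKp_compact g (γ ^ n) (pow_mem hγ n) (level_le Kt (hmem n).1) ?_
    have hdiv : n ∣ orderOf γ := ⟨p, by rw [hn, mul_comm]⟩
    rw [orderOf_pow_of_dvd hn0 hdiv, hn, Nat.mul_div_cancel _ (Nat.pos_of_ne_zero hn0)]
  have haN : a ^ orderOf γ = 1 := by
    have h2 := (hmem (orderOf γ)).2
    rw [pow_orderOf_eq_one, mul_one, inv_mul_cancel, map_one] at h2
    exact Subtype.ext h2.symm
  have := eq_one_of_pow_eq_one hKp_pro hndvd haN
  rw [ha, mul_inv_eq_one] at this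
  exact this.symm

/-- Representatives for `G(ℚ) \ G(𝔸_f) / K_p K^p`, and the coordinates which they define. -/
lemma exists_representatives [IsSimpleRing D] (hc : c ≠ 1) [Fact p.Prime]
    (hdef : CompactSpace (U σ (InfiniteAdeleRing F)))
    (hsmall : SufficientlySmall σ p Kt) (hKp_open : IsOpen (Kp : Set (GQp σ p)))
    (hKp_compact : IsCompact (Kp : Set (GQp σ p))) (hKp_pro : IsProP p Kp) :
    ∃ (r : ℕ) (_ : 0 < r) (g : Fin r → GAf σ) (idx : GAf σ → Fin r) (kp : GAf σ → Kp),
      (∀ x, ∃ γ ∈ rationalPoints σ, ∃ κ ∈ Kt.toSubgroup, x = γ * g (idx x) * kp x * κ) ∧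
      ∀ i (k : Kp), ∀ γ ∈ rationalPoints σ, ∀ κ ∈ Kt.toSubgroup,
        idx (γ * g i * k * κ) = i ∧ kp (γ * g i * k * κ) = k := by
  classical
  obtain ⟨T, hT⟩ := exists_finset_doubleCoset σ hc hdef (level Kt Kp) (isOpen_level Kt hKp_open)
  let Q := DoubleCoset.Quotient (rationalPoints σ : Set (GAf σ)) (level Kt Kp : Set (GAf σ))
  let q : GAf σ → Q := DoubleCoset.mk (rationalPoints σ) (level Kt Kp)
  have hq : ∀ x y, q x = q y ↔ ∃ γ ∈ rationalPoints σ, ∃ k ∈ level Kt Kp, y = γ * x * k :=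
    fun x y => DoubleCoset.eq _ _ _ _
  have hsurj : ∀ z : Q, ∃ t : T, q t = z := by
    intro z
    obtain ⟨x, rfl⟩ : ∃ x, q x = z := Quotient.exists_rep z
    obtain ⟨γ, hγ, t, ht, k, hk, hx⟩ := hT x
    exact ⟨⟨t, ht⟩, (hq _ _).2 ⟨γ, hγ, k, hk, hx⟩⟩
  have : Finite Q := Finite.of_surjective (fun t : T => q t) hsurj
  have : Nonempty Q := ⟨q 1⟩
  let e : Q ≃ Fin (Nat.card Q) := Finite.equivFin Q
  have hrep : ∀ i, ∃ x, q x = e.symm i := fun i => Quotient.exists_rep _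
  choose g hg using hrep
  have hex : ∀ x, ∃ k : Kp, ∃ γ ∈ rationalPoints σ, ∃ κ ∈ Kt.toSubgroup,
      x = γ * g (e (q x)) * k * κ := by
    intro x
    obtain ⟨γ, hγ, k, hk, hx⟩ := (hq (g (e (q x))) x).1 (by rw [hg, e.symm_apply_apply])
    refine ⟨⟨_, hk.1⟩, γ, hγ, _, hk.2, hx.trans ?_⟩
    rw [mul_assoc (γ * _)]
    exact congrArg _ (projQp_mul_projAfp σ p k).symm
  choose kp hkp using hex
  refine ⟨Nat.card Q, Nat.card_pos, g, fun x => e (q x), kp, hkp, ?_⟩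
  intro i k γ hγ κ hκ
  have h1 : e (q (γ * g i * k * κ)) = i := by
    rw [← Equiv.eq_symm_apply, ← hg]
    refine ((hq _ _).2 ⟨γ, hγ, _, mul_mem_level Kt k.2 hκ, ?_⟩).symm
    rw [mul_assoc]
  refine ⟨h1, ?_⟩
  obtain ⟨γ', hγ', κ', hκ', hx⟩ := hkp (γ * g i * k * κ)
  rw [h1] at hx
  -- The `K_p`-coordinate is well defined because the action is free.
  refine (eq_of_mul_eq_mul Kt hdef hsmall hKp_open hKp_compact hKp_pro (γ := γ'⁻¹ * γ) (g := g i)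
    (mul_mem (inv_mem hγ') hγ) hκ hκ' ?_).symm
  rw [show γ'⁻¹ * γ * g i * k * κ = γ'⁻¹ * (γ * g i * k * κ) by group]
  conv_lhs => rw [hx]
  group

end Freeness

end DefiniteUnitary
end

noncomputable section

namespace DefiniteUnitary

/-! ### Compact adic rings -/

section AdicRing

open Topology Filter

variable {O : Type*} [CommRing O] [TopologicalSpace O] [IsTopologicalRing O] {I : Ideal O}

lemma continuous_iff_isLocallyConstant_mk (hI : IsAdic I) {X : Type*} [TopologicalSpace X]
    {h : X → O} :
    Continuous h ↔ ∀ s : ℕ, IsLocallyConstant fun x => Ideal.Quotient.mk (I ^ s) (h x) := by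
  obtain ⟨h1, h2⟩ := isAdic_iff.1 hI
  simp only [IsLocallyConstant.iff_eventually_eq, Ideal.Quotient.eq, continuous_iff_continuousAt]
  constructor
  · intro hc s x
    have : Tendsto (fun y => h y - h x) (𝓝 x) (𝓝 0) := by
      have := (hc x).tendsto.sub_const (h x)
      rwa [sub_self] at this
    exact this.eventually ((h1 s).mem_nhds (zero_mem _))
  · intro hc x
    have : Tendsto (fun y => h y - h x) (𝓝 x) (𝓝 0) := by
      intro V hV
      obtain ⟨s, hs⟩ := h2 V hV
      exact mem_of_superset (hc s x) fun y hy => hs hy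
    have h3 := this.add_const (h x)
    simp only [sub_add_cancel, zero_add] at h3
    exact h3

lemma eq_of_forall_mk_eq [T2Space O] (hI : IsAdic I) {x y : O}
    (h : ∀ s, Ideal.Quotient.mk (I ^ s) x = Ideal.Quotient.mk (I ^ s) y) : x = y := by
  rw [← sub_eq_zero]
  by_contra hne
  obtain ⟨s, hs⟩ := (isAdic_iff.1 hI).2 {x - y}ᶜ
    (isOpen_compl_singleton.mem_nhds (by simpa using Ne.symm hne))
  exact hs (Ideal.Quotient.eq.1 (h s)) rfl

/-- The residue classes are nested nonempty closed sets in a compact space, so they have a common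
point. -/
lemma exists_forall_mk_eq [CompactSpace O] (hI : IsAdic I) (a : ∀ s : ℕ, O ⧸ I ^ s)
    (ha : ∀ s t (h : s ≤ t), Ideal.Quotient.factorPow I h (a t) = a s) :
    ∃ x, ∀ s, Ideal.Quotient.mk (I ^ s) x = a s := by
  have hcl : ∀ s, IsClosed {x | Ideal.Quotient.mk (I ^ s) x = a s} := by
    intro s
    have hlc := (continuous_iff_isLocallyConstant_mk hI).1 (continuous_id (X := O)) s
    exact hlc.isClosed_fiber (a s)
  have := IsCompact.nonempty_iInter_of_sequence_nonempty_isCompact_isClosed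
    (fun s => {x | Ideal.Quotient.mk (I ^ s) x = a s}) (fun s x hx => by
      change Ideal.Quotient.mk _ x = _
      rw [← ha s (s + 1) s.le_succ, ← show Ideal.Quotient.mk (I ^ (s + 1)) x = a (s + 1) from hx]
      rfl) (fun s => Ideal.Quotient.mk_surjective (a s)) (hcl 0).isCompact hcl
  obtain ⟨x, hx⟩ := this
  exact ⟨x, fun s => Set.mem_iInter.1 hx s⟩

lemma finite_quotient_pow [CompactSpace O] (hI : IsAdic I) (s : ℕ) : Finite (O ⧸ I ^ s) :=
  AddSubgroup.quotient_finite_of_isOpen (I ^ s).toAddSubgroup ((isAdic_iff.1 hI).1 s)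

end AdicRing

/-! ### The topology of the ring of integers of `L` -/

section IntegerRing

open Topology Filter

variable (p : ℕ) [Fact p.Prime] (L : Type*)
    [NontriviallyNormedField L] [NormedAlgebra ℚ_[p] L] [FiniteDimensional ℚ_[p] L]
    [Algebra ℤ_[p] L] [IsScalarTower ℤ_[p] ℚ_[p] L]

instance : Module.Finite ℤ_[p] (Int𝒪 p L) := IsIntegralClosure.finite ℤ_[p] ℚ_[p] L _

lemma continuous_algebraMap_int : Continuous (algebraMap ℤ_[p] (Int𝒪 p L)) := by
  refine continuous_induced_rng.2 ?_
  have : (Subtype.val ∘ algebraMap ℤ_[p] (Int𝒪 p L)) =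
      fun x : ℤ_[p] => algebraMap ℚ_[p] L (algebraMap ℤ_[p] ℚ_[p] x) :=
    funext fun x => IsScalarTower.algebraMap_apply ℤ_[p] ℚ_[p] L x
  rw [this]
  exact (continuous_algebraMap ℚ_[p] L).comp continuous_subtype_val

/-- By compactness of `ℤ_p^n` this surjection presents `𝒪` as a topological quotient; it transfers
compactness and openness from `ℤ_p`. -/
lemma exists_continuous_surjective : ∃ (n : ℕ) (f : (Fin n → ℤ_[p]) →ₗ[ℤ_[p]] Int𝒪 p L),
    Function.Surjective f ∧ Continuous f := by
  obtain ⟨n, f, hf⟩ := Module.Finite.exists_fin' ℤ_[p] (Int𝒪 p L)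
  refine ⟨n, f, hf, ?_⟩
  have : (f : (Fin n → ℤ_[p]) → Int𝒪 p L) = fun x =>
      ∑ i, algebraMap ℤ_[p] (Int𝒪 p L) (x i) * f (fun j => if i = j then 1 else 0) := by
    funext x
    simp only [← Algebra.smul_def]
    exact LinearMap.pi_apply_eq_sum_univ f x
  rw [this]
  exact continuous_finsetSum _ fun i _ =>
    ((continuous_algebraMap_int p L).comp (continuous_apply i)).mul continuous_const

instance : CompactSpace (Int𝒪 p L) := by
  obtain ⟨n, f, hf, hc⟩ := exists_continuous_surjective p L
  exact hf.compactSpace hc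

variable {p L} {ϖ : Int𝒪 p L}

/-- The powers of the ideal are open because each contracts to a nonzero ideal of `ℤ_p`. They shrink
to `0` because they are compact and decreasing, with zero intersection by Krull's theorem. -/
lemma isAdic_span (hϖ : Irreducible ϖ) : IsAdic (Ideal.span {ϖ}) := by
  set I := Ideal.span {ϖ} with hIdef
  have hopen : ∀ s, IsOpen ((I ^ s : Ideal (Int𝒪 p L)) : Set (Int𝒪 p L)) := by
    intro s
    obtain ⟨n, f, hf, hc⟩ := exists_continuous_surjective p L
    have hq : IsQuotientMap f := hc.isClosedMap.isQuotientMap hc hf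
    have hmem : ϖ ^ s ∈ I ^ s := Ideal.pow_mem_pow (Ideal.mem_span_singleton_self ϖ) s
    -- `ϖ ^ s` is a nonzero integral element, so its ideal meets `ℤ_p` nontrivially.
    have hne : (I ^ s).comap (algebraMap ℤ_[p] (Int𝒪 p L)) ≠ ⊥ :=
      Ideal.comap_ne_bot_of_integral_mem (pow_ne_zero s hϖ.ne_zero) hmem
        (Algebra.IsIntegral.isIntegral _)
    obtain ⟨a, ha, ha0⟩ := Submodule.exists_mem_ne_zero_of_ne_bot hne
    have hball : ((I ^ s).comap (algebraMap ℤ_[p] (Int𝒪 p L)) : Set ℤ_[p]) ∈ 𝓝 0 := by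
      have hsub : Ideal.span {(p : ℤ_[p]) ^ a.valuation} ≤
          (I ^ s).comap (algebraMap ℤ_[p] (Int𝒪 p L)) := by
        rw [Ideal.span_singleton_le_iff_mem]
        rw [PadicInt.unitCoeff_spec ha0] at ha
        exact (Ideal.unit_mul_mem_iff_mem _ (PadicInt.unitCoeff ha0).isUnit).1 ha
      refine mem_of_superset (Metric.closedBall_mem_nhds (0 : ℤ_[p])
        (ε := (p : ℝ) ^ (-(a.valuation : ℤ))) (by
          have := (Fact.out : p.Prime).pos
          positivity)) fun x hx => hsub ?_
      rw [← PadicInt.norm_le_pow_iff_mem_span_pow]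
      simpa using hx
    rw [← hq.isOpen_preimage]
    refine AddSubgroup.isOpen_of_mem_nhds
      ((I ^ s).toAddSubgroup.comap f.toAddMonoidHom) (g := 0) ?_
    refine mem_of_superset (set_pi_mem_nhds Set.finite_univ fun i _ => hball) fun x hx => ?_
    have hx' : f x ∈ I ^ s := by
      rw [LinearMap.pi_apply_eq_sum_univ f x]
      refine sum_mem fun i _ => ?_
      rw [Algebra.smul_def]
      exact Ideal.mul_mem_right _ _ (hx i (Set.mem_univ i))
    exact hx'
  refine isAdic_iff.2 ⟨hopen, fun V hV => ?_⟩
  have : IsNoetherianRing (Int𝒪 p L) := isNoetherian_of_tower ℤ_[p] inferInstance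
  refine exists_subset_nhds_of_isCompact
    (V := fun s : ℕ => ((I ^ s : Ideal (Int𝒪 p L)) : Set (Int𝒪 p L))) ?_
    (fun s => IsClosed.isCompact
      (AddSubgroup.isClosed_of_isOpen (I ^ s).toAddSubgroup (hopen s) :)) ?_
  · refine directed_of_isDirected_le ?_
    intro s t hst
    exact Ideal.pow_le_pow_right hst
  · intro x hx
    have hne : I ≠ ⊤ := by
      rw [hIdef, Ne, Ideal.span_singleton_eq_top]
      exact hϖ.not_isUnit
    have h0 := Ideal.iInf_pow_eq_bot_of_isDomain I hne
    have : x ∈ ⨅ s, I ^ s := (Submodule.mem_iInf _).2 fun s => Set.mem_iInter.1 hx s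
    rw [h0] at this
    rw [(Submodule.mem_bot _).1 this]
    exact hV

lemma exists_pow_mem_span (hϖ : Irreducible ϖ) (s : ℕ) :
    ∃ n : ℕ, (p : Int𝒪 p L) ^ n ∈ Ideal.span {ϖ} ^ s := by
  have h1 : Tendsto (fun n : ℕ => (p : ℤ_[p]) ^ n) atTop (𝓝 0) :=
    tendsto_pow_atTop_nhds_zero_of_norm_lt_one (by
      rw [PadicInt.norm_p]
      exact inv_lt_one_of_one_lt₀ (by exact_mod_cast (Fact.out : p.Prime).one_lt))
  have h2 := ((continuous_algebraMap_int p L).tendsto 0).comp h1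
  rw [map_zero] at h2
  obtain ⟨n, hn⟩ := (h2.eventually
    (((isAdic_iff.1 (isAdic_span hϖ)).1 s).mem_nhds (zero_mem _))).exists
  refine ⟨n, ?_⟩
  have h3 : algebraMap ℤ_[p] (Int𝒪 p L) ((p : ℤ_[p]) ^ n) = (p : Int𝒪 p L) ^ n := by
    rw [map_pow, map_natCast]
  rw [← h3]
  exact hn

end IntegerRing

end DefiniteUnitary
end

noncomputable section

namespace DefiniteUnitary

/-! ### Completed cohomology as continuous functions on `K_p` -/

section Values

open Topology Filter

variable {F K D : Type*} [Field F] [NumberField F] [Field K] [Algebra F K]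
  [Ring D] [Algebra F D] [Algebra K D] [FiniteDimensional F D] {c : K ≃ₐ[F] K}
  {σ : AntiInvolution D c} {p : ℕ} {Kt : TameLevel σ p} {O : Type*} [CommRing O] {I : Ideal O}

/-- The projection to `H⁰(K^p, 𝒪/I^s)`. -/
def CompletedH0.reduce (s : ℕ) : CompletedH0 Kt O I →ₗ[O] H0 Kt O (O ⧸ I ^ s) :=
  (LinearMap.proj s).comp (compatibleForms Kt O I).subtype

lemma CompletedH0.factorPow_reduce (f : CompletedH0 Kt O I) {s t : ℕ} (h : s ≤ t) (x : GAf σ) :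
    Ideal.Quotient.factorPow I h (H0.fn (reduce t f) x) = H0.fn (reduce s f) x := f.2 s t h x

lemma CompletedH0.ext_reduce {f g : CompletedH0 Kt O I} (h : ∀ s, reduce s f = reduce s g) :
    f = g := Subtype.ext (funext h)

lemma CompletedH0.reduce_translation (s : ℕ) (k : GQp σ p) (f : CompletedH0 Kt O I) :
    reduce s (translation Kt O I k f) = H0.translate Kt O (O ⧸ I ^ s) k (reduce s f) := rfl

lemma CompletedH0.continuous_iff {X : Type*} [TopologicalSpace X] {h : X → CompletedH0 Kt O I} :
    Continuous h ↔ ∀ s, IsLocallyConstant fun x => reduce s (h x) := by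
  simp only [IsLocallyConstant.iff_continuous]
  exact continuous_induced_rng.trans continuous_pi_iff

lemma CompletedH0.isLocallyConstant_reduce (s : ℕ) :
    IsLocallyConstant (reduce s : CompletedH0 Kt O I → H0 Kt O (O ⧸ I ^ s)) :=
  CompletedH0.continuous_iff.1 continuous_id s

instance : IsTopologicalAddGroup (CompletedH0 Kt O I) where
  continuous_add := CompletedH0.continuous_iff.2 fun s => by
    simp only [map_add]
    exact ((CompletedH0.isLocallyConstant_reduce s).comp_continuous continuous_fst).add
      ((CompletedH0.isLocallyConstant_reduce s).comp_continuous continuous_snd)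
  continuous_neg := CompletedH0.continuous_iff.2 fun s => by
    simp only [map_neg]
    exact (CompletedH0.isLocallyConstant_reduce s).neg

variable [TopologicalSpace O] [IsTopologicalRing O] [CompactSpace O]

/-- The value at `x` of a compatible family of forms. -/
def CompletedH0.value (hI : IsAdic I) (f : CompletedH0 Kt O I) (x : GAf σ) : O :=
  (exists_forall_mk_eq hI (fun s => H0.fn (reduce s f) x)
    fun _ _ h => factorPow_reduce f h x).choose

lemma CompletedH0.mk_value (hI : IsAdic I) (f : CompletedH0 Kt O I) (x : GAf σ) (s : ℕ) :
    Ideal.Quotient.mk (I ^ s) (value hI f x) = H0.fn (reduce s f) x :=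
  (exists_forall_mk_eq hI (fun s => H0.fn (reduce s f) x)
    fun _ _ h => factorPow_reduce f h x).choose_spec s

/-- The stabilizer of `φ` is open: by the tube lemma, `φ (k h) = φ k` holds for all `k` at once when
`h` is near `1`. -/
lemma exists_isOpen_subgroup_invariant {G A : Type*} [Group G] [TopologicalSpace G]
    [IsTopologicalGroup G] [CompactSpace G] {φ : G → A} (hφ : IsLocallyConstant φ) :
    ∃ H : Subgroup G, IsOpen (H : Set G) ∧ ∀ h ∈ H, ∀ k, φ (k * h) = φ k := by
  let H : Subgroup G :=
    { carrier := {h | ∀ k, φ (k * h) = φ k}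
      one_mem' := by simp
      mul_mem' := by
        intro a b ha hb k
        rw [← mul_assoc, hb, ha]
      inv_mem' := by
        intro a ha k
        rw [← ha (k * a⁻¹), inv_mul_cancel_right] }
  refine ⟨H, Subgroup.isOpen_of_mem_nhds H (g := 1) ?_, fun h hh => hh⟩
  have hopen : IsOpen {q : G × G | φ (q.1 * q.2) = φ q.1} := by
    have h1 : IsLocallyConstant fun q : G × G => (φ (q.1 * q.2), φ q.1) :=
      (hφ.comp_continuous (continuous_fst.mul continuous_snd)).prodMk
        (hφ.comp_continuous continuous_fst)
    exact h1 {a | a.1 = a.2}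
  obtain ⟨u, v, -, hv, hu1, hv1, huv⟩ := generalized_tube_lemma (isCompact_univ (X := G))
    (isCompact_singleton (x := (1 : G))) hopen (by
      rintro ⟨a, b⟩ ⟨-, hb⟩
      replace hb : b = 1 := hb
      change φ (a * b) = φ a
      rw [hb, mul_one])
  refine mem_of_superset (hv.mem_nhds (hv1 rfl)) fun h hh k => ?_
  exact huv (Set.mk_mem_prod (hu1 (Set.mem_univ k)) hh)

variable {Kp : Subgroup (GQp σ p)}

lemma H0.isLocallyConstant_restrict {A : Type*} [AddCommGroup A] [Module O A] (f : H0 Kt O A)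
    (g : GAf σ) : IsLocallyConstant fun k : Kp => H0.fn f (g * k) := by
  rw [IsLocallyConstant.iff_eventually_eq]
  obtain ⟨-, -, H, hH, h⟩ := f.2
  intro k
  have hopen : IsOpen {k' : Kp | (k : GQp σ p)⁻¹ * k' ∈ H} := hH.preimage (by fun_prop)
  filter_upwards [hopen.mem_nhds (by simp [H.one_mem])] with k' hk'
  have := h _ hk' (g * k)
  change H0.fn f _ = H0.fn f _ at this
  rw [← this]
  simp [mul_assoc]

variable [T2Space O]

/-- A form is determined by its restrictions to the `g i K_p`, which are arbitrary. -/
lemma exists_continuousLinearEquiv (hI : IsAdic I) (hKp_open : IsOpen (Kp : Set (GQp σ p)))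
    (hKp_compact : IsCompact (Kp : Set (GQp σ p))) {r : ℕ} {g : Fin r → GAf σ}
    {idx : GAf σ → Fin r} {kp : GAf σ → Kp}
    (hrep : ∀ x, ∃ γ ∈ rationalPoints σ, ∃ κ ∈ Kt.toSubgroup, x = γ * g (idx x) * kp x * κ)
    (huniq : ∀ i (k : Kp), ∀ γ ∈ rationalPoints σ, ∀ κ ∈ Kt.toSubgroup,
      idx (γ * g i * k * κ) = i ∧ kp (γ * g i * k * κ) = k) :
    ∃ e : CompletedH0 Kt O I ≃L[O] (Fin r → C(Kp, O)),
      ∀ f i k, e f i k = CompletedH0.value hI f (g i * k) := by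
  have : CompactSpace Kp := isCompact_iff_compactSpace.1 hKp_compact
  let E : CompletedH0 Kt O I →ₗ[O] (Fin r → C(Kp, O)) :=
    { toFun := fun f i => ⟨fun k => CompletedH0.value hI f (g i * k), by
        rw [continuous_iff_isLocallyConstant_mk hI]
        intro s
        simp only [CompletedH0.mk_value]
        exact H0.isLocallyConstant_restrict _ _⟩
      map_add' := fun f f' => by
        ext i k
        refine eq_of_forall_mk_eq hI fun s => ?_
        simp [CompletedH0.mk_value]
      map_smul' := fun a f => by
        ext i k
        refine eq_of_forall_mk_eq hI fun s => ?_
        simp [CompletedH0.mk_value, Algebra.smul_def] }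
  have hE : ∀ f i k, E f i k = CompletedH0.value hI f (g i * k) := fun _ _ _ => rfl
  have hval : ∀ (f : CompletedH0 Kt O I) s x,
      H0.fn (CompletedH0.reduce s f) x = H0.fn (CompletedH0.reduce s f) (g (idx x) * kp x) := by
    intro f s x
    obtain ⟨γ, hγ, κ, hκ, hx⟩ := hrep x
    have h1 := (CompletedH0.reduce s f).2.1 γ hγ (g (idx x) * kp x)
    have h2 := (CompletedH0.reduce s f).2.2.1 κ hκ (γ * (g (idx x) * kp x))
    rw [← mul_assoc γ, ← hx] at h2
    exact h2.trans (by rw [mul_assoc]; exact h1)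
  -- A function on the `r` copies of `K_p` is extended to `G(𝔸_f)` through the coordinates `idx` and
  -- `kp`. Left and right invariance follow from their uniqueness.
  have hlift : ∀ φ : Fin r → C(Kp, O), ∃ f : CompletedH0 Kt O I, ∀ s x,
      H0.fn (CompletedH0.reduce s f) x = Ideal.Quotient.mk (I ^ s) (φ (idx x) (kp x)) := by
    intro φ
    have hsm : ∀ s, (fun x => Ideal.Quotient.mk (I ^ s) (φ (idx x) (kp x))) ∈
        smoothForms Kt O (O ⧸ I ^ s) := by
      intro s
      refine ⟨fun γ hγ x => ?_, fun κ hκ x => ?_, ?_⟩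
      · obtain ⟨γ', hγ', κ', hκ', hx⟩ := hrep x
        have h1 := huniq (idx x) (kp x) (γ * γ') (mul_mem hγ hγ') κ' hκ'
        rw [show γ * γ' * g (idx x) * kp x * κ' = γ * (γ' * g (idx x) * kp x * κ') by group,
          ← hx] at h1
        beta_reduce
        rw [h1.1, h1.2]
      · obtain ⟨γ', hγ', κ', hκ', hx⟩ := hrep x
        have h1 := huniq (idx x) (kp x) γ' hγ' (κ' * κ) (mul_mem hκ' hκ)
        rw [← mul_assoc, ← hx] at h1
        beta_reduce
        rw [h1.1, h1.2]
      -- The `r` functions are bundled so that a single open subgroup of `K_p` stabilizes all of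
      -- them modulo `I ^ s`.
      · have hlc : IsLocallyConstant fun k : Kp => fun i =>
            Ideal.Quotient.mk (I ^ s) (φ i k) := by
          rw [IsLocallyConstant.iff_eventually_eq]
          intro k
          have : ∀ i, ∀ᶠ k' in 𝓝 k, Ideal.Quotient.mk (I ^ s) (φ i k') =
              Ideal.Quotient.mk (I ^ s) (φ i k) := fun i =>
            ((continuous_iff_isLocallyConstant_mk hI).1 (φ i).continuous s).eventually_eq k
          filter_upwards [eventually_all.2 this] with k' hk'
          exact funext hk'
        obtain ⟨H, hH, hinv⟩ := exists_isOpen_subgroup_invariant hlc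
        refine ⟨H.map Kp.subtype, ?_, ?_⟩
        · exact hKp_open.isOpenMap_subtype_val _ hH
        · rintro _ ⟨k, hk, rfl⟩ x
          obtain ⟨γ', hγ', κ', hκ', hx⟩ := hrep x
          have h1 := huniq (idx x) (kp x * k) γ' hγ' κ' hκ'
          have h2 : γ' * g (idx x) * ((kp x * k : Kp) : GQp σ p) * κ' =
              x * ((Kp.subtype k : GQp σ p) : GAf σ) := by
            conv_rhs => rw [hx]
            have h3 := GQp_commute σ p (k : GQp σ p).2 (Kt.le hκ')
            change γ' * g (idx x) * (kp x * k) * κ' = γ' * g (idx x) * kp x * κ' * k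
            rw [mul_assoc _ κ', ← h3]
            simp only [mul_assoc]
          rw [h2] at h1
          beta_reduce
          rw [h1.1, h1.2]
          exact congrFun (hinv k hk (kp x)) (idx x)
    exact ⟨⟨fun s => ⟨_, hsm s⟩, fun s t h x => rfl⟩, fun s x => rfl⟩
  have hinj : Function.Injective E := by
    intro f f' h
    refine CompletedH0.ext_reduce fun s => H0.ext fun x => ?_
    rw [hval, hval f', ← CompletedH0.mk_value hI, ← CompletedH0.mk_value hI, ← hE, ← hE, h]
  have hsurj : Function.Surjective E := by
    intro φ
    obtain ⟨f, hf⟩ := hlift φ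
    refine ⟨f, ?_⟩
    ext i k
    refine eq_of_forall_mk_eq hI fun s => ?_
    have h1 := huniq i k 1 (one_mem _) 1 (one_mem _)
    rw [one_mul, mul_one] at h1
    rw [hE, CompletedH0.mk_value, hf, h1.1, h1.2]
  let e := LinearEquiv.ofBijective E ⟨hinj, hsurj⟩
  have he : ∀ f, e f = E f := fun _ => rfl
  refine ⟨⟨e, ?_, ?_⟩, fun f i k => rfl⟩
  -- Continuity for uniform convergence follows from joint continuity in the form and the point.
  · refine continuous_pi fun i => ContinuousMap.continuous_of_continuous_uncurry _ ?_
    rw [continuous_iff_isLocallyConstant_mk hI]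
    intro s
    have h1 : (fun q : CompletedH0 Kt O I × Kp => Ideal.Quotient.mk (I ^ s)
        (Function.uncurry (fun f k => E f i k) q)) =
        fun q => H0.fn (CompletedH0.reduce s q.1) (g i * ((q.2 : GQp σ p) : GAf σ)) := by
      funext q
      exact CompletedH0.mk_value hI q.1 (g i * q.2) s
    refine (congrArg IsLocallyConstant h1).mpr ?_
    rw [ IsLocallyConstant.iff_eventually_eq]
    rintro ⟨f, k⟩
    rw [nhds_prod_eq]
    filter_upwards [((CompletedH0.isLocallyConstant_reduce s).eventually_eq f).prod_mk
      ((H0.isLocallyConstant_restrict (CompletedH0.reduce s f) (g i)).eventually_eq k)]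
      with q hq
    rw [hq.1]
    exact hq.2
  · change Continuous e.symm
    -- Functions with all values in `I ^ s` form a neighbourhood of `0`, and they come from families
    -- whose reduction at `s` vanishes.
    have hcont : ∀ s, ∀ᶠ φ in 𝓝 (0 : Fin r → C(Kp, O)), CompletedH0.reduce s (e.symm φ) = 0 := by
      intro s
      have hopen : ∀ i, IsOpen {φ : Fin r → C(Kp, O) |
          Set.MapsTo (φ i) Set.univ ((I ^ s : Ideal O) : Set O)} := fun i =>
        IsOpen.preimage (continuous_apply (A := fun _ : Fin r => C(Kp, O)) i)
          (ContinuousMap.isOpen_setOfPred_mapsTo isCompact_univ ((isAdic_iff.1 hI).1 s))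
      filter_upwards [eventually_all.2 fun i => (hopen i).mem_nhds
        (show (0 : Fin r → C(Kp, O)) ∈ _ from fun _ _ => zero_mem _)] with φ hφ
      refine H0.ext fun x => ?_
      rw [hval, ← CompletedH0.mk_value hI, ← hE, ← he, e.apply_symm_apply, map_zero,
        Ideal.Quotient.eq_zero_iff_mem.2 (hφ (idx x) (Set.mem_univ (kp x)))]
      rfl
    refine CompletedH0.continuous_iff.2 fun s => ?_
    rw [IsLocallyConstant.iff_eventually_eq]
    intro φ
    have h1 : Tendsto (fun ψ => ψ - φ) (𝓝 φ) (𝓝 0) := by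
      have := (show Continuous fun ψ : Fin r → C(Kp, O) => ψ - φ from
        continuous_id.sub continuous_const).tendsto φ
      rwa [sub_self] at this
    filter_upwards [h1.eventually (hcont s)] with ψ hψ
    rwa [map_sub, map_sub, sub_eq_zero] at hψ

end Values

end DefiniteUnitary
end

noncomputable section

namespace DefiniteUnitary

/-! ### The Hecke algebra acting on completed cohomology -/

section HeckeAction

open Topology Filter

variable {F K D : Type*} [Field F] [NumberField F] [Field K] [Algebra F K]
  [Ring D] [Algebra F D] [Algebra K D] [FiniteDimensional F D] {c : K ≃ₐ[F] K}
  {σ : AntiInvolution D c} {p : ℕ} {Kt : TameLevel σ p} {O : Type*} [CommRing O] {I : Ideal O}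
  {S : Finset (HeightOneSpectrum (𝓞 F))}

instance : T2Space (CompletedH0 Kt O I) :=
  inferInstanceAs (T2Space (compatibleForms Kt O I))

lemma isClosedEmbedding_reduce : IsClosedEmbedding
    (fun (f : CompletedH0 Kt O I) s => CompletedH0.reduce s f) := by
  refine ⟨⟨⟨rfl⟩, fun f g h => CompletedH0.ext_reduce (congrFun h)⟩, ?_⟩
  have : Set.range (fun (f : CompletedH0 Kt O I) s => CompletedH0.reduce s f) =
      ⋂ (s : ℕ) (t : ℕ) (h : s ≤ t), {f : ∀ s : ℕ, H0 Kt O (O ⧸ I ^ s) | ∀ x,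
        Ideal.Quotient.factorPow I h (H0.fn (f t) x) = H0.fn (f s) x} := by
    ext f
    simp only [Set.mem_iInter]
    constructor
    · rintro ⟨f, rfl⟩ s t h x
      exact CompletedH0.factorPow_reduce f h x
    · intro h
      exact ⟨⟨f, h⟩, rfl⟩
  rw [this]
  refine isClosed_iInter fun s => isClosed_iInter fun t => isClosed_iInter fun h => ?_
  have hcont : Continuous fun f : ∀ s : ℕ, H0 Kt O (O ⧸ I ^ s) => (f t, f s) :=
    (continuous_apply t).prodMk (continuous_apply s)
  exact (isClosed_discrete {q : H0 Kt O (O ⧸ I ^ t) × H0 Kt O (O ⧸ I ^ s) |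
    ∀ x, Ideal.Quotient.factorPow I h (H0.fn q.1 x) = H0.fn q.2 x}).preimage hcont

lemma mem_GAfp_of_mem_heckeCosets {g : GAf σ} (hg : g ∈ GAfp σ p)
    {q : GAf σ ⧸ Kt.toSubgroup} (hq : q ∈ heckeCosets Kt g) : q.out ∈ GAfp σ p := by
  obtain ⟨k, rfl⟩ := hq
  have h1 : ((k * g : GAf σ) : GAf σ ⧸ Kt.toSubgroup) =
      ((k • (g : GAf σ ⧸ Kt.toSubgroup)).out : GAf σ) := (Quotient.out_eq' _).symm
  have h2 := Kt.le (QuotientGroup.eq.1 h1)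
  have h3 := mul_mem (mul_mem (Kt.le k.2) hg) h2
  rwa [mul_inv_cancel_left] at h3

lemma heckeOperator_translation (g : GAfp σ p) (k : GQp σ p) (f : CompletedH0 Kt O I) :
    heckeOperator Kt O I g (translation Kt O I k f) =
      translation Kt O I k (heckeOperator Kt O I g f) := by
  refine CompletedH0.ext_reduce fun s => H0.ext fun x => ?_
  change H0.fn (H0.hecke Kt O _ g (H0.translate Kt O _ k (CompletedH0.reduce s f))) x =
    H0.fn (H0.translate Kt O _ k (H0.hecke Kt O _ g (CompletedH0.reduce s f))) x
  rw [H0.hecke_fn, H0.translate_fn, H0.hecke_fn]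
  refine Finset.sum_congr rfl fun q hq => ?_
  rw [H0.translate_fn, mul_assoc, mul_assoc, GQp_commute σ p k.2
    (mem_GAfp_of_mem_heckeCosets g.2 ((Set.Finite.mem_toFinset _).1 hq))]

lemma sphericalImage_translation {t : Module.End O (CompletedH0 Kt O I)}
    (ht : t ∈ sphericalImage Kt O I S) (k : GQp σ p) (f : CompletedH0 Kt O I) :
    t (translation Kt O I k f) = translation Kt O I k (t f) := by
  induction ht using Algebra.adjoin_induction generalizing f with
  | mem t h =>
    obtain ⟨g, -, rfl⟩ := h
    exact heckeOperator_translation g k f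
  | algebraMap a =>
    rw [Module.algebraMap_end_apply, Module.algebraMap_end_apply, map_smul]
  | add t t' _ _ h h' => rw [LinearMap.add_apply, h, h', LinearMap.add_apply, map_add]
  | mul t t' _ _ h h' => rw [Module.End.mul_apply, h', h, Module.End.mul_apply]

lemma sphericalImage_reduce {t : Module.End O (CompletedH0 Kt O I)}
    (ht : t ∈ sphericalImage Kt O I S) {s : ℕ} {f : CompletedH0 Kt O I}
    (hf : CompletedH0.reduce s f = 0) : CompletedH0.reduce s (t f) = 0 := by
  induction ht using Algebra.adjoin_induction generalizing f with
  | mem t h =>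
    obtain ⟨g, -, rfl⟩ := h
    change H0.hecke Kt O _ g (CompletedH0.reduce s f) = 0
    rw [hf, map_zero]
  | algebraMap a => rw [Module.algebraMap_end_apply, map_smul, hf, smul_zero]
  | add t t' _ _ h h' => rw [LinearMap.add_apply, map_add, h hf, h' hf, add_zero]
  | mul t t' _ _ h h' => rw [Module.End.mul_apply, h (h' hf)]

/-- Pointwise closure means agreement modulo `I ^ s` on finitely many forms. Statements testable on
such data therefore pass from the spherical image to the whole Hecke algebra. -/
lemma exists_sphericalImage_eq (T : bigHecke Kt O I S) (s : ℕ) (X : Finset (CompletedH0 Kt O I)) :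
    ∃ t ∈ sphericalImage Kt O I S, ∀ f ∈ X,
      CompletedH0.reduce s (t f) = CompletedH0.reduce s (T.1 f) := by
  have hopen : IsOpen {a : CompletedH0 Kt O I → CompletedH0 Kt O I | ∀ f ∈ X,
      CompletedH0.reduce s (a f) = CompletedH0.reduce s (T.1 f)} := by
    simp only [Set.ofPred_forall]
    refine isOpen_biInter_finset fun f _ => ?_
    exact (CompletedH0.isLocallyConstant_reduce s {y | y = CompletedH0.reduce s (T.1 f)}).preimage
      (continuous_apply (A := fun _ : CompletedH0 Kt O I => CompletedH0 Kt O I) f)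
  obtain ⟨_, ha, t, ht, rfl⟩ := mem_closure_iff.1 T.2 _ hopen fun f _ => rfl
  exact ⟨t, ht, ha⟩

lemma bigHecke_translation (T : bigHecke Kt O I S) (k : GQp σ p) (f : CompletedH0 Kt O I) :
    T.1 (translation Kt O I k f) = translation Kt O I k (T.1 f) := by
  classical
  refine CompletedH0.ext_reduce fun s => ?_
  obtain ⟨t, ht, h⟩ := exists_sphericalImage_eq T s {f, translation Kt O I k f}
  rw [← h _ (by simp), sphericalImage_translation ht, CompletedH0.reduce_translation,
    CompletedH0.reduce_translation, h _ (by simp)]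

lemma bigHecke_reduce_eq_zero (T : bigHecke Kt O I S) {s : ℕ} {f : CompletedH0 Kt O I}
    (hf : CompletedH0.reduce s f = 0) : CompletedH0.reduce s (T.1 f) = 0 := by
  obtain ⟨t, ht, h⟩ := exists_sphericalImage_eq T s {f}
  rw [← h _ (by simp), sphericalImage_reduce ht hf]

lemma bigHecke_reduce_congr (T : bigHecke Kt O I S) {s : ℕ} {f f' : CompletedH0 Kt O I}
    (hf : CompletedH0.reduce s f = CompletedH0.reduce s f') :
    CompletedH0.reduce s (T.1 f) = CompletedH0.reduce s (T.1 f') := by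
  rw [← sub_eq_zero, ← map_sub, ← map_sub]
  exact bigHecke_reduce_eq_zero T (by rw [map_sub, hf, sub_self])

lemma continuous_bigHecke (T : bigHecke Kt O I S) : Continuous T.1 := by
  refine CompletedH0.continuous_iff.2 fun s => ?_
  rw [IsLocallyConstant.iff_eventually_eq]
  intro f
  filter_upwards [(CompletedH0.isLocallyConstant_reduce s).eventually_eq f] with f' hf'
  exact bigHecke_reduce_congr T hf'

/-- Hecke operators preserve the stabilizers of forms modulo `I ^ s`. -/
lemma bigHecke_translate_reduce (T : bigHecke Kt O I S) {s : ℕ} {f : CompletedH0 Kt O I}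
    {k : GQp σ p} (hf : H0.translate Kt O _ k (CompletedH0.reduce s f) = CompletedH0.reduce s f) :
    H0.translate Kt O _ k (CompletedH0.reduce s (T.1 f)) = CompletedH0.reduce s (T.1 f) := by
  rw [← CompletedH0.reduce_translation] at hf ⊢
  rw [← bigHecke_translation]
  exact bigHecke_reduce_congr T hf

/-- One factor is approximated at a time: first spherical operators commute with the closure, then
the closure with itself. -/
lemma mul_comm_of_sphericalImage (h : ∀ a ∈ sphericalImage Kt O I S, ∀ b ∈ sphericalImage Kt O I S,
    a * b = b * a) (a b : bigHecke Kt O I S) : a * b = b * a := by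
  classical
  have key : ∀ a ∈ sphericalImage Kt O I S, ∀ (b : bigHecke Kt O I S) f,
      a (b.1 f) = b.1 (a f) := by
    intro a ha b f
    refine CompletedH0.ext_reduce fun s => ?_
    obtain ⟨t, ht, hb⟩ := exists_sphericalImage_eq b s {f, a f}
    rw [← hb (a f) (by simp), show t (a f) = a (t f) from
      LinearMap.congr_fun (h a ha t ht).symm f, ← sub_eq_zero, ← map_sub, ← map_sub]
    refine sphericalImage_reduce ha ?_
    rw [map_sub, hb f (by simp), sub_self]
  refine Subtype.ext (LinearMap.ext fun f => CompletedH0.ext_reduce fun s => ?_)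
  obtain ⟨t, ht, ha⟩ := exists_sphericalImage_eq a s {f, b.1 f}
  change CompletedH0.reduce s (a.1 (b.1 f)) = CompletedH0.reduce s (b.1 (a.1 f))
  rw [← ha _ (by simp), key t ht b f]
  exact bigHecke_reduce_congr b (ha f (by simp))

end HeckeAction

/-! ### Compactness of the Hecke algebra and its idempotents -/

section Compactness

open Topology Filter

variable {F K D : Type*} [Field F] [NumberField F] [Field K] [Algebra F K]
  [Ring D] [Algebra K D] [Algebra F D] [IsScalarTower F K D] [FiniteDimensional F D]
  {c : K ≃ₐ[F] K} {σ : AntiInvolution D c} {p : ℕ} {Kt : TameLevel σ p}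
  {O : Type*} [CommRing O] {I : Ideal O} {S : Finset (HeightOneSpectrum (𝓞 F))}

/-- Finiteness of the spaces of forms of a given level with finite coefficients. -/
lemma finite_invariants [IsSimpleRing D] (hc : c ≠ 1)
    (hdef : CompactSpace (U σ (NumberField.InfiniteAdeleRing F)))
    {A : Type*} [AddCommGroup A] [Module O A] [Finite A] {H : Subgroup (GQp σ p)}
    (hH : IsOpen (H : Set (GQp σ p))) :
    {f : H0 Kt O A | ∀ k ∈ H, H0.translate Kt O A k f = f}.Finite := by
  obtain ⟨T, hT⟩ := exists_finset_doubleCoset σ hc hdef (level Kt H) (isOpen_level Kt hH)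
  have : Finite (T → A) := inferInstance
  refine Set.Finite.of_finite_image (f := fun f (t : T) => H0.fn f t) (Set.toFinite _) ?_
  intro f hf f' hf' h
  refine H0.ext fun x => ?_
  obtain ⟨γ, hγ, t, ht, k, hk, rfl⟩ := hT x
  have key : ∀ f : H0 Kt O A, (∀ k ∈ H, H0.translate Kt O A k f = f) →
      H0.fn f (γ * t * k) = H0.fn f t := by
    intro f hf
    rw [← projQp_mul_projAfp σ p k, ← mul_assoc]
    refine (f.2.2.1 _ hk.2 _).trans ?_
    have h1 := congrArg (fun f => H0.fn f (γ * t)) (hf _ hk.1)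
    exact h1.trans (f.2.1 γ hγ t)
  rw [key f hf, key f' hf']
  exact congrFun h ⟨t, ht⟩

/-- The topology of pointwise convergence. -/
abbrev pointwiseTopology : TopologicalSpace (bigHecke Kt O I S) :=
  TopologicalSpace.induced (fun t f => t.1 f) inferInstance

attribute [local instance] pointwiseTopology

lemma isEmbedding_bigHecke : IsEmbedding (fun (t : bigHecke Kt O I S) f => t.1 f) :=
  ⟨⟨rfl⟩, fun _ _ h => Subtype.ext (LinearMap.ext (congrFun h))⟩

instance t2Space_bigHecke : T2Space (bigHecke Kt O I S) := isEmbedding_bigHecke.t2Space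

lemma continuous_bigHecke_apply (f : CompletedH0 Kt O I) :
    Continuous fun t : bigHecke Kt O I S => t.1 f :=
  (continuous_apply f).comp isEmbedding_bigHecke.continuous

lemma isLocallyConstant_bigHecke (s : ℕ) (f : CompletedH0 Kt O I) :
    IsLocallyConstant fun t : bigHecke Kt O I S => CompletedH0.reduce s (t.1 f) :=
  CompletedH0.continuous_iff.1 (continuous_bigHecke_apply f) s

lemma continuous_bigHecke_mul_right (r : bigHecke Kt O I S) :
    Continuous fun t : bigHecke Kt O I S => t * r :=
  isEmbedding_bigHecke.continuous_iff.2 (continuous_pi fun f =>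
    continuous_bigHecke_apply (r.1 f))

lemma continuous_bigHecke_mul_left (r : bigHecke Kt O I S) :
    Continuous fun t : bigHecke Kt O I S => r * t :=
  isEmbedding_bigHecke.continuous_iff.2 (continuous_pi fun f =>
    (continuous_bigHecke r).comp (continuous_bigHecke_apply f))

variable [TopologicalSpace O] [IsTopologicalRing O] [CompactSpace O] [T2Space O]

/-- Tychonoff. Modulo `I ^ s`, the image of `f` under any Hecke operator is fixed by the open
stabilizer of `f` modulo `I ^ s`, hence takes finitely many values. -/
lemma compactSpace_bigHecke [IsSimpleRing D] (hc : c ≠ 1)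
    (hdef : CompactSpace (U σ (NumberField.InfiniteAdeleRing F))) (hI : IsAdic I) :
    CompactSpace (bigHecke Kt O I S) := by
  have hfin : ∀ s, Finite (O ⧸ I ^ s) := finite_quotient_pow hI
  rw [← isCompact_univ_iff, isEmbedding_bigHecke.isCompact_iff, Set.image_univ]
  let Y : CompletedH0 Kt O I → ∀ s, Set (H0 Kt O (O ⧸ I ^ s)) := fun f s =>
    {y | ∀ k, H0.translate Kt O _ k (CompletedH0.reduce s f) = CompletedH0.reduce s f →
      H0.translate Kt O _ k y = y}
  have hY : ∀ f s, (Y f s).Finite := by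
    intro f s
    obtain ⟨-, -, H, hH, h⟩ := (CompletedH0.reduce s f).2
    exact (finite_invariants hc hdef hH).subset fun y hy k hk => hy k (H0.ext fun x => h k hk x)
  have hcpt : IsCompact (Set.univ.pi fun f : CompletedH0 Kt O I =>
      (fun (y : CompletedH0 Kt O I) s => CompletedH0.reduce s y) ⁻¹' (Set.univ.pi (Y f))) :=
    isCompact_univ_pi fun f => isClosedEmbedding_reduce.isCompact_preimage
      (isCompact_univ_pi fun s => (hY f s).isCompact)
  refine hcpt.of_isClosed_subset ?_ ?_
  -- Pointwise limits of linear maps are linear, so the Hecke algebra is the whole closure in the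
  -- space of functions.
  · have heq : Set.range (fun (t : bigHecke Kt O I S) f => t.1 f) =
        closure ((fun t : Module.End O (CompletedH0 Kt O I) =>
          (t : CompletedH0 Kt O I → CompletedH0 Kt O I)) '' (sphericalImage Kt O I S)) := by
      refine Set.Subset.antisymm ?_ ?_
      · rintro _ ⟨t, rfl⟩
        exact t.2
      · intro a ha
        have hadd : a ∈ {a : CompletedH0 Kt O I → CompletedH0 Kt O I |
            ∀ f g, a (f + g) = a f + a g} := by
          refine closure_minimal ?_ ?_ ha
          · rintro _ ⟨t, -, rfl⟩ f g
            exact map_add t f g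
          · simp only [Set.ofPred_forall]
            exact isClosed_iInter fun f => isClosed_iInter fun g =>
              isClosed_eq (continuous_apply _) ((continuous_apply f).add (continuous_apply g))
        have hsmul : a ∈ {a : CompletedH0 Kt O I → CompletedH0 Kt O I |
            ∀ (b : O) f, a (b • f) = b • a f} := by
          refine closure_minimal ?_ ?_ ha
          · rintro _ ⟨t, -, rfl⟩ b f
            exact map_smul t b f
          · simp only [Set.ofPred_forall]
            refine isClosed_iInter fun b => isClosed_iInter fun f =>
              isClosed_eq (continuous_apply _) ?_
            refine CompletedH0.continuous_iff.2 fun s => ?_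
            simp only [map_smul]
            exact ((CompletedH0.isLocallyConstant_reduce s).comp_continuous
              (continuous_apply f)).comp (fun y => b • y)
        exact ⟨⟨⟨⟨a, hadd⟩, hsmul⟩, ha⟩, rfl⟩
    rw [heq]
    exact isClosed_closure
  · rintro _ ⟨t, rfl⟩ f - s - k hk
    exact bigHecke_translate_reduce t hk

/-- Every closed multiplicative semigroup generated by one element contains an idempotent. -/
lemma exists_idempotent [IsSimpleRing D] (hc : c ≠ 1)
    (hdef : CompactSpace (U σ (NumberField.InfiniteAdeleRing F))) (hI : IsAdic I)
    (z : bigHecke Kt O I S) :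
    ∃ e ∈ closure (Set.range fun n : ℕ => z ^ (n + 1)), e * e = e ∧ ∃ u, e = z * u := by
  have := compactSpace_bigHecke (S := S) (Kt := Kt) hc hdef hI
  -- The powers start at `z` itself, so that they all lie in the closed set of multiples of `z`.
  set P : Set (bigHecke Kt O I S) := Set.range fun n : ℕ => z ^ (n + 1)
  have hmul : ∀ x ∈ closure P, ∀ y ∈ closure P, x * y ∈ closure P := by
    have h1 : ∀ x ∈ P, ∀ y ∈ closure P, x * y ∈ closure P := by
      rintro _ ⟨n, rfl⟩ y hy
      refine map_mem_closure (continuous_bigHecke_mul_left _) hy ?_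
      rintro _ ⟨k, rfl⟩
      refine ⟨n + (k + 1), ?_⟩
      exact (congrArg (z ^ ·) (show n + (k + 1) + 1 = n + 1 + (k + 1) by omega)).trans
        (pow_add z (n + 1) (k + 1))
    intro x hx y hy
    have := map_mem_closure (continuous_bigHecke_mul_right y) hx (fun x hx => h1 x hx y hy)
    rwa [closure_closure] at this
  obtain ⟨e, he, hee⟩ := exists_idempotent_in_compact_subsemigroup
    continuous_bigHecke_mul_right (closure P) ⟨z, subset_closure ⟨0, by simp⟩⟩
    isClosed_closure.isCompact hmul
  refine ⟨e, he, hee, ?_⟩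
  have hcl : IsClosed (Set.range fun u : bigHecke Kt O I S => z * u) :=
    (isCompact_range (continuous_bigHecke_mul_left z)).isClosed
  obtain ⟨u, hu⟩ := closure_minimal (by
    rintro _ ⟨n, rfl⟩
    exact ⟨z ^ n, (pow_succ' z n).symm⟩) hcl he
  exact ⟨u, hu.symm⟩

end Compactness

end DefiniteUnitary
end

noncomputable section

namespace DefiniteUnitary

/-! ### Localization split by an idempotent -/

section Localization

/-- If an idempotent outside the prime `m` is divisible by every element outside `m`, then it splits
the localization at `m`. -/
lemma exists_section_localization {R M : Type*} [CommRing R] [AddCommGroup M] [Module R M]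
    (S : Submonoid R) {e : R} (he : e * e = e) (heS : e ∈ S) (h : ∀ s ∈ S, ∃ u, s * u * e = e) :
    ∃ j : LocalizedModule S M →ₗ[R] M,
      (∀ x, j (LocalizedModule.mkLinearMap S M x) = e • x) ∧
      ∀ y, LocalizedModule.mkLinearMap S M (j y) = y := by
  -- On the summand `e M` every element of `S` is invertible, so the projection to it factors
  -- through the localization.
  let N : Submodule R M := LinearMap.range (LinearMap.lsmul R M e)
  let π : M →ₗ[R] N := (LinearMap.lsmul R M e).rangeRestrict
  have heN : ∀ y : N, e • y = y := by
    rintro ⟨_, x, rfl⟩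
    refine Subtype.ext ?_
    change e • e • x = e • x
    rw [smul_smul, he]
  have hunit : ∀ s : S, IsUnit (algebraMap R (Module.End R N) s) := by
    intro s
    obtain ⟨u, hu⟩ := h s s.2
    have h1 : ∀ y : N, (s : R) • u • y = y := by
      intro y
      rw [← heN y, smul_smul, smul_smul, hu]
    have h2 : ∀ y : N, u • (s : R) • y = y := fun y => by rw [smul_comm, h1]
    exact ⟨⟨algebraMap R _ s, algebraMap R _ u, LinearMap.ext h1, LinearMap.ext h2⟩, rfl⟩
  let j₀ := LocalizedModule.lift S π hunit
  have hj₀ : ∀ x, j₀ (LocalizedModule.mkLinearMap S M x) = π x := fun x =>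
    LinearMap.congr_fun (LocalizedModule.lift_comp S π hunit) x
  have hj : ∀ x, (N.subtype.comp j₀) (LocalizedModule.mkLinearMap S M x) = e • x := fun x => by
    rw [LinearMap.comp_apply, hj₀]
    rfl
  refine ⟨N.subtype.comp j₀, hj, fun y => ?_⟩
  have hinj : ∀ s ∈ S, ∀ a b : LocalizedModule S M, s • a = s • b → a = b := fun s hs a b hab =>
    (IsLocalizedModule.smul_inj (S := S) (LocalizedModule.mkLinearMap S M) ⟨s, hs⟩ a b).1 hab
  obtain ⟨⟨x, s⟩, hx⟩ := IsLocalizedModule.surj S (LocalizedModule.mkLinearMap S M) y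
  refine hinj s s.2 _ _ ?_
  have hx' : (s : R) • y = LocalizedModule.mkLinearMap S M x := hx
  rw [hx', ← map_smul, ← map_smul, hx', hj]
  -- As `e` belongs to `S`, it acts injectively on the localization, so `e` may be cancelled.
  refine hinj e heS _ _ ?_
  rw [← map_smul, ← map_smul, smul_smul, he]

end Localization

/-! ### Idempotents of the Hecke algebra and its maximal ideals -/

section Idempotents

open Topology Filter

attribute [local instance] pointwiseTopology tensorTopology

variable {F K D : Type*} [Field F] [NumberField F] [Field K] [Algebra F K]
  [Ring D] [Algebra K D] [Algebra F D] [IsScalarTower F K D] [FiniteDimensional F D]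
  {c : K ≃ₐ[F] K} {σ : AntiInvolution D c} {p : ℕ} {Kt : TameLevel σ p}
  {O : Type*} [CommRing O] [IsDomain O] [TopologicalSpace O] [IsTopologicalRing O] [CompactSpace O]
  [T2Space O] {ϖ : O} {S : Finset (HeightOneSpectrum (𝓞 F))}

/-- The values in `𝒪` can be divided by `ϖ`, and cancelling `ϖ` carries the invariance of `f` over
to the quotient. -/
lemma exists_eq_smul_of_reduce_one (hI : IsAdic (Ideal.span {ϖ})) (hϖ : ϖ ≠ 0)
    {f : CompletedH0 Kt O (Ideal.span {ϖ})} (hf : CompletedH0.reduce 1 f = 0) :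
    ∃ h, f = ϖ • h := by
  have hdvd : ∀ x, ϖ ∣ CompletedH0.value hI f x := by
    intro x
    have h1 := CompletedH0.mk_value hI f x 1
    rw [hf, map_zero, Pi.zero_apply, Ideal.Quotient.eq_zero_iff_mem, pow_one,
      Ideal.mem_span_singleton] at h1
    exact h1
  choose q hq using hdvd
  have hinv : ∀ x y, (∀ s, H0.fn (CompletedH0.reduce s f) x = H0.fn (CompletedH0.reduce s f) y) →
      q x = q y := by
    intro x y h
    apply mul_left_cancel₀ hϖ
    rw [← hq, ← hq]
    refine eq_of_forall_mk_eq hI fun s => ?_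
    rw [CompletedH0.mk_value, CompletedH0.mk_value, h]
  have hsm : ∀ s, (fun x => Ideal.Quotient.mk (Ideal.span {ϖ} ^ s) (q x)) ∈
      smoothForms Kt O (O ⧸ Ideal.span {ϖ} ^ s) := by
    intro s
    -- Division loses one power of `ϖ`: the quotient modulo `ϖ ^ s` is invariant wherever `f` is
    -- modulo `ϖ ^ (s + 1)`.
    obtain ⟨-, -, H, hH, h⟩ := (CompletedH0.reduce (s + 1) f).2
    refine ⟨fun γ hγ x => ?_, fun κ hκ x => ?_, H, hH, fun k hk x => ?_⟩
    · exact congrArg _ (hinv _ _ fun s => (CompletedH0.reduce s f).2.1 γ hγ x)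
    · exact congrArg _ (hinv _ _ fun s => (CompletedH0.reduce s f).2.2.1 κ hκ x)
    · have h1 : H0.fn (CompletedH0.reduce (s + 1) f) (x * k) =
        H0.fn (CompletedH0.reduce (s + 1) f) x := h k hk x
      rw [← CompletedH0.mk_value hI, ← CompletedH0.mk_value hI, Ideal.Quotient.eq, hq, hq,
        ← mul_sub, Ideal.span_singleton_pow, Ideal.mem_span_singleton, pow_succ',
        mul_dvd_mul_iff_left hϖ] at h1
      change Ideal.Quotient.mk _ _ = Ideal.Quotient.mk _ _
      rwa [Ideal.Quotient.eq, Ideal.span_singleton_pow, Ideal.mem_span_singleton]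
  refine ⟨⟨fun s => ⟨_, hsm s⟩, fun s t h x => rfl⟩, CompletedH0.ext_reduce fun s => H0.ext fun x => ?_⟩
  rw [← CompletedH0.mk_value hI, hq, map_mul]
  rfl

lemma reduce_pow_smul (s : ℕ) (h : CompletedH0 Kt O (Ideal.span {ϖ})) :
    CompletedH0.reduce s (ϖ ^ s • h) = 0 := by
  refine H0.ext fun x => ?_
  rw [map_smul, map_smul, Pi.smul_apply, Algebra.smul_def, map_zero]
  have : algebraMap O (O ⧸ Ideal.span {ϖ} ^ s) (ϖ ^ s) = 0 :=
    Ideal.Quotient.eq_zero_iff_mem.2 (Ideal.pow_mem_pow (Ideal.mem_span_singleton_self ϖ) s)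
  rw [this, zero_mul]
  rfl

/-- A `p`-torsion smooth representation of a pro-`p` group has invariants; here for the reductions
of the forms fixed by a Hecke operator. -/
lemma exists_invariant_reduce_ne_zero [Fact p.Prime] [IsSimpleRing D] (hc : c ≠ 1)
    (hdef : CompactSpace (U σ (NumberField.InfiniteAdeleRing F)))
    {Kp : Subgroup (GQp σ p)} (hKp_open : IsOpen (Kp : Set (GQp σ p)))
    (hKp_compact : IsCompact (Kp : Set (GQp σ p))) (hKp_pro : IsProP p Kp)
    {I : Ideal O} (hI : IsAdic I) (hp : ∃ n : ℕ, (p : O) ^ n ∈ I ^ 1)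
    (ε : bigHecke Kt O I S)
    {f : CompletedH0 Kt O I} (hf : ε.1 f = f) (hf0 : CompletedH0.reduce 1 f ≠ 0) :
    ∃ h, ε.1 h = h ∧ CompletedH0.reduce 1 h ≠ 0 ∧
      ∀ k ∈ Kp, H0.translate Kt O _ k (CompletedH0.reduce 1 h) = CompletedH0.reduce 1 h := by
  have : CompactSpace Kp := isCompact_iff_compactSpace.1 hKp_compact
  have := finite_quotient_pow hI 1
  obtain ⟨H, hH, hHf⟩ : ∃ H : Subgroup (GQp σ p), IsOpen (H : Set (GQp σ p)) ∧ ∀ k ∈ H,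
      H0.translate Kt O _ k (CompletedH0.reduce 1 f) = CompletedH0.reduce 1 f := by
    obtain ⟨-, -, H, hH, h⟩ := (CompletedH0.reduce 1 f).2
    exact ⟨H, hH, fun k hk => H0.ext fun x => h k hk x⟩
  obtain ⟨N, hN⟩ := ProfiniteGrp.exist_openNormalSubgroup_sub_open_nhds_of_one
    (hH.preimage (continuous_subtype_val (p := (· ∈ Kp)))) (by simp [H.one_mem])
  -- `V` consists of the `N`-invariant reductions of forms fixed by `ε`. It is finite and contains
  -- the reduction of `f`, and `K_p` acts on it through a finite `p`-group.
  let V : AddSubgroup (H0 Kt O (O ⧸ I ^ 1)) :=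
    { carrier := {y | (∃ h, ε.1 h = h ∧ CompletedH0.reduce 1 h = y) ∧
        ∀ k ∈ N.toSubgroup, H0.translate Kt O _ (k : GQp σ p) y = y}
      zero_mem' := ⟨⟨0, map_zero _, map_zero _⟩, fun k _ => map_zero _⟩
      add_mem' := by
        rintro _ _ ⟨⟨h, hh, rfl⟩, h1⟩ ⟨⟨h', hh', rfl⟩, h2⟩
        refine ⟨⟨h + h', by rw [map_add, hh, hh'], map_add _ _ _⟩, fun k hk => ?_⟩
        rw [map_add, h1 k hk, h2 k hk]
      neg_mem' := by
        rintro _ ⟨⟨h, hh, rfl⟩, h1⟩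
        refine ⟨⟨-h, by rw [map_neg, hh], map_neg _ _⟩, fun k hk => ?_⟩
        rw [map_neg, h1 k hk] }
  have htr : ∀ (a b : GQp σ p) (y : H0 Kt O (O ⧸ I ^ 1)),
      H0.translate Kt O _ (a * b) y = H0.translate Kt O _ a (H0.translate Kt O _ b y) := by
    intro a b y
    refine H0.ext fun x => ?_
    change H0.fn y (x * (a * b)) = H0.fn y (x * a * b)
    rw [mul_assoc]
  have htr1 : ∀ y : H0 Kt O (O ⧸ I ^ 1), H0.translate Kt O _ 1 y = y := by
    intro y
    refine H0.ext fun x => ?_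
    change H0.fn y (x * 1) = _
    rw [mul_one]
  have hVfin : Finite V := by
    have h1 : IsOpen (((N.toSubgroup).map Kp.subtype : Subgroup (GQp σ p)) : Set (GQp σ p)) :=
      hKp_open.isOpenMap_subtype_val _ N.isOpen'
    refine ((finite_invariants (Kt := Kt) (O := O) (A := O ⧸ I ^ 1) hc hdef h1).subset ?_).to_subtype
    rintro y ⟨-, hy⟩ _ ⟨k, hk, rfl⟩
    exact hy k hk
  have hstab : ∀ (k : Kp) (y : V), H0.translate Kt O _ (k : GQp σ p) y.1 ∈ V := by
    rintro k ⟨_, ⟨h, hh, rfl⟩, hy⟩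
    refine ⟨⟨translation Kt O I k h, ?_, rfl⟩, fun n hn => ?_⟩
    · rw [bigHecke_translation, hh]
    · have h1 : (n : GQp σ p) * k = k * ((k⁻¹ * n * k : Kp) : GQp σ p) := by
        simp [mul_assoc]
      have h2 : k⁻¹ * n * k ∈ N.toSubgroup := by
        have h3 : N.toSubgroup.Normal := inferInstance
        simpa using h3.conj_mem n hn k⁻¹
      rw [← htr, h1, htr, hy _ h2]
  let act : MulAction Kp V :=
    { smul := fun k y => ⟨_, hstab k y⟩
      one_smul := fun y => Subtype.ext (htr1 _)
      mul_smul := fun a b y => Subtype.ext (htr a b _) }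
  have hsmul : ∀ (k : Kp) (y : V), ((k • y : V) : H0 Kt O (O ⧸ I ^ 1)) =
    H0.translate Kt O _ (k : GQp σ p) y.1 := fun _ _ => rfl
  let ρ := MulAction.toPermHom Kp V
  have hker : N.toSubgroup ≤ ρ.ker := by
    intro k hk
    refine Equiv.ext fun y => Subtype.ext ?_
    exact y.2.2 k hk
  have hkeropen : IsOpen (ρ.ker : Set Kp) := Subgroup.isOpen_mono hker N.isOpen'
  obtain ⟨m, hm⟩ := hKp_pro ρ.ker inferInstance hkeropen
  have hpg : IsPGroup p ρ.range := by
    refine IsPGroup.of_card (n := m) ?_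
    rw [← Subgroup.index_ker, hm]
  have hmem : CompletedH0.reduce 1 f ∈ V := ⟨⟨f, hf, rfl⟩, fun k hk => hHf _ (hN hk)⟩
  -- The reduction of `f` is a nonzero element of `V` killed by a power of `p`.
  have hdvd : p ∣ Nat.card V := by
    obtain ⟨n, hn⟩ := hp
    let y : V := ⟨_, hmem⟩
    have hy : (p ^ n) • y = 0 := by
      refine Subtype.ext ?_
      change (p ^ n) • (CompletedH0.reduce 1 f) = 0
      refine H0.ext fun x => ?_
      rw [map_nsmul, Pi.smul_apply, ← Nat.cast_smul_eq_nsmul O, Nat.cast_pow, Algebra.smul_def,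
        show algebraMap O (O ⧸ I ^ 1) ((p : O) ^ n) = 0 from Ideal.Quotient.eq_zero_iff_mem.2 hn,
        zero_mul, map_zero]
      rfl
    have hne : addOrderOf y ≠ 1 := by
      rw [Ne, AddMonoid.addOrderOf_eq_one_iff]
      intro h
      exact hf0 (congrArg Subtype.val h)
    obtain ⟨j, -, hj⟩ := (Nat.dvd_prime_pow (Fact.out : p.Prime)).1
      (addOrderOf_dvd_of_nsmul_eq_zero hy)
    refine Dvd.dvd.trans ?_ (addOrderOf_dvd_natCard y)
    rw [hj]
    refine dvd_pow_self p ?_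
    rintro rfl
    exact hne (by rw [hj, pow_zero])
  -- The number of fixed points of a `p`-group on `V` is divisible by `p`, so `0` is not the only
  -- one.
  obtain ⟨⟨y, ⟨h, hh, rfl⟩, hy'⟩, hyfix, hy0⟩ :=
    hpg.exists_fixed_point_of_prime_dvd_card_of_fixed_point V hdvd (a := 0) (by
      rintro ⟨_, k, rfl⟩
      exact Subtype.ext (map_zero _))
  refine ⟨h, hh, fun h0 => hy0 (Subtype.ext h0.symm), fun k hk => ?_⟩
  exact congrArg Subtype.val (hyfix ⟨ρ ⟨k, hk⟩, ⟨k, hk⟩, rfl⟩)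

/-- The Hecke operators are determined, when they are idempotent, by their action modulo `ϖ` on
the forms of level `K_p`. -/
lemma eq_zero_of_idempotent [Fact p.Prime] [IsSimpleRing D] (hc : c ≠ 1)
    (hdef : CompactSpace (U σ (NumberField.InfiniteAdeleRing F)))
    {Kp : Subgroup (GQp σ p)} (hKp_open : IsOpen (Kp : Set (GQp σ p)))
    (hKp_compact : IsCompact (Kp : Set (GQp σ p))) (hKp_pro : IsProP p Kp)
    (hI : IsAdic (Ideal.span {ϖ})) (hϖ : ϖ ≠ 0) (hp : ∃ n : ℕ, (p : O) ^ n ∈ Ideal.span {ϖ} ^ 1)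
    {ε : bigHecke Kt O (Ideal.span {ϖ}) S} (hε : ε * ε = ε)
    (h : ∀ f, (∀ k ∈ Kp, H0.translate Kt O _ k (CompletedH0.reduce 1 f) =
      CompletedH0.reduce 1 f) → CompletedH0.reduce 1 (ε.1 f) = 0) : ε = 0 := by
  have hεε : ∀ f, ε.1 (ε.1 f) = ε.1 f := fun f =>
    LinearMap.congr_fun (congrArg Subtype.val hε) f
  have h1 : ∀ f, ε.1 f = f → CompletedH0.reduce 1 f = 0 := by
    intro f hf
    by_contra hne
    obtain ⟨f', hf', hne', hinv⟩ := exists_invariant_reduce_ne_zero hc hdef hKp_open hKp_compact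
      hKp_pro hI hp ε hf hne
    refine hne' ?_
    rw [← hf']
    exact h f' hinv
  -- A form fixed by `ε` vanishes modulo `ϖ`; writing it as `ϖ g` and applying `ε`, it equals `ϖ`
  -- times the fixed form `ε g`. Iterating, it is divisible by every power of `ϖ`.
  have h2 : ∀ n : ℕ, ∀ f, ε.1 f = f → ∃ f', f = ϖ ^ n • f' ∧ ε.1 f' = f' := by
    intro n
    induction n with
    | zero => exact fun f hf => ⟨f, by simp, hf⟩
    | succ n ih =>
      intro f hf
      obtain ⟨f', hff', hf'⟩ := ih f hf
      obtain ⟨g, hg⟩ := exists_eq_smul_of_reduce_one hI hϖ (h1 f' hf')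
      refine ⟨ε.1 g, ?_, hεε g⟩
      rw [pow_succ, mul_smul, ← map_smul, ← hg, hf', hff']
  refine Subtype.ext (LinearMap.ext fun f => CompletedH0.ext_reduce fun s => ?_)
  obtain ⟨f', hf', -⟩ := h2 s (ε.1 f) (hεε f)
  rw [hf', reduce_pow_smul]
  rfl

/-- By commutativity `e (1 - e')` is idempotent and acts as zero on the test forms modulo `ϖ`,
whence `e = e e'`; the symmetric argument gives `e' = e' e`. -/
lemma eq_of_idempotent [Fact p.Prime] [IsSimpleRing D] (hc : c ≠ 1)
    (hdef : CompactSpace (U σ (NumberField.InfiniteAdeleRing F)))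
    {Kp : Subgroup (GQp σ p)} (hKp_open : IsOpen (Kp : Set (GQp σ p)))
    (hKp_compact : IsCompact (Kp : Set (GQp σ p))) (hKp_pro : IsProP p Kp)
    (hI : IsAdic (Ideal.span {ϖ})) (hϖ : ϖ ≠ 0) (hp : ∃ n : ℕ, (p : O) ^ n ∈ Ideal.span {ϖ} ^ 1)
    (hcomm : ∀ a b : bigHecke Kt O (Ideal.span {ϖ}) S, a * b = b * a)
    {e e' : bigHecke Kt O (Ideal.span {ϖ}) S} (he : e * e = e) (he' : e' * e' = e')
    (h : ∀ f, (∀ k ∈ Kp, H0.translate Kt O _ k (CompletedH0.reduce 1 f) =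
      CompletedH0.reduce 1 f) → CompletedH0.reduce 1 (e.1 f) = CompletedH0.reduce 1 (e'.1 f)) :
    e = e' := by
  have key : ∀ {e e' : bigHecke Kt O (Ideal.span {ϖ}) S}, e * e = e → e' * e' = e' →
      (∀ f, (∀ k ∈ Kp, H0.translate Kt O _ k (CompletedH0.reduce 1 f) =
      CompletedH0.reduce 1 f) → CompletedH0.reduce 1 (e.1 f) = CompletedH0.reduce 1 (e'.1 f)) →
      e = e * e' := by
    intro e e' he he' h
    rw [← sub_eq_zero]
    refine eq_zero_of_idempotent hc hdef hKp_open hKp_compact hKp_pro hI hϖ hp ?_ ?_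
    · have h1 : e * e' * e = e * e' := by rw [mul_assoc, hcomm e' e, ← mul_assoc, he]
      have h2 : e * (e * e') = e * e' := by rw [← mul_assoc, he]
      have h3 : e * e' * (e * e') = e * e' := by rw [← mul_assoc, h1, mul_assoc, he']
      rw [sub_mul, mul_sub, mul_sub, he, h1, h2, h3, sub_self, sub_zero]
    · intro f hf
      have h1 : (e - e * e').1 f = e.1 f - e.1 (e'.1 f) := rfl
      have h2 : e'.1 (e'.1 f) = e'.1 f := LinearMap.congr_fun (congrArg Subtype.val he') f
      rw [h1, map_sub, h _ fun k hk => bigHecke_translate_reduce e' (hf k hk), h2, h f hf, sub_self]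
  rw [key he he' h, hcomm, ← key he' he fun f hf => (h f hf).symm]

/-- For every maximal ideal `m` there is an idempotent outside `m` which is divisible by the
elements outside `m`. -/
lemma exists_idempotent_notMem [Fact p.Prime] [IsSimpleRing D] (hc : c ≠ 1)
    (hdef : CompactSpace (U σ (NumberField.InfiniteAdeleRing F)))
    {Kp : Subgroup (GQp σ p)} (hKp_open : IsOpen (Kp : Set (GQp σ p)))
    (hKp_compact : IsCompact (Kp : Set (GQp σ p))) (hKp_pro : IsProP p Kp)
    (hI : IsAdic (Ideal.span {ϖ})) (hϖ : ϖ ≠ 0) (hp : ∃ n : ℕ, (p : O) ^ n ∈ Ideal.span {ϖ} ^ 1)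
    (hcomm : ∀ a b : bigHecke Kt O (Ideal.span {ϖ}) S, a * b = b * a)
    (m : Ideal (bigHecke Kt O (Ideal.span {ϖ}) S)) (hm : m.IsMaximal) :
    ∃ e : bigHecke Kt O (Ideal.span {ϖ}) S, e ∉ m ∧ e * e = e ∧ ∀ s ∉ m, ∃ u, s * u * e = e := by
  classical
  letI : CommRing (bigHecke Kt O (Ideal.span {ϖ}) S) :=
    { (inferInstance : Ring (bigHecke Kt O (Ideal.span {ϖ}) S)) with mul_comm := hcomm }
  have hprime : m.IsPrime := hm.isPrime
  let X : Set (CompletedH0 Kt O (Ideal.span {ϖ})) := {f | ∀ k ∈ Kp,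
    H0.translate Kt O _ k (CompletedH0.reduce 1 f) = CompletedH0.reduce 1 f}
  have hX : ∀ (t : bigHecke Kt O (Ideal.span {ϖ}) S), ∀ f ∈ X, t.1 f ∈ X :=
    fun t f hf k hk => bigHecke_translate_reduce t (hf k hk)
  have huniq : ∀ {e e' : bigHecke Kt O (Ideal.span {ϖ}) S}, e * e = e → e' * e' = e' →
      (∀ f ∈ X, CompletedH0.reduce 1 (e.1 f) = CompletedH0.reduce 1 (e'.1 f)) → e = e' :=
    fun he he' h => eq_of_idempotent hc hdef hKp_open hKp_compact hKp_pro hI hϖ hp hcomm he he' h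
  have := finite_quotient_pow hI 1
  have hYfin : (CompletedH0.reduce 1 '' X).Finite := by
    refine (finite_invariants (Kt := Kt) (O := O) (A := O ⧸ Ideal.span {ϖ} ^ 1) hc hdef
      hKp_open).subset ?_
    rintro _ ⟨f, hf, rfl⟩
    exact hf
  have hrep : ∀ y : CompletedH0.reduce 1 '' X, ∃ f ∈ X, CompletedH0.reduce 1 f = y.1 := fun y => y.2
  choose rep hrepX hrep using hrep
  -- Only finitely many reductions occur on `X`, so an element of a closure acts on them exactly as
  -- some element of the original set.
  have hclose : ∀ (P : Set (bigHecke Kt O (Ideal.span {ϖ}) S)), ∀ z ∈ closure P,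
      ∃ t ∈ P, ∀ f ∈ X, CompletedH0.reduce 1 (t.1 f) = CompletedH0.reduce 1 (z.1 f) := by
    intro P z hz
    have : Finite (CompletedH0.reduce 1 '' X) := hYfin
    have hopen : IsOpen {t : bigHecke Kt O (Ideal.span {ϖ}) S | ∀ y,
        CompletedH0.reduce 1 (t.1 (rep y)) = CompletedH0.reduce 1 (z.1 (rep y))} := by
      rw [Set.ofPred_forall]
      exact isOpen_iInter_of_finite fun y => isLocallyConstant_bigHecke 1 (rep y) {a | a = _}
    obtain ⟨t, ht, htP⟩ := mem_closure_iff.1 hz _ hopen fun y => rfl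
    refine ⟨t, htP, fun f hf => ?_⟩
    let y : CompletedH0.reduce 1 '' X := ⟨_, f, hf, rfl⟩
    rw [bigHecke_reduce_congr t (hrep y).symm, bigHecke_reduce_congr z (hrep y).symm]
    exact ht y
  -- An idempotent is determined by the map it induces on the finite set of reductions.
  have hidfin : {e : bigHecke Kt O (Ideal.span {ϖ}) S | e * e = e ∧ e ∉ m}.Finite := by
    have : Finite (CompletedH0.reduce 1 '' X) := hYfin
    have : Finite (CompletedH0.reduce 1 '' X → CompletedH0.reduce 1 '' X) := inferInstance
    refine Set.Finite.of_finite_image (f := fun e y => (⟨_, e.1 (rep y), hX e _ (hrepX y), rfl⟩ :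
      CompletedH0.reduce 1 '' X)) (Set.toFinite _) ?_
    intro e he e' he' h
    refine huniq he.1 he'.1 fun f hf => ?_
    let y : CompletedH0.reduce 1 '' X := ⟨_, f, hf, rfl⟩
    rw [bigHecke_reduce_congr e (hrep y).symm, bigHecke_reduce_congr e' (hrep y).symm]
    exact congrArg Subtype.val (congrFun h y)
  -- The ideal `m` is not assumed closed, so it is not automatic that the idempotent in the closure
  -- of the powers of `s` avoids it. If `e ∈ m`, the same construction applied to `(1 - e) μ`, with
  -- `μ ∈ m`, would put `1 - e` in `m` as well.
  have hnotMem : ∀ s ∉ m, ∃ e, e * e = e ∧ e ∉ m ∧ ∃ u, e = s * u := by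
    intro s hs
    obtain ⟨e, hecl, hee, u, hu⟩ := exists_idempotent hc hdef hI s
    refine ⟨e, hee, fun hem => ?_, u, hu⟩
    have hff : (1 - e) * (1 - e) = 1 - e := by
      linear_combination hee
    obtain ⟨_, ⟨n, rfl⟩, hn⟩ := hclose _ e hecl
    obtain ⟨a, μ, hμ, haμ⟩ := hm.exists_inv (x := s ^ (n + 1)) fun h => hs (hprime.mem_of_pow_mem _ h)
    -- Some `s ^ (n + 1)` acts like `e` on the test forms, and `a s ^ (n + 1) + μ = 1`. Hence `(1 -
    -- e) μ` and all its positive powers act like `1 - e`, which identifies `e'` with `1 - e`.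
    obtain ⟨e', he'cl, hee', u', hu'⟩ := exists_idempotent hc hdef hI ((1 - e) * μ)
    have hz : ∀ f ∈ X, CompletedH0.reduce 1 (((1 - e) * μ).1 f) =
        CompletedH0.reduce 1 ((1 - e).1 f) := by
      intro f hf
      have h1 : (1 - e) * μ = (1 - e) - (1 - e) * a * s ^ (n + 1) := by
        linear_combination (1 - e) * haμ
      have h2 : ((1 - e) * μ).1 f = (1 - e).1 f - ((1 - e) * a).1 ((s ^ (n + 1)).1 f) := by
        rw [h1]
        rfl
      rw [h2, map_sub, bigHecke_reduce_congr _ (hn f hf)]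
      have h3 : ((1 - e) * a).1 (e.1 f) = ((1 - e) * a * e).1 f := rfl
      have h4 : (1 - e) * a * e = 0 := by linear_combination -a * hee
      rw [h3, h4]
      change _ - CompletedH0.reduce 1 0 = _
      rw [map_zero, sub_zero]
    have hzpow : ∀ k : ℕ, ∀ f ∈ X, CompletedH0.reduce 1 ((((1 - e) * μ) ^ (k + 1)).1 f) =
        CompletedH0.reduce 1 ((1 - e).1 f) := by
      intro k
      induction k with
      | zero =>
        intro f hf
        rw [zero_add, pow_one ((1 - e) * μ)]
        exact hz f hf
      | succ k ih =>
        intro f hf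
        rw [pow_succ ((1 - e) * μ) (k + 1)]
        change CompletedH0.reduce 1 ((((1 - e) * μ) ^ (k + 1)).1 (((1 - e) * μ).1 f)) = _
        rw [ih _ (hX _ f hf), bigHecke_reduce_congr _ (hz f hf)]
        exact congrArg _ (LinearMap.congr_fun (congrArg Subtype.val hff) f)
    have heq : e' = 1 - e := by
      refine huniq hee' hff fun f hf => ?_
      obtain ⟨_, ⟨k, rfl⟩, hk⟩ := hclose _ e' he'cl
      rw [← hk f hf]
      exact hzpow k f hf
    apply hm.ne_top
    rw [Ideal.eq_top_iff_one]
    have : (1 : bigHecke Kt O (Ideal.span {ϖ}) S) = e + (1 - e) := by ring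
    rw [this, ← heq, hu']
    exact m.add_mem hem (m.mul_mem_right _ (m.mul_mem_left _ hμ))
  -- The product of all idempotents outside `m` is the required one: it is a multiple of the
  -- idempotent attached to any `s ∉ m`, which is itself a multiple of `s`.
  have hprod : ∀ E : Finset (bigHecke Kt O (Ideal.span {ϖ}) S),
      (∀ e ∈ E, e * e = e ∧ e ∉ m) → (∏ e ∈ E, e) * (∏ e ∈ E, e) = ∏ e ∈ E, e ∧
        ∏ e ∈ E, e ∉ m := by
    intro E hE
    refine ⟨?_, fun h => ?_⟩
    · rw [← Finset.prod_mul_distrib]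
      exact Finset.prod_congr rfl fun e he => (hE e he).1
    · obtain ⟨e, he, hem⟩ := hprime.prod_mem_iff.1 h
      exact (hE e he).2 hem
  obtain ⟨h1, h2⟩ := hprod hidfin.toFinset fun e he => hidfin.mem_toFinset.1 he
  refine ⟨_, h2, h1, fun s hs => ?_⟩
  obtain ⟨e, hee, hem, u, hu⟩ := hnotMem s hs
  refine ⟨u, ?_⟩
  rw [← Finset.mul_prod_erase _ (fun x => x) (hidfin.mem_toFinset.2 ⟨hee, hem⟩)]
  change s * u * (e * _) = e * _
  rw [← hu, ← mul_assoc, hee]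

/-- The localization of the completed cohomology at a maximal ideal of the Hecke algebra is a direct
summand. -/
lemma exists_localization_section [Fact p.Prime] [IsSimpleRing D] (hc : c ≠ 1)
    (hdef : CompactSpace (U σ (NumberField.InfiniteAdeleRing F)))
    {Kp : Subgroup (GQp σ p)} (hKp_open : IsOpen (Kp : Set (GQp σ p)))
    (hKp_compact : IsCompact (Kp : Set (GQp σ p))) (hKp_pro : IsProP p Kp)
    (hI : IsAdic (Ideal.span {ϖ})) (hϖ : ϖ ≠ 0) (hp : ∃ n : ℕ, (p : O) ^ n ∈ Ideal.span {ϖ} ^ 1)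
    (hcomm : ∀ a b : bigHecke Kt O (Ideal.span {ϖ}) S, a * b = b * a) :
    letI : CommRing (bigHecke Kt O (Ideal.span {ϖ}) S) :=
      { (inferInstance : Ring (bigHecke Kt O (Ideal.span {ϖ}) S)) with mul_comm := hcomm }
    ∀ (m : Ideal (bigHecke Kt O (Ideal.span {ϖ}) S)) [m.IsMaximal],
      ∃ j : LocalizedModule m.primeCompl (CompletedH0 Kt O (Ideal.span {ϖ}))
          →ₗ[bigHecke Kt O (Ideal.span {ϖ}) S] CompletedH0 Kt O (Ideal.span {ϖ}),
        (∀ y, LocalizedModule.mkLinearMap m.primeCompl _ (j y) = y) ∧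
        Continuous (fun f => j (LocalizedModule.mkLinearMap m.primeCompl
          (CompletedH0 Kt O (Ideal.span {ϖ})) f)) ∧
        ∀ (g : GQp σ p) (f : CompletedH0 Kt O (Ideal.span {ϖ})),
          j (LocalizedModule.mkLinearMap m.primeCompl _
            (translation Kt O (Ideal.span {ϖ}) g f)) =
          translation Kt O (Ideal.span {ϖ}) g
            (j (LocalizedModule.mkLinearMap m.primeCompl _ f)) := by
  letI : CommRing (bigHecke Kt O (Ideal.span {ϖ}) S) :=
    { (inferInstance : Ring (bigHecke Kt O (Ideal.span {ϖ}) S)) with mul_comm := hcomm }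
  intro m hm
  obtain ⟨e, hem, hee, he⟩ := exists_idempotent_notMem hc hdef hKp_open hKp_compact hKp_pro hI
    hϖ hp hcomm m hm
  obtain ⟨j, hj, hjs⟩ := exists_section_localization
    (M := CompletedH0 Kt O (Ideal.span {ϖ})) m.primeCompl hee hem he
  have hj' : ∀ f, j (LocalizedModule.mkLinearMap m.primeCompl _ f) = e.1 f := hj
  refine ⟨j, hjs, ?_, fun g f => ?_⟩
  · simp only [hj']
    exact continuous_bigHecke e
  · rw [hj', hj']
    exact bigHecke_translation e g f

end Idempotents

end DefiniteUnitary
end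

noncomputable section

namespace DefiniteUnitary

/-! ### Smith normal form over a valuation ring -/

section Smith

open Matrix

variable {E : Type*} [CommRing E] {O : Subring E} {ϖ : Eˣ}

/-- A nonzero entry of least valuation divides all the others. -/
lemma exists_pivot (hϖ : (ϖ : E) ∈ O)
    (hval : ∀ x : E, x ≠ 0 → ∃ (k : ℤ) (u : Eˣ), (u : E) ∈ O ∧ (↑u⁻¹ : E) ∈ O ∧
      x = ↑(ϖ ^ k) * u)
    {ι κ : Type*} [Finite ι] [Finite κ] {x : Matrix ι κ E} (hx : x ≠ 0) :
    ∃ i j, ∀ i' j', ∃ r ∈ O, x i' j' = x i j * r := by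
  choose! k u hu hu' hk using hval
  let X : Set (ι × κ) := {q | x q.1 q.2 ≠ 0}
  have hX : X.Nonempty := by
    by_contra h
    apply hx
    ext i j
    by_contra hij
    exact h ⟨(i, j), hij⟩
  obtain ⟨⟨i, j⟩, hij, hmin⟩ := Set.exists_min_image X (fun q => k (x q.1 q.2)) (Set.toFinite _) hX
  refine ⟨i, j, fun i' j' => ?_⟩
  by_cases h0 : x i' j' = 0
  · exact ⟨0, zero_mem _, by rw [h0, mul_zero]⟩
  · obtain ⟨m, hm⟩ := Int.le.dest (hmin (i', j') h0)
    refine ⟨(ϖ : E) ^ m * u (x i' j') * ↑(u (x i j))⁻¹,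
      mul_mem (mul_mem (pow_mem hϖ _) (hu _ h0)) (hu' _ hij), ?_⟩
    have h1 : ((ϖ ^ k (x i' j') : Eˣ) : E) = ↑(ϖ ^ k (x i j)) * (ϖ : E) ^ m := by
      rw [← hm, _root_.zpow_add, zpow_natCast, Units.val_mul, Units.val_pow_eq_pow_val]
    calc x i' j' = ↑(ϖ ^ k (x i j)) * (ϖ : E) ^ m * u (x i' j') := by rw [← h1, ← hk _ h0]
      _ = ↑(ϖ ^ k (x i j)) * (u (x i j) * ↑(u (x i j))⁻¹) * (ϖ : E) ^ m * u (x i' j') := by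
        rw [Units.mul_inv, mul_one]
      _ = (↑(ϖ ^ k (x i j)) * u (x i j)) * ((ϖ : E) ^ m * u (x i' j') * ↑(u (x i j))⁻¹) := by ring
      _ = _ := by rw [← hk _ hij]

lemma exists_equiv_unit_sum {n : ℕ} (i : Fin (n + 1)) :
    ∃ e : Fin (n + 1) ≃ Unit ⊕ Fin n, e i = Sum.inl () := by
  let e₀ : Fin (n + 1) ≃ Unit ⊕ Fin n := Fintype.equivOfCardEq (by simp [add_comm])
  exact ⟨(Equiv.swap i (e₀.symm (Sum.inl ()))).trans e₀, by simp⟩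

/-- Diagonalization over a valuation ring. -/
lemma exists_diagonalization (hϖ : (ϖ : E) ∈ O)
    (hval : ∀ x : E, x ≠ 0 → ∃ (k : ℤ) (u : Eˣ), (u : E) ∈ O ∧ (↑u⁻¹ : E) ∈ O ∧
      x = ↑(ϖ ^ k) * u) (n : ℕ) (x : Matrix (Fin n) (Fin n) E) :
    ∃ (k₁ k₂ : (Matrix (Fin n) (Fin n) O)ˣ) (d : Fin n → E),
      x = k₁.1.map O.subtype * diagonal d * k₂.1.map O.subtype := by
  induction n with
  | zero => exact ⟨1, 1, 0, Subsingleton.elim _ _⟩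
  | succ n ih =>
    by_cases hx : x = 0
    · exact ⟨1, 1, 0, by simp [hx]⟩
    obtain ⟨i, j, hij⟩ := exists_pivot hϖ hval hx
    obtain ⟨e₁, he₁⟩ := exists_equiv_unit_sum i
    obtain ⟨e₂, he₂⟩ := exists_equiv_unit_sum j
    have he₁' : e₁.symm (Sum.inl ()) = i := by rw [← he₁, e₁.symm_apply_apply]
    have he₂' : e₂.symm (Sum.inl ()) = j := by rw [← he₂, e₂.symm_apply_apply]
    choose r hr hxr using hij
    set p := x i j
    let b : Matrix Unit (Fin n) O := of fun _ m => ⟨_, hr i (e₂.symm (Sum.inr m))⟩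
    let c : Matrix (Fin n) Unit O := of fun m _ => ⟨_, hr (e₁.symm (Sum.inr m)) j⟩
    -- The Schur complement left after clearing the row and the column of the pivot `p`.
    let D : Matrix (Fin n) (Fin n) E := of fun m l => x (e₁.symm (Sum.inr m)) (e₂.symm (Sum.inr l)) -
      p * (r (e₁.symm (Sum.inr m)) j * r i (e₂.symm (Sum.inr l)))
    obtain ⟨k₁, k₂, d, hD⟩ := ih D
    let A : Matrix Unit Unit E := of fun _ _ => p
    let L : Matrix (Unit ⊕ Fin n) (Unit ⊕ Fin n) O := fromBlocks 1 0 c 1 * fromBlocks 1 0 0 k₁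
    let L' : Matrix (Unit ⊕ Fin n) (Unit ⊕ Fin n) O :=
      fromBlocks 1 0 0 k₁⁻¹.1 * fromBlocks 1 0 (-c) 1
    let R : Matrix (Unit ⊕ Fin n) (Unit ⊕ Fin n) O := fromBlocks 1 0 0 k₂ * fromBlocks 1 b 0 1
    let R' : Matrix (Unit ⊕ Fin n) (Unit ⊕ Fin n) O :=
      fromBlocks 1 (-b) 0 1 * fromBlocks 1 0 0 k₂⁻¹.1
    have hLL' : L * L' = 1 := by simp [L, L', fromBlocks_multiply, fromBlocks_one]
    have hL'L : L' * L = 1 := by simp [L, L', fromBlocks_multiply, fromBlocks_one]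
    have hRR' : R * R' = 1 := by simp [R, R', fromBlocks_multiply, fromBlocks_one]
    have hR'R : R' * R = 1 := by simp [R, R', fromBlocks_multiply, fromBlocks_one]
    have hmain : x.submatrix e₁.symm e₂.symm = L.map O.subtype *
        diagonal (Sum.elim (fun _ => p) d) * R.map O.subtype := by
      have h1 : x.submatrix e₁.symm e₂.symm = fromBlocks 1 0 (c.map O.subtype) 1 *
          fromBlocks A 0 0 D * fromBlocks 1 (b.map O.subtype) 0 1 := by
        rw [fromBlocks_multiply, fromBlocks_multiply]
        ext (a | a) (a' | a')
        · simp [A, he₁', he₂', p]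
        · simp only [submatrix_apply, he₁', fromBlocks_apply₁₂]
          simp [A, b, mul_apply, ← hxr]
        · simp only [submatrix_apply, he₂', fromBlocks_apply₂₁]
          simp [A, c, mul_apply, mul_comm _ p, ← hxr]
        · simp only [submatrix_apply, fromBlocks_apply₂₂]
          simp [A, b, c, mul_apply, D]
          ring
      have h2 : fromBlocks A 0 0 D = fromBlocks 1 0 0 (k₁.1.map O.subtype) *
          diagonal (Sum.elim (fun _ => p) d) * fromBlocks 1 0 0 (k₂.1.map O.subtype) := by
        have h3 : diagonal (Sum.elim (fun _ => p) d) = fromBlocks A 0 0 (diagonal d) := by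
          rw [← fromBlocks_diagonal]
          congr 1
        rw [h3, fromBlocks_multiply, fromBlocks_multiply, hD]
        simp
      rw [h1, h2]
      simp only [L, R, Matrix.map_mul, fromBlocks_map]
      simp [Matrix.mul_assoc, Matrix.map_one]
    refine ⟨⟨L.submatrix e₁ e₁, L'.submatrix e₁ e₁, ?_, ?_⟩,
      ⟨R.submatrix e₁ e₂, R'.submatrix e₂ e₁, ?_, ?_⟩,
      Sum.elim (fun _ => p) d ∘ e₁, ?_⟩
    · rw [submatrix_mul_equiv, hLL', submatrix_one_equiv]
    · rw [submatrix_mul_equiv, hL'L, submatrix_one_equiv]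
    · rw [submatrix_mul_equiv, hRR', submatrix_one_equiv]
    · rw [submatrix_mul_equiv, hR'R, submatrix_one_equiv]
    · have h1 := congrArg (fun y => y.submatrix e₁ e₂) hmain
      simp only [submatrix_submatrix, Equiv.symm_comp_self, submatrix_id_id] at h1
      rw [h1, ← submatrix_mul_equiv _ _ _ e₁, ← submatrix_mul_equiv _ _ _ e₁]
      rw [submatrix_diagonal_equiv]
      rfl

/-- The Smith normal form of an invertible matrix. -/
lemma exists_smith (hϖ : (ϖ : E) ∈ O)
    (hval : ∀ x : E, x ≠ 0 → ∃ (k : ℤ) (u : Eˣ), (u : E) ∈ O ∧ (↑u⁻¹ : E) ∈ O ∧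
      x = ↑(ϖ ^ k) * u) [Nontrivial E] {n : ℕ} {x y : Matrix (Fin n) (Fin n) E} (hx : x * y = 1) :
    ∃ (k₁ k₂ : (Matrix (Fin n) (Fin n) O)ˣ) (a : Fin n → ℤ),
      x = k₁.1.map O.subtype * diagonal (fun i => ((ϖ ^ a i : Eˣ) : E)) * k₂.1.map O.subtype := by
  obtain ⟨k₁, k₂, d, hd⟩ := exists_diagonalization hϖ hval n x
  have hdet : IsUnit x.det := by
    refine IsUnit.of_mul_eq_one y.det ?_
    rw [← det_mul, hx, det_one]
  have hd0 : ∀ i, d i ≠ 0 := by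
    intro i
    rw [hd, det_mul, det_mul, det_diagonal] at hdet
    have h1 := isUnit_of_mul_isUnit_right (isUnit_of_mul_isUnit_left hdet)
    exact (isUnit_of_dvd_unit (Finset.dvd_prod_of_mem d (Finset.mem_univ i)) h1).ne_zero
  choose! k u hu hu' hk using hval
  let w : (Matrix (Fin n) (Fin n) O)ˣ := ⟨diagonal fun i => ⟨_, hu _ (hd0 i)⟩,
    diagonal fun i => ⟨_, hu' _ (hd0 i)⟩, by
      rw [diagonal_mul_diagonal, ← diagonal_one]
      congr 1
      ext i
      simp, by
      rw [diagonal_mul_diagonal, ← diagonal_one]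
      congr 1
      ext i
      simp⟩
  refine ⟨k₁, w * k₂, fun i => k (d i), ?_⟩
  have h1 : diagonal d = diagonal (fun i => ((ϖ ^ k (d i) : Eˣ) : E)) * w.1.map O.subtype := by
    rw [show w.1.map O.subtype = diagonal fun i => (u (d i) : E) by
      simp only [w]
      rw [diagonal_map (map_zero _)]
      rfl, diagonal_mul_diagonal]
    congr 1
    ext i
    exact hk _ (hd0 i)
  rw [Units.val_mul, Matrix.map_mul, hd, h1]
  simp only [Matrix.mul_assoc]

end Smith

end DefiniteUnitary
end

noncomputable section

namespace DefiniteUnitary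

/-! ### Gelfand's trick for double cosets -/

section GelfandTrick

variable {G : Type*} [Group G] {Γ M : Subgroup G} {ι : G → G}

lemma mk_mem_orbit_iff {g y : G} : (y : G ⧸ Γ) ∈ MulAction.orbit Γ (g : G ⧸ Γ) ↔
    ∃ k₁ ∈ Γ, ∃ k₂ ∈ Γ, y = k₁ * g * k₂ := by
  constructor
  · rintro ⟨k, hk⟩
    have h1 : ((k * g : G) : G ⧸ Γ) = y := hk
    exact ⟨k, k.2, _, QuotientGroup.eq.1 h1, by group⟩
  · rintro ⟨k₁, h₁, k₂, h₂, rfl⟩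
    refine ⟨⟨k₁, h₁⟩, ?_⟩
    change ((k₁ * g : G) : G ⧸ Γ) = _
    exact QuotientGroup.eq.2 (by simpa [mul_assoc] using h₂)

lemma out_eq_mul {q : G ⧸ Γ} {y : G} (h : (y : G ⧸ Γ) = q) : ∃ γ ∈ Γ, q.out = y * γ := by
  have h1 : (y : G ⧸ Γ) = (q.out : G) := h.trans (Quotient.out_eq' q).symm
  exact ⟨_, QuotientGroup.eq.1 h1, by group⟩

open Classical in
/-- The counting half of Gelfand's trick. -/
lemma card_fiber_le (hΓ : Γ ≤ M) (hι : ∀ x y, ι (x * y) = ι y * ι x)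
    (hM : ∀ x ∈ M, ∃ k₁ ∈ Γ, ∃ k₂ ∈ Γ, ι x = k₁ * x * k₂) {g h : G} (hg : g ∈ M) (hh : h ∈ M)
    {s t : Finset (G ⧸ Γ)} (hs : ∀ q, q ∈ s ↔ q ∈ MulAction.orbit Γ (g : G ⧸ Γ))
    (ht : ∀ q, q ∈ t ↔ q ∈ MulAction.orbit Γ (h : G ⧸ Γ)) (C : G ⧸ Γ) :
    ((s ×ˢ t).filter fun q => C = ((q.1.out * q.2.out : G) : G ⧸ Γ)).card ≤
      ((t ×ˢ s).filter fun q => C = ((q.1.out * q.2.out : G) : G ⧸ Γ)).card := by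
  -- The map `ι` is only controlled on `M`; outside `M` there is nothing to count, since products of
  -- the representatives stay in `M`.
  by_cases hC : C.out ∈ M
  swap
  · refine le_of_eq_of_le (Finset.card_eq_zero.2 (Finset.filter_eq_empty_iff.2 ?_)) (Nat.zero_le _)
    intro q hq hqC
    rw [Finset.mem_product, hs, ht] at hq
    apply hC
    obtain ⟨γ, hγ, h1⟩ := out_eq_mul hqC.symm
    have hout : ∀ {g : G}, g ∈ M → ∀ {q : G ⧸ Γ}, q ∈ MulAction.orbit Γ (g : G ⧸ Γ) → q.out ∈ M := by
      intro g hg q hq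
      rw [← Quotient.out_eq' q] at hq
      obtain ⟨k₁, h₁, k₂, h₂, h3⟩ := mk_mem_orbit_iff.1 hq
      have h4 : q.out = k₁ * g * k₂ := h3
      rw [h4]
      exact mul_mem (mul_mem (hΓ h₁) hg) (hΓ h₂)
    rw [h1]
    exact mul_mem (mul_mem (hout hg hq.1) (hout hh hq.2)) (hΓ hγ)
  obtain ⟨k₁, h₁, k₂, h₂, hk⟩ := hM _ hC
  have hone : ι 1 = 1 := by simpa using hι 1 1
  have hinv : ∀ x, ι x⁻¹ = (ι x)⁻¹ := fun x => by
    rw [eq_inv_iff_mul_eq_one, ← hι, mul_inv_cancel, hone]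
  have hιmem : ∀ {x}, x ∈ M → (ι x ∈ Γ ↔ x ∈ Γ) := by
    intro x hx
    obtain ⟨a, ha, b, hb, h⟩ := hM x hx
    rw [h, Γ.mul_mem_cancel_right hb, Γ.mul_mem_cancel_left ha]
  -- If `C = x y` with `x ∈ ΓgΓ` and `y ∈ ΓhΓ`, then `k₁ C k₂ = ι C = ι y · ι x`. So `C k₂ (ι x)⁻¹ =
  -- k₁⁻¹ ι y` is a first factor in `ΓhΓ`, with a second factor in `ΓgΓ`.
  let z : G ⧸ Γ → G := fun q => C.out * k₂ * (ι q.out)⁻¹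
  let ψ : (G ⧸ Γ) × (G ⧸ Γ) → (G ⧸ Γ) × (G ⧸ Γ) := fun q =>
    ((z q.1 : G), (((z q.1 : G) : G ⧸ Γ).out⁻¹ * C.out : G))
  have key : ∀ q ∈ (s ×ˢ t).filter fun q => C = ((q.1.out * q.2.out : G) : G ⧸ Γ),
      (∃ a ∈ Γ, ∃ b ∈ Γ, q.1.out = a * g * b) ∧ ∃ a ∈ Γ, ∃ b ∈ Γ, q.1.out⁻¹ * C.out = a * h * b := by
    intro q hq
    rw [Finset.mem_filter, Finset.mem_product, hs, ht] at hq
    obtain ⟨⟨hq1, hq2⟩, hqC⟩ := hq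
    rw [← Quotient.out_eq' q.1] at hq1
    rw [← Quotient.out_eq' q.2] at hq2
    refine ⟨mk_mem_orbit_iff.1 hq1, ?_⟩
    obtain ⟨a, ha, b, hb, h3⟩ := mk_mem_orbit_iff.1 hq2
    have h4 : q.2.out = a * h * b := h3
    obtain ⟨γ, hγ, h5⟩ := out_eq_mul hqC.symm
    exact ⟨a, ha, b * γ, mul_mem hb hγ, by rw [h5, h4]; group⟩
  have hmem : ∀ {g : G}, g ∈ M → ∀ {x : G}, (∃ a ∈ Γ, ∃ b ∈ Γ, x = a * g * b) →
      x ∈ M ∧ ∃ a ∈ Γ, ∃ b ∈ Γ, ι x = a * g * b := by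
    rintro g hg x ⟨a, ha, b, hb, rfl⟩
    have hx : a * g * b ∈ M := mul_mem (mul_mem (hΓ ha) hg) (hΓ hb)
    obtain ⟨a', ha', b', hb', h⟩ := hM _ hx
    exact ⟨hx, a' * a, mul_mem ha' ha, b * b', mul_mem hb hb', by rw [h]; group⟩
  refine Finset.card_le_card_of_injOn ψ ?_ ?_
  · intro q hq
    obtain ⟨hq1, hq2⟩ := key q hq
    obtain ⟨-, a, ha, b, hb, h3⟩ := hmem hg hq1
    obtain ⟨-, a', ha', b', hb', h4⟩ := hmem hh hq2
    obtain ⟨γ, hγ, h5⟩ := out_eq_mul (q := ((z q.1 : G) : G ⧸ Γ)) rfl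
    refine Finset.mem_coe.2 (Finset.mem_filter.2 ⟨Finset.mem_product.2
      ⟨(ht _).2 (mk_mem_orbit_iff.2 ⟨k₁⁻¹ * a', mul_mem (inv_mem h₁) ha', b', hb', ?_⟩),
        (hs _).2 (mk_mem_orbit_iff.2 ⟨γ⁻¹ * a, mul_mem (inv_mem hγ) ha, b * k₂⁻¹,
          mul_mem hb (inv_mem h₂), ?_⟩)⟩, ?_⟩)
    · rw [hι, hinv, hk] at h4
      simp only [z]
      rw [mul_assoc k₁⁻¹, mul_assoc k₁⁻¹, ← h4]
      group
    · rw [h5]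
      simp only [z]
      calc _ = γ⁻¹ * ι q.1.out * k₂⁻¹ := by group
        _ = _ := by rw [h3]; group
    · obtain ⟨δ, hδ, h6⟩ := out_eq_mul (q := (ψ q).2) rfl
      rw [h6]
      conv_lhs => rw [← Quotient.out_eq' C]
      refine QuotientGroup.eq.2 ?_
      simpa [ψ, mul_assoc] using hδ
  · intro q hq q' hq' hqq
    obtain ⟨hq1, hq2⟩ := key q hq
    obtain ⟨hq1', hq2'⟩ := key q' hq'
    have h3 := QuotientGroup.eq.1 (congrArg Prod.fst hqq)
    have h4 : q.1 = q'.1 := by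
      rw [← Quotient.out_eq' q.1, ← Quotient.out_eq' q'.1]
      refine (QuotientGroup.eq.2 ((hιmem (mul_mem (inv_mem (hmem hg hq1').1) (hmem hg hq1).1)).1 ?_)).symm
      rw [hι, hinv]
      simpa [z, mul_assoc] using h3
    refine Prod.ext h4 ?_
    rw [Finset.mem_coe, Finset.mem_filter] at hq hq'
    have h5 := hq.2.symm.trans hq'.2
    rw [h4, QuotientGroup.eq, mul_inv_rev, mul_assoc, inv_mul_cancel_left] at h5
    rw [← Quotient.out_eq' q.2, ← Quotient.out_eq' q'.2]
    exact QuotientGroup.eq.2 h5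

open Classical in
-- Applying the count in both orders shows that the two families of products are the same multiset
-- of cosets.
lemma sum_doubleCoset_comm (hΓ : Γ ≤ M) (hι : ∀ x y, ι (x * y) = ι y * ι x)
    (hM : ∀ x ∈ M, ∃ k₁ ∈ Γ, ∃ k₂ ∈ Γ, ι x = k₁ * x * k₂) {g h : G} (hg : g ∈ M) (hh : h ∈ M)
    {s t : Finset (G ⧸ Γ)} (hs : ∀ q, q ∈ s ↔ q ∈ MulAction.orbit Γ (g : G ⧸ Γ))
    (ht : ∀ q, q ∈ t ↔ q ∈ MulAction.orbit Γ (h : G ⧸ Γ)) {A : Type*} [AddCommMonoid A]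
    (f : G ⧸ Γ → A) :
    ∑ q ∈ s, ∑ r ∈ t, f ((q.out * r.out : G) : G ⧸ Γ) =
      ∑ r ∈ t, ∑ q ∈ s, f ((r.out * q.out : G) : G ⧸ Γ) := by
  rw [← Finset.sum_product', ← Finset.sum_product']
  have : (s ×ˢ t).val.map (fun q => ((q.1.out * q.2.out : G) : G ⧸ Γ)) =
      (t ×ˢ s).val.map (fun q => ((q.1.out * q.2.out : G) : G ⧸ Γ)) := by
    ext C
    rw [Multiset.count_map, Multiset.count_map]
    exact le_antisymm (card_fiber_le hΓ hι hM hg hh hs ht C)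
      (card_fiber_le hΓ hι hM hh hg ht hs C)
  have h2 := congrArg (fun m => (m.map f).sum) this
  simp only [Multiset.map_map] at h2
  exact h2

end GelfandTrick

/-- There is an anti-homomorphism which preserves all double cosets of `Γ`. -/
def HasGelfandInvolution {G : Type*} [Group G] (Γ : Subgroup G) : Prop :=
  ∃ ι : G → G, (∀ x y, ι (x * y) = ι y * ι x) ∧ ∀ x, ∃ k₁ ∈ Γ, ∃ k₂ ∈ Γ, ι x = k₁ * x * k₂

/-! ### Commutativity of the spherical Hecke algebra from local anti-involutions -/

section Global

open Filter Topology

variable {F K D : Type*} [Field F] [NumberField F] [Field K] [Algebra F K]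
  [Ring D] [Algebra F D] [Algebra K D] [FiniteDimensional F D] {c : K ≃ₐ[F] K}
  {σ : AntiInvolution D c} {p : ℕ} {Kt : TameLevel σ p} {O : Type*} [CommRing O] {I : Ideal O}
  {S : Finset (HeightOneSpectrum (𝓞 F))}

attribute [local instance] tensorTopology

/-- Openness of `K^p` is used here. It contains every prime-to-`p` point close enough to `1`, and
`y` becomes such a point once its components at a finite set of places are made trivial. -/
lemma finite_notMem_loc {y : GAf σ} (hy : y ∈ GAfp σ p) :
    {v : HeightOneSpectrum (𝓞 F) | ∃ h : ¬ Above p v, component σ v y ∉ Kt.loc ⟨v, h⟩}.Finite := by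
  obtain ⟨W, hW, hWK⟩ := isOpen_induced_iff.1 Kt.isOpen_toSubgroup
  have h1 : W ∈ 𝓝 (1 : GAf σ) := hW.mem_nhds (by
    have : (1 : GAfp σ p) ∈ (Kt.toSubgroup.subgroupOf (GAfp σ p) : Set (GAfp σ p)) := one_mem _
    rw [← hWK] at this
    exact this)
  rw [(U.isEmbedding_val (FiniteAdeleRing (𝓞 F) F) σ).nhds_eq_comap, U.val_one] at h1
  obtain ⟨V, hV, hVW⟩ := h1
  let A := FiniteAdeleRing (𝓞 F) F
  let m : (Fin (Module.finrank F D) → A) → A ⊗[F] D := fun a => 1 + (coordinates F D A).symm a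
  have hm : Continuous m := continuous_const.add (coordinates F D A).symm.continuous
  have hm0 : m ⁻¹' V ∈ 𝓝 0 := hm.continuousAt.preimage_mem_nhds (by simpa [m] using hV)
  rw [nhds_pi, Filter.mem_pi] at hm0
  obtain ⟨J, hJ, B, hB, hsub⟩ := hm0
  choose T hT using fun i => exists_finset_of_mem_nhds_zero (hB i)
  -- The places constrained by the neighbourhood of `1`, and those where `y - 1` is not integral.
  let bad : Set (HeightOneSpectrum (𝓞 F)) := (⋃ i, (T i : Set _)) ∪
    ⋃ i, {v | (coordinates F D A (U.val σ y - 1) i) v ∉ v.adicCompletionIntegers F}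
  have hbad : bad.Finite := (Set.finite_iUnion fun i => (T i).finite_toSet).union
    (Set.finite_iUnion fun i => eventually_mem_integers _)
  refine hbad.subset fun v hv => ?_
  by_contra hvb
  obtain ⟨hp, hv⟩ := hv
  apply hv
  have h2 : truncate σ badᶜ y ∈ Kt.toSubgroup := by
    have h3 : truncate σ badᶜ y ∈ GAfp σ p := (mem_GAfp σ p).2 fun w hw => by
      by_cases h : w ∈ badᶜ
      · rw [component_truncate_of_mem σ y h, (mem_GAfp σ p).1 hy w hw]
      · rw [component_truncate_of_notMem σ y h]
    have h4 : truncate σ badᶜ y ∈ W := by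
      apply hVW
      change U.val σ (truncate σ badᶜ y) ∈ V
      have h5 : U.val σ (truncate σ badᶜ y) =
          m (coordinates F D A (U.val σ (truncate σ badᶜ y) - 1)) := by simp [m]
      rw [h5]
      refine hsub fun i _ => ?_
      have hc : ∀ (w : HeightOneSpectrum (𝓞 F)) (x : GAf σ), (coordinates F D A (U.val σ x - 1) i) w =
          coordinates F D _ (U.val σ (component σ w x) - 1) i := by
        intro w x
        have := coordinates_map (F := F) (D := D) A (adeleEval w) (U.val σ x - 1) i
        rw [map_sub, map_one] at this
        exact this.symm
      have h0 : ∀ w, w ∈ bad → (coordinates F D A (U.val σ (truncate σ badᶜ y) - 1) i) w = 0 := by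
        intro w hw
        rw [hc, component_truncate_of_notMem σ y (by simpa using hw), U.val_one, sub_self, map_zero]
        rfl
      refine hT i _ (mem_integralAdeles.2 fun w => ?_) fun w hw => h0 w
        (Or.inl (Set.mem_iUnion.2 ⟨i, hw⟩))
      by_cases hw : w ∈ bad
      · rw [h0 w hw]
        exact zero_mem _
      · rw [hc, component_truncate_of_mem σ y hw, ← hc]
        by_contra h
        exact hw (Or.inr (Set.mem_iUnion.2 ⟨i, h⟩))
    have h5 : (⟨_, h3⟩ : GAfp σ p) ∈ (Kt.toSubgroup.subgroupOf (GAfp σ p) : Set (GAfp σ p)) := by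
      rw [← hWK]
      exact h4
    exact h5
  have h6 := ((Kt.mem_toSubgroup _).1 h2).2 ⟨v, hp⟩
  rwa [component_truncate_of_mem σ y hvb] at h6

/-- The local anti-involution is used only at the finite set `T` of places outside `S` where `g` or
`h` leaves `K_v`; elsewhere inversion serves. It preserves double cosets on the subgroup `M` of
points lying in `K_v` at the places prime to `p` outside `T`. -/
lemma exists_antihom (hloc : ∀ v : {v : HeightOneSpectrum (𝓞 F) // ¬ Above p v}, v.1 ∉ S →
    HasGelfandInvolution (Kt.loc v))
    {g h : GAfp σ p} (hg : ∀ v ∈ S, component σ v g = 1)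
    (hh : ∀ v ∈ S, component σ v h = 1) :
    ∃ (M : Subgroup (GAf σ)) (ι : GAf σ → GAf σ), Kt.toSubgroup ≤ M ∧ (g : GAf σ) ∈ M ∧
      (h : GAf σ) ∈ M ∧ (∀ x y, ι (x * y) = ι y * ι x) ∧
      ∀ x ∈ M, ∃ k₁ ∈ Kt.toSubgroup, ∃ k₂ ∈ Kt.toSubgroup, ι x = k₁ * x * k₂ := by
  classical
  let T : Set (HeightOneSpectrum (𝓞 F)) :=
    {v | v ∉ S ∧ ∃ hv : ¬ Above p v, component σ v g ∉ Kt.loc ⟨v, hv⟩} ∪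
    {v | v ∉ S ∧ ∃ hv : ¬ Above p v, component σ v h ∉ Kt.loc ⟨v, hv⟩}
  have hT : T.Finite := ((finite_notMem_loc g.2).subset fun v hv => hv.2).union
    ((finite_notMem_loc h.2).subset fun v hv => hv.2)
  have hTS : ∀ v ∈ T, v ∉ S ∧ ¬ Above p v := by
    rintro v (⟨h1, h2, -⟩ | ⟨h1, h2, -⟩) <;> exact ⟨h1, h2⟩
  let ιl : ∀ v, ULoc σ v → ULoc σ v := fun v =>
    if hv : v ∈ T then (hloc ⟨v, (hTS v hv).2⟩ (hTS v hv).1).choose else fun x => x⁻¹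
  have hιT : ∀ v (hv : v ∈ T), ιl v = (hloc ⟨v, (hTS v hv).2⟩ (hTS v hv).1).choose :=
    fun v hv => dif_pos hv
  have hιT' : ∀ v, v ∉ T → ιl v = fun x => x⁻¹ := fun v hv => dif_neg hv
  have hev : ∀ᶠ v in cofinite, v ∉ T := hT.eventually_cofinite_notMem
  choose ι hι using fun y => exists_glue σ (fun v => ιl v (component σ v y)) y⁻¹ 1
    (hev.mono fun v hv => Or.inl (by rw [hιT' v hv, map_inv]))
  let M : Subgroup (GAf σ) := GAfp σ p ⊓
    ⨅ v : {v : {v : HeightOneSpectrum (𝓞 F) // ¬ Above p v} // v.1 ∉ T},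
      (Kt.loc v.1).comap (component σ v.1.1)
  have hM : ∀ x, x ∈ M ↔ x ∈ GAfp σ p ∧ ∀ (v : {v // ¬ Above p v}), v.1 ∉ T →
      component σ v.1 x ∈ Kt.loc v := fun x => by
    simp only [M, Subgroup.mem_inf, Subgroup.mem_iInf, Subgroup.mem_comap]
    exact and_congr_right fun _ => ⟨fun h v hv => h ⟨v, hv⟩, fun h v => h v.1 v.2⟩
  refine ⟨M, ι, fun x hx => ?_, (hM _).2 ⟨g.2, fun v hv => ?_⟩, (hM _).2 ⟨h.2, fun v hv => ?_⟩,
    fun x y => GAf_ext σ fun v => ?_, fun x hx => ?_⟩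
  · obtain ⟨h1, h2⟩ := (Kt.mem_toSubgroup x).1 hx
    exact (hM x).2 ⟨h1, fun v _ => h2 v⟩
  · by_cases hvS : v.1 ∈ S
    · rw [hg _ hvS]
      exact one_mem _
    · by_contra hn
      exact hv (Or.inl ⟨hvS, v.2, hn⟩)
  · by_cases hvS : v.1 ∈ S
    · rw [hh _ hvS]
      exact one_mem _
    · by_contra hn
      exact hv (Or.inr ⟨hvS, v.2, hn⟩)
  · simp only [map_mul, hι]
    by_cases hv : v ∈ T
    · rw [hιT v hv]
      exact (hloc ⟨v, (hTS v hv).2⟩ (hTS v hv).1).choose_spec.1 _ _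
    · rw [hιT' v hv]
      exact mul_inv_rev _ _
  · obtain ⟨hxp, hxM⟩ := (hM x).1 hx
    -- Outside `T` the left factor is `x⁻²`, from `x⁻¹ = x⁻² · x`. It comes from one adelic point,
    -- so the local factors glue.
    have hl : ∀ v, ∃ k₁ k₂ : ULoc σ v, ιl v (component σ v x) = k₁ * component σ v x * k₂ ∧
        (Above p v → k₁ = 1 ∧ k₂ = 1) ∧ (∀ hv : ¬ Above p v, k₁ ∈ Kt.loc ⟨v, hv⟩ ∧ k₂ ∈ Kt.loc ⟨v, hv⟩) ∧
        (v ∉ T → k₁ = component σ v (x⁻¹ * x⁻¹) ∧ k₂ = 1) := by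
      intro v
      by_cases hv : v ∈ T
      · obtain ⟨k₁, h₁, k₂, h₂, hk⟩ :=
          (hloc ⟨v, (hTS v hv).2⟩ (hTS v hv).1).choose_spec.2 (component σ v x)
        exact ⟨k₁, k₂, by rw [hιT v hv]; exact hk, fun h => absurd h (hTS v hv).2, fun _ => ⟨h₁, h₂⟩,
          fun h => absurd hv h⟩
      · refine ⟨_, _, ?_, fun h => ?_, fun h => ⟨?_, (Kt.loc ⟨v, h⟩).one_mem⟩,
          fun _ => ⟨rfl, rfl⟩⟩
        · rw [hιT' v hv]
          simp
        · simp [(mem_GAfp σ p).1 hxp v h]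
        · rw [map_mul, map_inv]
          have := inv_mem (hxM ⟨v, h⟩ hv)
          exact mul_mem this this
    choose k₁ k₂ hk hk1 hk2 hk3 using hl
    obtain ⟨a, ha⟩ := exists_glue σ k₁ (x⁻¹ * x⁻¹) 1 (hev.mono fun v hv => Or.inl (hk3 v hv).1)
    obtain ⟨b, hb⟩ := exists_glue σ k₂ 1 1 (hev.mono fun v hv =>
      Or.inl ((hk3 v hv).2.trans (map_one _).symm))
    refine ⟨a, (Kt.mem_toSubgroup a).2 ⟨(mem_GAfp σ p).2 fun v hv => ?_, fun v => ?_⟩,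
      b, (Kt.mem_toSubgroup b).2 ⟨(mem_GAfp σ p).2 fun v hv => ?_, fun v => ?_⟩,
      GAf_ext σ fun v => ?_⟩
    · rw [ha, (hk1 v hv).1]
    · rw [ha]
      exact (hk2 v.1 v.2).1
    · rw [hb, (hk1 v hv).2]
    · rw [hb]
      exact (hk2 v.1 v.2).2
    · rw [hι, map_mul, map_mul, ha, hb]
      exact hk v

lemma heckeOperator_comm (hloc : ∀ v : {v : HeightOneSpectrum (𝓞 F) // ¬ Above p v}, v.1 ∉ S →
    HasGelfandInvolution (Kt.loc v))
    {g h : GAfp σ p} (hg : ∀ v ∈ S, component σ v g = 1)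
    (hh : ∀ v ∈ S, component σ v h = 1) :
    heckeOperator Kt O I g * heckeOperator Kt O I h =
      heckeOperator Kt O I h * heckeOperator Kt O I g := by
  obtain ⟨M, ι, hΓ, hgM, hhM, hι, hM⟩ := exists_antihom hloc hg hh
  refine LinearMap.ext fun f => CompletedH0.ext_reduce fun s => H0.ext fun x => ?_
  change H0.fn (H0.hecke Kt O _ g (H0.hecke Kt O _ h (CompletedH0.reduce s f))) x =
    H0.fn (H0.hecke Kt O _ h (H0.hecke Kt O _ g (CompletedH0.reduce s f))) x
  simp only [H0.hecke_fn]
  let φ : GAf σ ⧸ Kt.toSubgroup → O ⧸ I ^ s := fun q => H0.fn (CompletedH0.reduce s f) (x * q.out)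
  have hφ : ∀ y z : GAf σ, H0.fn (CompletedH0.reduce s f) (x * y * z) =
      φ ((y * z : GAf σ) : GAf σ ⧸ Kt.toSubgroup) := fun y z => by
    rw [mul_assoc]
    exact H0.fn_eq_of_coset _ _ _ _ _ (Quotient.out_eq' _).symm
  simp only [hφ]
  exact sum_doubleCoset_comm hΓ hι hM hgM hhM (fun q => Set.Finite.mem_toFinset _)
    (fun q => Set.Finite.mem_toFinset _) φ

lemma sphericalImage_comm (hloc : ∀ v : {v : HeightOneSpectrum (𝓞 F) // ¬ Above p v}, v.1 ∉ S →
    HasGelfandInvolution (Kt.loc v)) :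
    ∀ a ∈ sphericalImage Kt O I S, ∀ b ∈ sphericalImage Kt O I S,
    a * b = b * a := by
  intro a ha b hb
  have hcomm : ∀ a ∈ {T | ∃ g : GAfp σ p, (∀ v ∈ S, component σ v g = 1) ∧ T = heckeOperator Kt O I g},
      ∀ b ∈ {T | ∃ g : GAfp σ p, (∀ v ∈ S, component σ v g = 1) ∧ T = heckeOperator Kt O I g},
      a * b = b * a := by
    rintro _ ⟨g, hg, rfl⟩ _ ⟨h, hh, rfl⟩
    exact heckeOperator_comm hloc hg hh
  have := Algebra.isMulCommutative_adjoin O hcomm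
  exact congrArg Subtype.val (this.is_comm.comm (⟨a, ha⟩ : Algebra.adjoin O _) ⟨b, hb⟩)

end Global

end DefiniteUnitary
end

noncomputable section

namespace DefiniteUnitary

/-! ### Hermitian matrices and pairs of unimodular lattices -/

section Hermitian

open Matrix

variable {E : Type*} [CommRing E]

/-- The entries of `M` lie in the subring `O`. -/
def IntegralEntries (O : Subring E) {ι κ : Type*} (M : Matrix ι κ E) : Prop := ∀ i j, M i j ∈ O

section IntegralEntries

variable {O : Subring E} {ι κ μ ν : Type*}

lemma IntegralEntries.mul [Fintype κ] {M : Matrix ι κ E} {N : Matrix κ μ E} (hM : IntegralEntries O M)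
    (hN : IntegralEntries O N) : IntegralEntries O (M * N) := fun i j =>
  sum_mem fun l _ => mul_mem (hM i l) (hN l j)

lemma IntegralEntries.neg {M : Matrix ι κ E} (hM : IntegralEntries O M) :
    IntegralEntries O (-M) := fun i j => neg_mem (hM i j)

lemma IntegralEntries.transpose {M : Matrix ι κ E} (hM : IntegralEntries O M) :
    IntegralEntries O Mᵀ := fun i j => hM j i

lemma IntegralEntries.map {M : Matrix ι κ E} (hM : IntegralEntries O M) {f : E →+* E}
    (hf : ∀ x ∈ O, f x ∈ O) : IntegralEntries O (M.map f) := fun i j => hf _ (hM i j)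

lemma IntegralEntries.one [DecidableEq ι] : IntegralEntries O (1 : Matrix ι ι E) := fun i j => by
  rw [one_apply]
  split_ifs
  exacts [one_mem _, zero_mem _]

lemma IntegralEntries.zero : IntegralEntries O (0 : Matrix ι κ E) := fun _ _ => zero_mem _

lemma IntegralEntries.fromBlocks {A : Matrix ι κ E} {B : Matrix ι μ E} {C : Matrix ν κ E}
    {D : Matrix ν μ E} (hA : IntegralEntries O A) (hB : IntegralEntries O B)
    (hC : IntegralEntries O C) (hD : IntegralEntries O D) :
    IntegralEntries O (Matrix.fromBlocks A B C D) := by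
  rintro (i | i) (j | j)
  exacts [hA i j, hB i j, hC i j, hD i j]

end IntegralEntries

/-- `O` is a discrete valuation ring of `E` with uniformizer `ϖ`. -/
structure IsUniformizer (O : Subring E) (ϖ : Eˣ) : Prop where
  uniformizer_mem : (ϖ : E) ∈ O
  inv_notMem : ((ϖ⁻¹ : Eˣ) : E) ∉ O
  exists_eq_zpow_mul : ∀ x : E, x ≠ 0 → ∃ (k : ℤ) (u : Eˣ), (u : E) ∈ O ∧ (↑u⁻¹ : E) ∈ O ∧
    x = ↑(ϖ ^ k) * u

/-- A discrete valuation ring with an unramified involution, for which Hensel's lemma holds. -/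
structure IsInert (bar : E →+* E) (O : Subring E) (ϖ : Eˣ) : Prop extends IsUniformizer O ϖ where
  bar_bar : ∀ x, bar (bar x) = x
  bar_mem : ∀ x ∈ O, bar x ∈ O
  bar_uniformizer : bar ϖ = ϖ
  exists_trace_eq_one : ∃ t ∈ O, t + bar t = 1
  exists_root : ∀ c ∈ O, ∀ δ ∈ O, bar c = c → bar δ = δ →
    ∃ y ∈ O, bar y = y ∧ y + ϖ * c * y ^ 2 + δ = 0

/-- The diagonal matrix with entries `ϖ ^ a i`. -/
def powDiag (ϖ : Eˣ) {ι : Type*} [DecidableEq ι] (a : ι → ℤ) : Matrix ι ι E :=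
  diagonal fun i => ((ϖ ^ a i : Eˣ) : E)

variable {bar : E →+* E} {O : Subring E} {ϖ : Eˣ}
  {ι κ μ : Type*} [Fintype ι] [DecidableEq ι] [Fintype κ] [DecidableEq κ] [Fintype μ] [DecidableEq μ]

lemma powDiag_mul_neg (a : ι → ℤ) : powDiag ϖ a * powDiag ϖ (-a) = 1 := by
  rw [powDiag, powDiag, diagonal_mul_diagonal, ← diagonal_one]
  congr 1
  ext i
  rw [← Units.val_mul, ← _root_.zpow_add]
  simp

lemma powDiag_neg_mul (a : ι → ℤ) : powDiag ϖ (-a) * powDiag ϖ a = 1 := by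
  simpa using powDiag_mul_neg (ϖ := ϖ) (-a)

lemma powDiag_neg_mul_cancel (a : ι → ℤ) (X : Matrix ι κ E) :
    powDiag ϖ (-a) * (powDiag ϖ a * X) = X := by
  rw [← Matrix.mul_assoc, powDiag_neg_mul, Matrix.one_mul]

lemma powDiag_mul_neg_cancel (a : ι → ℤ) (X : Matrix ι κ E) :
    powDiag ϖ a * (powDiag ϖ (-a) * X) = X := by
  rw [← Matrix.mul_assoc, powDiag_mul_neg, Matrix.one_mul]

lemma transpose_powDiag (a : ι → ℤ) : (powDiag ϖ a)ᵀ = powDiag ϖ a := diagonal_transpose _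

lemma powDiag_sumElim (a : ι → ℤ) (b : κ → ℤ) :
    powDiag ϖ (Sum.elim a b) = fromBlocks (powDiag ϖ a) 0 0 (powDiag ϖ b) := by
  rw [powDiag, powDiag, powDiag, fromBlocks_diagonal]
  congr 1
  ext (i | i) <;> rfl

lemma powDiag_neg_sumElim (a : ι → ℤ) (b : κ → ℤ) :
    powDiag ϖ (-Sum.elim a b) = fromBlocks (powDiag ϖ (-a)) 0 0 (powDiag ϖ (-b)) := by
  rw [← powDiag_sumElim]
  congr 1
  ext (i | i) <;> rfl

lemma IsInert.map_zpow (h : IsInert bar O ϖ) (k : ℤ) :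
    bar ((ϖ ^ k : Eˣ) : E) = ((ϖ ^ k : Eˣ) : E) := by
  have h1 : Units.map (bar : E →* E) ϖ = ϖ := Units.ext h.bar_uniformizer
  have h2 := congrArg (fun u : Eˣ => (u : E)) (_root_.map_zpow (Units.map (bar : E →* E)) ϖ k)
  rw [h1] at h2
  exact h2

lemma IsInert.map_powDiag (h : IsInert bar O ϖ) (a : ι → ℤ) :
    (powDiag ϖ a).map bar = powDiag ϖ a := by
  rw [powDiag, diagonal_map (map_zero _)]
  congr 1
  ext i
  exact h.map_zpow _

lemma IsUniformizer.zpow_mem (h : IsUniformizer O ϖ) {k : ℤ} (hk : 0 ≤ k) : ((ϖ ^ k : Eˣ) : E) ∈ O := by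
  obtain ⟨m, rfl⟩ := Int.eq_ofNat_of_zero_le hk
  rw [zpow_natCast, Units.val_pow_eq_pow_val]
  exact pow_mem h.uniformizer_mem m

lemma IsUniformizer.nonneg_of_zpow_mem (h : IsUniformizer O ϖ) {k : ℤ} (hk : ((ϖ ^ k : Eˣ) : E) ∈ O) :
    0 ≤ k := by
  by_contra hneg
  apply h.inv_notMem
  have := mul_mem hk (h.zpow_mem (k := -1 - k) (by omega))
  rwa [← Units.val_mul, ← _root_.zpow_add, show k + (-1 - k) = -1 by ring, _root_.zpow_neg_one] at this

lemma IsInert.map_map (h : IsInert bar O ϖ) (M : Matrix ι κ E) : (M.map bar).map bar = M := by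
  ext i j
  exact h.bar_bar _

variable (bar O ϖ) in
/-- A Hermitian matrix which is unimodular for the two lattices related by `powDiag ϖ a`. -/
structure IsUnimodular (a : ι → ℤ) (H : Matrix ι ι E) : Prop where
  hermitian : H.map bar = Hᵀ
  integral : IntegralEntries O H
  integral' : IntegralEntries O (powDiag ϖ a * H * powDiag ϖ a)
  exists_inverse : ∃ G, H * G = 1 ∧ IntegralEntries O G ∧
    IntegralEntries O (powDiag ϖ (-a) * G * powDiag ϖ (-a))

variable (bar O ϖ) in
/-- There is an isometry of the Hermitian form with its conjugate which interchanges the two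
lattices. -/
def HasSwap (a : ι → ℤ) (H : Matrix ι ι E) : Prop :=
  ∃ A : Matrix ι ι E, Aᵀ * H * A.map bar = H.map bar ∧ IntegralEntries O (powDiag ϖ (-a) * A) ∧
    IntegralEntries O (A * powDiag ϖ a)

variable {a : ι → ℤ} {H k k' : Matrix ι ι E}

/-- The hypotheses say that `k` is a change of basis preserving both `O^n` and `ϖ^a O^n`. -/
lemma IsUnimodular.baseChange (h : IsInert bar O ϖ) (hH : IsUnimodular bar O ϖ a H)
    (hkk' : k * k' = 1) (hk : IntegralEntries O k)
    (hk' : IntegralEntries O k') (hk1 : IntegralEntries O (powDiag ϖ (-a) * k * powDiag ϖ a))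
    (hk1' : IntegralEntries O (powDiag ϖ (-a) * k' * powDiag ϖ a)) :
    IsUnimodular bar O ϖ a (kᵀ * H * k.map bar) := by
  obtain ⟨h1, h2, h3, G, h4, h5, h6⟩ := hH
  have hb := h.bar_mem
  refine ⟨?_, (hk.transpose.mul h2).mul (hk.map hb), ?_, k'.map bar * G * k'ᵀ, ?_,
    ((hk'.map hb).mul h5).mul hk'.transpose, ?_⟩
  · simp only [Matrix.map_mul, transpose_mul, h.map_map, transpose_map, h1, transpose_transpose,
      Matrix.mul_assoc]
  · have := (hk1.transpose.mul h3).mul (hk1.map hb)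
    simpa only [Matrix.map_mul, transpose_mul, h.map_powDiag, transpose_powDiag, Matrix.mul_assoc,
      powDiag_neg_mul_cancel, powDiag_mul_neg_cancel] using this
  · have e1 : k.map bar * k'.map bar = 1 := by rw [← Matrix.map_mul, hkk']; simp
    have e2 : kᵀ * k'ᵀ = 1 := by rw [← transpose_mul, mul_eq_one_comm.1 hkk', transpose_one]
    calc kᵀ * H * k.map bar * (k'.map bar * G * k'ᵀ)
        = kᵀ * (H * (k.map bar * k'.map bar) * G) * k'ᵀ := by simp only [Matrix.mul_assoc]
      _ = 1 := by rw [e1, Matrix.mul_one, h4, Matrix.mul_one, e2]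
  · have := ((hk1'.map hb).mul h6).mul hk1'.transpose
    simpa only [Matrix.map_mul, transpose_mul, h.map_powDiag, transpose_powDiag, Matrix.mul_assoc,
      powDiag_neg_mul_cancel, powDiag_mul_neg_cancel] using this

lemma HasSwap.of_baseChange (h : IsInert bar O ϖ) (hH : HasSwap bar O ϖ a (kᵀ * H * k.map bar))
    (hkk' : k * k' = 1) (hk : IntegralEntries O k)
    (hk' : IntegralEntries O k') (hk1 : IntegralEntries O (powDiag ϖ (-a) * k * powDiag ϖ a))
    (hk1' : IntegralEntries O (powDiag ϖ (-a) * k' * powDiag ϖ a)) :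
    HasSwap bar O ϖ a H := by
  obtain ⟨A, h1, h2, h3⟩ := hH
  have hb := h.bar_mem
  have e1 : k.map bar * k'.map bar = 1 := by rw [← Matrix.map_mul, hkk']; simp
  have e2 : (k'.map bar)ᵀ * (k.map bar)ᵀ = 1 := by rw [← transpose_mul, e1, transpose_one]
  refine ⟨k * A * k'.map bar, ?_, ?_, ?_⟩
  · calc _ = (k'.map bar)ᵀ * (Aᵀ * (kᵀ * H * k.map bar) * A.map bar) * k' := by
          simp only [Matrix.map_mul, transpose_mul, h.map_map, Matrix.mul_assoc]
      _ = ((k'.map bar)ᵀ * (k.map bar)ᵀ) * H.map bar * (k * k') := by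
          rw [h1]
          simp only [Matrix.map_mul, transpose_map, h.map_map, Matrix.mul_assoc]
      _ = H.map bar := by rw [e2, hkk', Matrix.one_mul, Matrix.mul_one]
  · have := (hk1.mul h2).mul (hk'.map hb)
    simpa only [Matrix.mul_assoc, powDiag_neg_mul_cancel, powDiag_mul_neg_cancel] using this
  · have := (hk.mul h3).mul (hk1'.map hb)
    simpa only [Matrix.map_mul, h.map_powDiag, Matrix.mul_assoc, powDiag_neg_mul_cancel,
      powDiag_mul_neg_cancel] using this

lemma HasSwap.fromBlocks {b : κ → ℤ} {H' : Matrix κ κ E} (hH : HasSwap bar O ϖ a H)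
    (hH' : HasSwap bar O ϖ b H') :
    HasSwap bar O ϖ (Sum.elim a b) (Matrix.fromBlocks H 0 0 H') := by
  obtain ⟨A, h1, h2, h3⟩ := hH
  obtain ⟨A', h1', h2', h3'⟩ := hH'
  refine ⟨Matrix.fromBlocks A 0 0 A', ?_, ?_, ?_⟩
  · simp [fromBlocks_transpose, fromBlocks_map, fromBlocks_multiply, h1, h1']
  · rw [powDiag_neg_sumElim, fromBlocks_multiply]
    simpa using h2.fromBlocks IntegralEntries.zero IntegralEntries.zero h2'
  · rw [powDiag_sumElim, fromBlocks_multiply]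
    simpa using h3.fromBlocks IntegralEntries.zero IntegralEntries.zero h3'

lemma powDiag_submatrix (e : κ ≃ ι) : (powDiag ϖ a).submatrix e e = powDiag ϖ (a ∘ e) :=
  submatrix_diagonal_equiv _ _

lemma powDiag_neg_submatrix (e : κ ≃ ι) : (powDiag ϖ (-a)).submatrix e e = powDiag ϖ (-(a ∘ e)) :=
  submatrix_diagonal_equiv _ _

lemma IntegralEntries.submatrix {M : Matrix ι ι E} (hM : IntegralEntries O M) (e f : κ → ι) :
    IntegralEntries O (M.submatrix e f) := fun _ _ => hM _ _

lemma IsUnimodular.submatrix (hH : IsUnimodular bar O ϖ a H) (e : κ ≃ ι) :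
    IsUnimodular bar O ϖ (a ∘ e) (H.submatrix e e) := by
  obtain ⟨h1, h2, h3, G, h4, h5, h6⟩ := hH
  refine ⟨?_, h2.submatrix e e, ?_, G.submatrix e e, ?_, h5.submatrix e e, ?_⟩
  · rw [← submatrix_map, h1, transpose_submatrix]
  · rw [← powDiag_submatrix e, submatrix_mul_equiv, submatrix_mul_equiv]
    exact h3.submatrix e e
  · rw [submatrix_mul_equiv, h4, submatrix_one_equiv]
  · rw [← powDiag_neg_submatrix e, submatrix_mul_equiv, submatrix_mul_equiv]
    exact h6.submatrix e e

lemma HasSwap.of_submatrix (e : κ ≃ ι) (hH : HasSwap bar O ϖ (a ∘ e) (H.submatrix e e)) :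
    HasSwap bar O ϖ a H := by
  obtain ⟨A, h1, h2, h3⟩ := hH
  have ha : (a ∘ e) ∘ e.symm = a := by ext; simp
  refine ⟨A.submatrix e.symm e.symm, ?_, ?_, ?_⟩
  · have := congrArg (fun M => M.submatrix e.symm e.symm) h1
    simpa [← submatrix_mul_equiv _ _ _ e.symm _, submatrix_map] using this
  · have := h2.submatrix e.symm e.symm
    rwa [← submatrix_mul_equiv _ _ _ e.symm, powDiag_neg_submatrix, ha] at this
  · have := h3.submatrix e.symm e.symm
    rwa [← submatrix_mul_equiv _ _ _ e.symm, powDiag_submatrix, ha] at this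

end Hermitian

end DefiniteUnitary
end

noncomputable section

namespace DefiniteUnitary

/-! ### Splitting off lines and planes -/

section HermitianInduction

open Matrix

variable {E : Type*} [CommRing E] {bar : E →+* E} {O : Subring E} {ϖ : Eˣ}
  {ι κ μ : Type*} [Fintype ι] [DecidableEq ι] [Fintype κ] [DecidableEq κ] [Fintype μ] [DecidableEq μ]

/-- Splitting off a unimodular summand. -/
lemma HasSwap.of_summand (h : IsInert bar O ϖ) {a : κ → ℤ} {b : μ → ℤ} {P : Matrix κ κ E}
    {Q : Matrix κ μ E} {R : Matrix μ κ E} {T : Matrix μ μ E}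
    (hH : IsUnimodular bar O ϖ (Sum.elim a b) (Matrix.fromBlocks P Q R T)) (hP : IsUnimodular bar O ϖ a P)
    (hPs : HasSwap bar O ϖ a P)
    (ih : ∀ S, IsUnimodular bar O ϖ b S → HasSwap bar O ϖ b S) :
    HasSwap bar O ϖ (Sum.elim a b) (Matrix.fromBlocks P Q R T) := by
  obtain ⟨h1, h2, h3, -⟩ := id hH
  obtain ⟨p1, p2, p3, G, p4, p5, p6⟩ := hP
  have p4' := mul_eq_one_comm.1 p4
  rw [fromBlocks_map, fromBlocks_transpose, fromBlocks_inj] at h1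
  obtain ⟨-, hQ, hR, hT⟩ := h1
  have hGb : G.map bar = Gᵀ := by
    have e1 : (G.map bar) * (P.map bar) = 1 := by rw [← Matrix.map_mul, p4']; simp
    have e2 : P.map bar * Gᵀ = 1 := by rw [p1, ← transpose_mul, p4', transpose_one]
    calc G.map bar = G.map bar * (P.map bar * Gᵀ) := by rw [e2, Matrix.mul_one]
      _ = Gᵀ := by rw [← Matrix.mul_assoc, e1, Matrix.one_mul]
  -- `X` is the projection to the summand. It is integral for both lattices, so subtracting it is an
  -- admissible base change; the complement then has the Gram matrix `T - R G Q`.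
  let X : Matrix κ μ E := (R * G)ᵀ
  have hXb : X.map bar = G * Q := by
    rw [show X = Gᵀ * Rᵀ from transpose_mul _ _, Matrix.map_mul, ← hGb, h.map_map, ← hQ, h.map_map]
  have hXt : Xᵀ = R * G := transpose_transpose _
  have hRi : IntegralEntries O R := fun i j => h2 (Sum.inr i) (Sum.inl j)
  have hX : IntegralEntries O X := (hRi.mul p5).transpose
  rw [powDiag_sumElim, fromBlocks_multiply, fromBlocks_multiply] at h3
  have hR' : IntegralEntries O (powDiag ϖ b * R * powDiag ϖ a) := fun i j => by
    simpa using h3 (Sum.inr i) (Sum.inl j)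
  have hX' : IntegralEntries O (powDiag ϖ (-a) * X * powDiag ϖ b) := by
    have := (hR'.mul p6).transpose
    simpa only [X, transpose_mul, transpose_powDiag, Matrix.mul_assoc, powDiag_mul_neg_cancel,
      powDiag_neg_mul_cancel] using this
  let k : Matrix (κ ⊕ μ) (κ ⊕ μ) E := Matrix.fromBlocks 1 (-X) 0 1
  let k' : Matrix (κ ⊕ μ) (κ ⊕ μ) E := Matrix.fromBlocks 1 X 0 1
  have hkk' : k * k' = 1 := by simp [k, k', fromBlocks_multiply, fromBlocks_one]
  have hk : IntegralEntries O k := IntegralEntries.one.fromBlocks hX.neg IntegralEntries.zero IntegralEntries.one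
  have hk' : IntegralEntries O k' := IntegralEntries.one.fromBlocks hX IntegralEntries.zero IntegralEntries.one
  have hk1 : IntegralEntries O (powDiag ϖ (-Sum.elim a b) * k * powDiag ϖ (Sum.elim a b)) := by
    rw [powDiag_sumElim, powDiag_neg_sumElim, fromBlocks_multiply, fromBlocks_multiply]
    simpa [powDiag_neg_mul] using IntegralEntries.one.fromBlocks hX'.neg IntegralEntries.zero IntegralEntries.one
  have hk1' : IntegralEntries O (powDiag ϖ (-Sum.elim a b) * k' * powDiag ϖ (Sum.elim a b)) := by
    rw [powDiag_sumElim, powDiag_neg_sumElim, fromBlocks_multiply, fromBlocks_multiply]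
    simpa [powDiag_neg_mul] using IntegralEntries.one.fromBlocks hX' IntegralEntries.zero IntegralEntries.one
  have hblock : kᵀ * Matrix.fromBlocks P Q R T * k.map bar = Matrix.fromBlocks P 0 0 (T - R * G * Q) := by
    have e1 : (-X).map bar = -(G * Q) := by
      rw [← hXb]
      ext i j
      simp
    have e2 : P * (G * Q) = Q := by rw [← Matrix.mul_assoc, p4, Matrix.one_mul]
    have e3 : R * G * P = R := by rw [Matrix.mul_assoc, p4', Matrix.mul_one]
    simp only [k, fromBlocks_transpose, fromBlocks_map, fromBlocks_multiply, e1, transpose_neg, hXt]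
    simp [e2, e3]
    abel
  have hU := hH.baseChange h hkk' hk hk' hk1 hk1'
  refine HasSwap.of_baseChange h ?_ hkk' hk hk' hk1 hk1'
  rw [hblock] at hU ⊢
  refine hPs.fromBlocks (ih _ ?_)
  obtain ⟨u1, u2, u3, G', u4, u5, u6⟩ := hU
  rw [fromBlocks_map, fromBlocks_transpose, fromBlocks_inj] at u1
  rw [powDiag_sumElim, fromBlocks_multiply, fromBlocks_multiply] at u3
  obtain ⟨G₁, G₂, G₃, G₄, rfl⟩ : ∃ A B C D, G' = Matrix.fromBlocks A B C D :=
    ⟨_, _, _, _, (fromBlocks_toBlocks G').symm⟩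
  rw [powDiag_neg_sumElim, fromBlocks_multiply, fromBlocks_multiply] at u6
  rw [fromBlocks_multiply, ← fromBlocks_one, fromBlocks_inj] at u4
  refine ⟨u1.2.2.2, fun i j => u2 (Sum.inr i) (Sum.inr j), fun i j => ?_, G₄, ?_,
    fun i j => u5 (Sum.inr i) (Sum.inr j), fun i j => ?_⟩
  · simpa using u3 (Sum.inr i) (Sum.inr j)
  · simpa using u4.2.2.2
  · simpa using u6 (Sum.inr i) (Sum.inr j)

/-- On a line with exponent `0` the two lattices coincide, and the identity is a swap. -/
lemma isUnimodular_unit {a : Unit → ℤ} {P : Matrix Unit Unit E} {v : E}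
    (ha : a () = 0) (hP : P () () ∈ O) (hbar : bar (P () ()) = P () ()) (hv : v ∈ O) (hPv : P () () * v = 1) :
    IsUnimodular bar O ϖ a P ∧ HasSwap bar O ϖ a P := by
  have h1 : powDiag ϖ a = 1 := by
    ext ⟨⟩ ⟨⟩
    simp [powDiag, ha]
  have h1' : powDiag ϖ (-a) = 1 := by
    ext ⟨⟩ ⟨⟩
    simp [powDiag, ha]
  have hint : IntegralEntries O P := fun _ _ => hP
  refine ⟨⟨?_, hint, by simpa [h1] using hint, of fun _ _ => v, ?_, fun _ _ => hv, ?_⟩, 1, ?_, ?_, ?_⟩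
  · ext ⟨⟩ ⟨⟩
    exact hbar
  · ext ⟨⟩ ⟨⟩
    simpa [mul_apply] using hPv
  · rw [h1', Matrix.one_mul, Matrix.mul_one]
    exact fun _ _ => hv
  · ext ⟨⟩ ⟨⟩
    simp [hbar]
  · rw [h1', Matrix.one_mul]
    exact IntegralEntries.one
  · rw [h1, Matrix.one_mul]
    exact IntegralEntries.one

lemma IsUniformizer.exists_eq_mul (h : IsUniformizer O ϖ) {x : E} (hx : x ∈ O)
    (hxu : ¬ ∃ y ∈ O, x * y = 1) : ∃ y ∈ O, x = ϖ * y := by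
  by_cases h0 : x = 0
  · exact ⟨0, zero_mem _, by rw [h0, mul_zero]⟩
  obtain ⟨k, u, hu, hu', rfl⟩ := h.exists_eq_zpow_mul x h0
  have hk : 0 ≤ k := by
    refine h.nonneg_of_zpow_mem ?_
    simpa using mul_mem hx hu'
  have hk0 : k ≠ 0 := by
    rintro rfl
    exact hxu ⟨_, hu', by simp⟩
  refine ⟨((ϖ ^ (k - 1) : Eˣ) : E) * u, mul_mem (h.zpow_mem (by omega)) hu, ?_⟩
  rw [← mul_assoc, ← Units.val_mul ϖ, ← _root_.zpow_one_add, add_sub_cancel]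

lemma IsUniformizer.isUnit_one_sub (h : IsUniformizer O ϖ) {x : E} (hx : x ∈ O) :
    ∃ y ∈ O, (1 - ϖ * x) * y = 1 := by
  by_contra hc
  obtain ⟨y, hy, he⟩ := h.exists_eq_mul (sub_mem (one_mem _) (mul_mem h.uniformizer_mem hx)) hc
  apply h.inv_notMem
  have : ((ϖ⁻¹ : Eˣ) : E) = x + y := by
    have h1 : (1 : E) = ϖ * (x + y) := by linear_combination he
    rw [← mul_one ((ϖ⁻¹ : Eˣ) : E), h1, Units.inv_mul_cancel_left]
  rw [this]
  exact add_mem hx hy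

lemma powDiag_fin_two (m m' : ℤ) : powDiag ϖ ![m, m'] = !![((ϖ ^ m : Eˣ) : E), 0; 0, ((ϖ ^ m' : Eˣ) : E)] := by
  ext i j
  fin_cases i <;> fin_cases j <;> simp [powDiag]

lemma integralEntries_fin_two {w x y z : E} (hw : w ∈ O) (hx : x ∈ O) (hy : y ∈ O) (hz : z ∈ O) :
    IntegralEntries O !![w, x; y, z] := by
  intro i j
  fin_cases i <;> fin_cases j <;> assumption

lemma zpow_mul_zpow_neg (m : ℤ) : ((ϖ ^ m : Eˣ) : E) * ((ϖ ^ (-m) : Eˣ) : E) = 1 := by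
  rw [← Units.val_mul, ← _root_.zpow_add, add_neg_cancel, _root_.zpow_zero, Units.val_one]

/-- The case of a hyperbolic plane. -/
lemma isUnimodular_plane (h : IsInert bar O ϖ) {m : ℤ} (hm : 0 ≤ m) {α β u v α' α₁ : E}
    (hα : bar α = α) (hβ : bar β = β) (hα'O : α' ∈ O) (hβO : β ∈ O) (hu : u ∈ O) (hv : v ∈ O)
    (huv : u * v = 1) (hα' : α = ((ϖ ^ m : Eˣ) : E) * ((ϖ ^ m : Eˣ) : E) * α') (hα₁O : α₁ ∈ O) (hα₁ : α = ϖ * α₁) :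
    IsUnimodular bar O ϖ ![-m, m] !![α, u; bar u, β] ∧
      HasSwap bar O ϖ ![-m, m] !![α, u; bar u, β] := by
  have hb := h.bar_mem
  have huv' : bar u * bar v = 1 := by rw [← map_mul, huv, map_one]
  have hαO : α ∈ O := hα₁ ▸ mul_mem h.uniformizer_mem hα₁O
  set π : E := ((ϖ ^ m : Eˣ) : E) with hπ
  set π' : E := ((ϖ ^ (-m) : Eˣ) : E) with hπ'
  have hππ' : π * π' = 1 := zpow_mul_zpow_neg m
  have hπO : π ∈ O := h.zpow_mem hm
  have hπb : bar π = π := h.map_zpow m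
  have hπb' : bar π' = π' := h.map_zpow (-m)
  have hα'b : bar α' = α' := by
    have h1 := hα
    rw [hα'] at h1
    simp only [map_mul, hπb] at h1
    linear_combination π' * π' * h1 - (bar α' - α') * (π * π' + 1) * hππ'
  have hα₁b : bar α₁ = α₁ := by
    have h1 := hα
    rw [hα₁, map_mul, h.bar_uniformizer] at h1
    exact (Units.mul_right_inj ϖ).1 h1
  have hD : powDiag ϖ ![-m, m] = !![π', 0; 0, π] := powDiag_fin_two _ _
  have hD' : powDiag ϖ (-![-m, m]) = !![π, 0; 0, π'] := by
    have : -![-m, m] = ![m, -m] := by ext i; fin_cases i <;> simp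
    rw [this]
    exact powDiag_fin_two _ _
  have hH : IsUnimodular bar O ϖ ![-m, m] !![α, u; bar u, β] := by
    obtain ⟨d, hd, hd1⟩ := h.isUnit_one_sub (x := α₁ * β * v * bar v)
      (mul_mem (mul_mem (mul_mem hα₁O hβO) hv) (hb _ hv))
    -- The determinant is a unit because `α` is divisible by `ϖ` and `u` is a unit.
    have hdet : (α * β - u * bar u) * (-(d * v * bar v)) = 1 := by
      rw [hα₁]
      linear_combination hd1 + d * v * u * huv' + d * huv
    set e := -(d * v * bar v) with he
    have heO : e ∈ O := neg_mem (mul_mem (mul_mem hd hv) (hb _ hv))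
    refine ⟨?_, integralEntries_fin_two hαO hu (hb _ hu) hβO, ?_,
      !![e * β, -(e * u); -(e * bar u), e * α], ?_, integralEntries_fin_two (mul_mem heO hβO)
        (neg_mem (mul_mem heO hu)) (neg_mem (mul_mem heO (hb _ hu))) (mul_mem heO hαO), ?_⟩
    · ext i j
      fin_cases i <;> fin_cases j <;> simp [hα, hβ, h.bar_bar]
    · rw [hD]
      have : !![π', 0; 0, π] * !![α, u; bar u, β] * !![π', 0; 0, π] =
          !![α', u; bar u, π * β * π] := by
        ext i j
        fin_cases i <;> fin_cases j <;> simp [hα']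
        · linear_combination α' * (π * π' + 1) * hππ'
        · linear_combination u * hππ'
        · linear_combination bar u * hππ'
      rw [this]
      exact integralEntries_fin_two hα'O hu (hb _ hu) (mul_mem (mul_mem hπO hβO) hπO)
    · rw [one_fin_two]
      ext i j
      fin_cases i <;> fin_cases j <;> simp
      · linear_combination hdet
      · ring
      · ring
      · linear_combination hdet
    · rw [hD']
      have : !![π, 0; 0, π'] * !![e * β, -(e * u); -(e * bar u), e * α] * !![π, 0; 0, π'] =
          !![π * (e * β) * π, -(e * u); -(e * bar u), e * α'] := by
        ext i j
        fin_cases i <;> fin_cases j <;> simp [hα']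
        · linear_combination e * u * hππ'
        · linear_combination e * bar u * hππ'
        · linear_combination e * α' * (π * π' + 1) * hππ'
      rw [this]
      exact integralEntries_fin_two (mul_mem (mul_mem hπO (mul_mem heO hβO)) hπO)
        (neg_mem (mul_mem heO hu)) (neg_mem (mul_mem heO (hb _ hu))) (mul_mem heO hα'O)
  refine ⟨hH, ?_⟩
  obtain ⟨t, ht, htr⟩ := h.exists_trace_eq_one
  obtain ⟨q, hq, hq1⟩ := h.isUnit_one_sub (x := α₁ * α') (mul_mem hα₁O hα'O)
  have hq1 : (1 - α * α') * q = 1 := by rw [hα₁]; linear_combination hq1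
  have hqb : bar q = q := by
    have h1 := congrArg bar hq1
    simp only [map_mul, map_sub, map_one, hα, hα'b] at h1
    linear_combination q * h1 - bar q * hq1
  -- The second basis vector is to become a multiple of `x e₁ + e₂` with norm `α'` and pairing `1`
  -- with `e₁`. For `x = y t v`, with `t` of trace `1`, the trace term `x u + bar (x u)` is `y`, and
  -- the condition becomes this quadratic equation in `y`; `q` is the inverse of `1 - α α'`.
  obtain ⟨y, hyO, hyb, hy⟩ := h.exists_root (α₁ * (t * bar t * v * bar v))
    (mul_mem hα₁O (mul_mem (mul_mem (mul_mem ht (hb _ ht)) hv) (hb _ hv)))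
    ((β - α' * (u * bar u)) * q)
    (mul_mem (sub_mem hβO (mul_mem hα'O (mul_mem hu (hb _ hu)))) hq)
    (by simp only [map_mul, h.bar_bar, hα₁b]; ring)
    (by simp only [map_mul, map_sub, h.bar_bar, hβ, hα'b, hqb]; ring)
  have hy : y + α * (t * bar t * v * bar v) * y ^ 2 + (β - α' * (u * bar u)) * q = 0 := by
    rw [hα₁]; linear_combination hy
  set x := y * t * v with hx
  have hxO : x ∈ O := mul_mem (mul_mem hyO ht) hv
  obtain ⟨w₀, hw₀, hw₁⟩ := h.isUnit_one_sub (x := -(bar v * α₁ * x))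
    (neg_mem (mul_mem (mul_mem (hb _ hv) hα₁O) hxO))
  obtain ⟨w, hwO, hw⟩ : ∃ w ∈ O, (bar u + α * x) * w = 1 := ⟨bar v * w₀, mul_mem (hb _ hv) hw₀, by
    rw [hα₁]
    linear_combination hw₁ + w₀ * huv'⟩
  have hw' : (u + α * bar x) * bar w = 1 := by
    have := congrArg bar hw
    simpa only [map_mul, map_add, h.bar_bar, hα, map_one] using this
  have hkk' : !![1, w * x; 0, w] * !![1, -x; 0, bar u + α * x] = 1 := by
    rw [one_fin_two]
    ext i j
    fin_cases i <;> fin_cases j <;> simp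
    · linear_combination x * hw
    · linear_combination hw
  have huxO : bar u + α * x ∈ O := add_mem (hb _ hu) (mul_mem hαO hxO)
  refine HasSwap.of_baseChange h ?_ hkk'
    (integralEntries_fin_two (one_mem _) (mul_mem hwO hxO) (zero_mem _) hwO)
    (integralEntries_fin_two (one_mem _) (neg_mem hxO) (zero_mem _) huxO) ?_ ?_
  · have hgram : !![1, w * x; 0, w]ᵀ * !![α, u; bar u, β] * (!![1, w * x; 0, w].map bar) =
        !![α, 1; 1, α'] := by
      have e4 : x * u + bar u * bar x = y := by
        simp only [hx, map_mul, hyb]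
        linear_combination y * t * huv + y * bar t * huv' + y * htr
      have e5 : x * bar x = y ^ 2 * (t * bar t * v * bar v) := by
        simp only [hx, map_mul, hyb]; ring
      have e6 : u * x * α + bar u * bar x * α = α * y := by linear_combination α * e4
      have e7 : (α * x * bar x + x * u + bar u * bar x + β) =
          α' * ((bar u + α * x) * (u + α * bar x)) := by
        linear_combination (α - α' * α ^ 2) * e5 + (1 - α' * α) * e4 + (1 - α * α') * hy -
          (β - α' * (u * bar u)) * hq1
      ext i j
      fin_cases i <;> fin_cases j <;> simp [mul_apply, Fin.sum_univ_two]
      · linear_combination hw'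
      · linear_combination hw
      · linear_combination w * bar w * e7 + α' * (bar w * (u + α * bar x)) * hw + α' * hw'
    rw [hgram]
    -- In the basis with Gram matrix `!![α, 1; 1, α']` and `α = π² α'`, the swap exchanges the two
    -- vectors after rescaling them by `π` and `π⁻¹`.
    refine ⟨!![0, π'; π, 0], ?_, ?_, ?_⟩
    · ext i j
      fin_cases i <;> fin_cases j <;> simp [mul_apply, Fin.sum_univ_two, hπb, hπb', hα, hα'b]
      · linear_combination -hα'
      · linear_combination hππ'
      · linear_combination hππ'
      · rw [hα']
        linear_combination α' * (π * π' + 1) * hππ'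
    · rw [hD']
      have : !![π, 0; 0, π'] * !![0, π'; π, 0] = !![0, 1; 1, 0] := by
        ext i j
        fin_cases i <;> fin_cases j <;> simp [hππ', mul_comm π']
      rw [this]
      exact integralEntries_fin_two (zero_mem _) (one_mem _) (one_mem _) (zero_mem _)
    · rw [hD]
      have : !![0, π'; π, 0] * !![π', 0; 0, π] = !![0, 1; 1, 0] := by
        ext i j
        fin_cases i <;> fin_cases j <;> simp [hππ', mul_comm π']
      rw [this]
      exact integralEntries_fin_two (zero_mem _) (one_mem _) (one_mem _) (zero_mem _)
  · rw [hD, hD']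
    have : !![π, 0; 0, π'] * !![1, w * x; 0, w] * !![π', 0; 0, π] = !![1, π * (w * x) * π; 0, w] := by
      ext i j
      fin_cases i <;> fin_cases j <;> simp [hππ']
      linear_combination w * hππ'
    rw [this]
    exact integralEntries_fin_two (one_mem _) (mul_mem (mul_mem hπO (mul_mem hwO hxO)) hπO)
      (zero_mem _) hwO
  · rw [hD, hD']
    have : !![π, 0; 0, π'] * !![1, -x; 0, bar u + α * x] * !![π', 0; 0, π] =
        !![1, π * (-x) * π; 0, bar u + α * x] := by
      ext i j
      fin_cases i <;> fin_cases j <;> simp [hππ']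
      linear_combination (bar u + α * x) * hππ'
    rw [this]
    exact integralEntries_fin_two (one_mem _) (mul_mem (mul_mem hπO (neg_mem hxO)) hπO)
      (zero_mem _) huxO

end HermitianInduction

end DefiniteUnitary
end

noncomputable section

namespace DefiniteUnitary

/-! ### Transposition in the inert case -/

section Transpose

open Matrix

variable {E : Type*} [CommRing E] {bar : E →+* E} {O : Subring E} {ϖ : Eˣ}

lemma HasSwap.of_injective (h : IsInert bar O ϖ) {ι κ : Type} [Fintype ι] [DecidableEq ι] [Fintype κ]
    [DecidableEq κ] [Nonempty κ] {a : ι → ℤ} {H : Matrix ι ι E} (hH : IsUnimodular bar O ϖ a H)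
    {f : κ → ι} (hf : Function.Injective f)
    (hP : IsUnimodular bar O ϖ (a ∘ f) (H.submatrix f f) ∧
      HasSwap bar O ϖ (a ∘ f) (H.submatrix f f))
    (ih : ∀ (μ : Type) [Fintype μ] [DecidableEq μ] (b : μ → ℤ) (T : Matrix μ μ E),
      Fintype.card μ < Fintype.card ι → IsUnimodular bar O ϖ b T → HasSwap bar O ϖ b T) :
    HasSwap bar O ϖ a H := by
  classical
  let e : κ ⊕ ((Set.range f)ᶜ : Set ι) ≃ ι :=
    ((Equiv.ofInjective f hf).sumCongr (Equiv.refl _)).trans (Equiv.Set.sumCompl (Set.range f))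
  have he : ∀ l, e (Sum.inl l) = f l := fun l => by simp [e]
  have ha : a ∘ e = Sum.elim (a ∘ f) (fun l => a (e (Sum.inr l))) := by
    ext (l | l)
    · simp [he]
    · rfl
  have hM : H.submatrix e e = Matrix.fromBlocks (H.submatrix f f) (H.submatrix e e).toBlocks₁₂
      (H.submatrix e e).toBlocks₂₁ (H.submatrix e e).toBlocks₂₂ := by
    conv_lhs => rw [← fromBlocks_toBlocks (H.submatrix e e)]
    congr 1
  refine HasSwap.of_submatrix e ?_
  have hU := hH.submatrix e
  rw [ha, hM] at hU ⊢
  refine HasSwap.of_summand h hU hP.1 hP.2 fun T hT => ih _ _ _ ?_ hT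
  rw [← Fintype.card_congr e, Fintype.card_sum]
  have := Fintype.card_pos (α := κ)
  omega

lemma IsUniformizer.one_ne_mul (h : IsUniformizer O ϖ) {z : E} (hz : z ∈ O) : (1 : E) ≠ ϖ * z := by
  intro h1
  apply h.inv_notMem
  rw [← mul_one ((ϖ⁻¹ : Eˣ) : E), h1, Units.inv_mul_cancel_left]
  exact hz

/-- In row `i` of `H G = 1` some product `H i j * G j i` is a unit, so both factors are. Integrality
of `H` on the second lattice gives `a i + a j ≥ 0`, and that of `G` gives the opposite inequality.
-/
lemma IsUnimodular.exists_pivot (h : IsInert bar O ϖ) {ι : Type*} [Fintype ι] [DecidableEq ι]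
    {a : ι → ℤ} {H : Matrix ι ι E} (hH : IsUnimodular bar O ϖ a H) (i : ι) :
    ∃ j, a i + a j = 0 ∧ ∃ v ∈ O, H i j * v = 1 := by
  obtain ⟨h1, h2, h3, G, h4, h5, h6⟩ := hH
  have hsum : ∑ j, H i j * G j i = 1 := by
    have := congrFun (congrFun h4 i) i
    rwa [mul_apply, one_apply_eq] at this
  obtain ⟨j, hj⟩ : ∃ j, ¬ ∃ z ∈ O, H i j * G j i = ϖ * z := by
    by_contra! hc
    choose z hz hz' using hc
    refine h.one_ne_mul (sum_mem fun j (_ : j ∈ Finset.univ) => hz j) ?_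
    rw [Finset.mul_sum, ← hsum]
    exact Finset.sum_congr rfl fun j _ => hz' j
  obtain ⟨v, hv, hv1⟩ : ∃ v ∈ O, H i j * v = 1 := by
    by_contra hc
    obtain ⟨y, hy, hy1⟩ := h.exists_eq_mul (h2 i j) hc
    exact hj ⟨y * G j i, mul_mem hy (h5 j i), by rw [hy1, mul_assoc]⟩
  obtain ⟨w, hw, hw1⟩ : ∃ v ∈ O, G j i * v = 1 := by
    by_contra hc
    obtain ⟨y, hy, hy1⟩ := h.exists_eq_mul (h5 j i) hc
    exact hj ⟨H i j * y, mul_mem (h2 i j) hy, by rw [hy1]; ring⟩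
  refine ⟨j, le_antisymm ?_ ?_, v, hv, hv1⟩
  · have h7 := mul_mem (h6 j i) hw
    simp only [powDiag, diagonal_mul, mul_diagonal, Pi.neg_apply] at h7
    rw [mul_right_comm, mul_assoc _ (G j i), hw1, mul_one, ← Units.val_mul, ← _root_.zpow_add] at h7
    have := h.nonneg_of_zpow_mem h7
    omega
  · have h7 := mul_mem (h3 i j) hv
    simp only [powDiag, diagonal_mul, mul_diagonal] at h7
    rw [mul_right_comm, mul_assoc _ (H i j), hv1, mul_one, ← Units.val_mul, ← _root_.zpow_add] at h7
    exact h.nonneg_of_zpow_mem h7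

/-- Induction on the rank: split off a line when a diagonal unit has exponent `0`, and otherwise the
plane spanned by `i` and a pivot partner with opposite exponent. -/
lemma IsUnimodular.hasSwap (h : IsInert bar O ϖ) (N : ℕ) : ∀ (ι : Type) [Fintype ι] [DecidableEq ι]
    (a : ι → ℤ) (H : Matrix ι ι E), Fintype.card ι = N → IsUnimodular bar O ϖ a H →
      HasSwap bar O ϖ a H := by
  induction N using Nat.strong_induction_on with
  | _ N ih =>
  intro ι _ _ a H hN hH
  have ih' : ∀ (μ : Type) [Fintype μ] [DecidableEq μ] (b : μ → ℤ) (T : Matrix μ μ E),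
      Fintype.card μ < Fintype.card ι → IsUnimodular bar O ϖ b T → HasSwap bar O ϖ b T :=
    fun μ _ _ b T hlt hT => ih _ (hN ▸ hlt) μ b T rfl hT
  obtain hι | ⟨⟨i⟩⟩ := isEmpty_or_nonempty ι
  · exact ⟨1, Subsingleton.elim _ _, fun i => isEmptyElim i, fun i => isEmptyElim i⟩
  have hherm : ∀ i j, bar (H i j) = H j i := fun i j => congrFun (congrFun hH.hermitian i) j
  by_cases h1 : ∃ l, a l = 0 ∧ ∃ v ∈ O, H l l * v = 1
  · obtain ⟨l, hl, v, hv, hv1⟩ := h1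
    exact HasSwap.of_injective h hH (f := fun _ : Unit => l) (fun _ _ _ => rfl)
      (isUnimodular_unit hl (hH.integral l l) (hherm l l) hv hv1) ih'
  obtain ⟨i, j, v, m, hm, hi, hj, hv, hv1⟩ : ∃ (i j : ι) (v : E) (m : ℤ), 0 ≤ m ∧ a i = -m ∧ a j = m ∧
      v ∈ O ∧ H i j * v = 1 := by
    obtain ⟨j, hij, v, hv, hv1⟩ := hH.exists_pivot h i
    rcases le_total 0 (a j) with hm | hm
    · exact ⟨i, j, v, a j, hm, by omega, rfl, hv, hv1⟩
    · exact ⟨j, i, bar v, a i, by omega, by omega, rfl, h.bar_mem _ hv, by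
        rw [← hherm, ← map_mul, hv1, map_one]⟩
  have hij : i ≠ j := by
    rintro rfl
    exact h1 ⟨i, by omega, v, hv, hv1⟩
  have hα := hH.integral' i i
  simp only [powDiag, diagonal_mul, mul_diagonal, hi] at hα
  -- If `m = 0`, the entry is a nonunit because no line can be split off. If `m > 0`, it is
  -- divisible by `ϖ ^ (2 m)` because `ϖ ^ (-m) e_i` lies in the second lattice.
  obtain ⟨α₁, hα₁, hα₁'⟩ : ∃ y ∈ O, H i i = ϖ * y := by
    rcases hm.eq_or_lt with h0 | h0
    · exact h.exists_eq_mul (hH.integral i i) fun hc => h1 ⟨i, by omega, hc⟩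
    · refine ⟨((ϖ ^ (m - 1) : Eˣ) : E) * ((ϖ ^ m : Eˣ) : E) * _,
        mul_mem (mul_mem (h.zpow_mem (by omega)) (h.zpow_mem hm)) hα, ?_⟩
      have h2 : (ϖ : E) * ((ϖ ^ (m - 1) : Eˣ) : E) = ((ϖ ^ m : Eˣ) : E) := by
        rw [← Units.val_mul, ← _root_.zpow_one_add, add_sub_cancel]
      have h3 := zpow_mul_zpow_neg (ϖ := ϖ) m
      linear_combination -H i i * (((ϖ ^ m : Eˣ) : E) * ((ϖ ^ (-m) : Eˣ) : E) + 1) * h3 -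
        ((ϖ ^ m : Eˣ) : E) * ((ϖ ^ (-m) : Eˣ) : E) ^ 2 * H i i * h2
  have hP := isUnimodular_plane h hm (hherm i i) (hherm j j) hα (hH.integral j j) (hH.integral i j) hv hv1
    (by
      have h3 := zpow_mul_zpow_neg (ϖ := ϖ) m
      linear_combination -H i i * (((ϖ ^ m : Eˣ) : E) * ((ϖ ^ (-m) : Eˣ) : E) + 1) * h3) hα₁ hα₁'
  have hf : Function.Injective ![i, j] := by
    intro x y hxy
    fin_cases x <;> fin_cases y <;> simp_all
  have ha : a ∘ ![i, j] = ![-m, m] := by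
    ext x
    fin_cases x
    exacts [hi, hj]
  have hM : H.submatrix ![i, j] ![i, j] = !![H i i, H i j; bar (H i j), H j j] := by
    ext x y
    fin_cases x <;> fin_cases y <;> simp [hherm]
  exact HasSwap.of_injective h hH hf (by rw [ha, hM]; exact hP) ih'

/-- For any `B` with `Bᵀ * B.map bar = 1`, the matrices `xᵀ Bᵀ.map bar` and `xᵀ.map bar * B` are
unitary and solve the equation. With the Smith form `x = k ϖ^a l` and `B = k A k'.map bar`, where
`k' = k⁻¹`, they are integral when `A` is a swap for the Gram matrix `kᵀ * k.map bar`. -/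
lemma IsInert.exists_transpose_eq [Nontrivial E] (h : IsInert bar O ϖ) {n : ℕ}
    {x : Matrix (Fin n) (Fin n) E} (hx : x * xᵀ.map bar = 1) :
    ∃ k₁ k₂ : Matrix (Fin n) (Fin n) E, (IntegralEntries O k₁ ∧ k₁ * k₁ᵀ.map bar = 1) ∧
      (IntegralEntries O k₂ ∧ k₂ * k₂ᵀ.map bar = 1) ∧ xᵀ = k₁ * x * k₂ := by
  have hb := h.bar_mem
  obtain ⟨l₁, l₂, a, hxa⟩ := exists_smith h.uniformizer_mem h.exists_eq_zpow_mul hx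
  have hl : ∀ l : (Matrix (Fin n) (Fin n) O)ˣ, ∃ k k' : Matrix (Fin n) (Fin n) E,
      IntegralEntries O k ∧ IntegralEntries O k' ∧ k * k' = 1 ∧ k' * k = 1 ∧ l.1.map O.subtype = k := by
    intro l
    refine ⟨l.1.map O.subtype, l⁻¹.1.map O.subtype, fun i j => (l.1 i j).2,
      fun i j => (l⁻¹.1 i j).2, ?_, ?_, rfl⟩
    · rw [← Matrix.map_mul, Units.mul_inv]
      simp
    · rw [← Matrix.map_mul, Units.inv_mul]
      simp
  obtain ⟨k, k', hk, hk', hkk', hk'k, e₁⟩ := hl l₁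
  obtain ⟨l, l', hl, hl', hll', hl'l, e₂⟩ := hl l₂
  rw [e₁, e₂] at hxa
  change x = k * powDiag ϖ a * l at hxa
  have hmap : ∀ {M N : Matrix (Fin n) (Fin n) E}, M * N = 1 → M.map bar * N.map bar = 1 := by
    intro M N hMN
    rw [← Matrix.map_mul, hMN]
    simp
  have hkb := hmap hkk'
  have hkb' := hmap hk'k
  have hlb := hmap hll'
  have hlb' := hmap hl'l
  have htr : ∀ {M N : Matrix (Fin n) (Fin n) E}, M * N = 1 → Nᵀ * Mᵀ = 1 := by
    intro M N hMN
    rw [← transpose_mul, hMN, transpose_one]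
  have assoc : ∀ {M N : Matrix (Fin n) (Fin n) E}, M * N = 1 → ∀ X : Matrix (Fin n) (Fin n) E,
      M * (N * X) = X := by
    intro M N hMN X
    rw [← Matrix.mul_assoc, hMN, Matrix.one_mul]
  have hx' : xᵀ.map bar * x = 1 := mul_eq_one_comm.1 hx
  have hxa' : xᵀ.map bar = (l.map bar)ᵀ * powDiag ϖ a * (k.map bar)ᵀ := by
    rw [hxa]
    simp only [transpose_mul, Matrix.map_mul, transpose_map, transpose_powDiag, h.map_powDiag,
      Matrix.mul_assoc]
  -- Unitarity of `x` turns the Gram matrix on the second lattice into one given by `l' = l⁻¹`,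
  -- which is integral.
  have hU : IsUnimodular bar O ϖ a (kᵀ * k.map bar) := by
    refine ⟨?_, hk.transpose.mul (hk.map hb), ?_, k'.map bar * k'ᵀ, ?_,
      (hk'.map hb).mul hk'.transpose, ?_⟩
    · simp only [Matrix.map_mul, transpose_mul, h.map_map, transpose_map, transpose_transpose]
    · have h1 : (xᵀ.map bar * x)ᵀ = 1 := by rw [hx', transpose_one]
      have h2 : lᵀ * (powDiag ϖ a * (kᵀ * k.map bar) * powDiag ϖ a) * l.map bar = 1 := by
        rw [← h1, hxa', hxa]
        simp only [transpose_mul, transpose_transpose, transpose_powDiag, Matrix.mul_assoc]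
      have h3 : powDiag ϖ a * (kᵀ * k.map bar) * powDiag ϖ a = l'ᵀ * l'.map bar := by
        calc _ = l'ᵀ * (lᵀ * (powDiag ϖ a * (kᵀ * k.map bar) * powDiag ϖ a) * l.map bar) *
              l'.map bar := by
              simp only [Matrix.mul_assoc, assoc (htr hll'), hlb, Matrix.mul_one]
          _ = _ := by rw [h2, Matrix.mul_one]
      rw [h3]
      exact hl'.transpose.mul (hl'.map hb)
    · simp only [Matrix.mul_assoc, assoc hkb, htr hk'k]
    · have h2 : k * (powDiag ϖ a * (l * (l.map bar)ᵀ) * powDiag ϖ a) * (k.map bar)ᵀ = 1 := by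
        rw [← hx, hxa', hxa]
        simp only [Matrix.mul_assoc]
      have h3 : powDiag ϖ a * (l * (l.map bar)ᵀ) * powDiag ϖ a = k' * (k'.map bar)ᵀ := by
        calc _ = k' * (k * (powDiag ϖ a * (l * (l.map bar)ᵀ) * powDiag ϖ a) * (k.map bar)ᵀ) *
              (k'.map bar)ᵀ := by
              simp only [Matrix.mul_assoc, assoc hk'k, htr hkb', Matrix.mul_one]
          _ = _ := by rw [h2, Matrix.mul_one]
      have h4 : k'.map bar * k'ᵀ = powDiag ϖ a * (l.map bar * lᵀ) * powDiag ϖ a := by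
        have := congrArg (fun M => M.map bar) h3
        simp only [Matrix.map_mul, transpose_map, h.map_map, h.map_powDiag] at this
        exact this.symm
      rw [h4]
      simp only [Matrix.mul_assoc, powDiag_neg_mul_cancel, powDiag_mul_neg, Matrix.mul_one]
      exact (hl.map hb).mul hl.transpose
  obtain ⟨A, hA, hA1, hA2⟩ := hU.hasSwap h _ _ _ _ rfl
  obtain ⟨B, hBk⟩ : ∃ B, B = k * A * k'.map bar := ⟨_, rfl⟩
  have hB : Bᵀ * B.map bar = 1 := by
    calc _ = (k'.map bar)ᵀ * (Aᵀ * (kᵀ * k.map bar) * A.map bar) * k' := by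
          simp only [hBk, Matrix.map_mul, transpose_mul, h.map_map, Matrix.mul_assoc]
      _ = 1 := by
          rw [hA]
          simp only [Matrix.map_mul, transpose_map, h.map_map, Matrix.mul_assoc, hkk',
            Matrix.mul_one, htr hkb]
  have hB' : B * Bᵀ.map bar = 1 := by
    have := hmap (mul_eq_one_comm.1 hB)
    rwa [h.map_map] at this
  have hBi := mul_eq_one_comm.1 hB'
  have hinv : xᵀ.map bar = l' * (powDiag ϖ (-a) * k') := by
    calc xᵀ.map bar = xᵀ.map bar * (x * (l' * (powDiag ϖ (-a) * k'))) := by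
          rw [hxa]
          simp only [Matrix.mul_assoc, assoc hll', powDiag_mul_neg_cancel, hkk', Matrix.mul_one]
      _ = _ := by rw [← Matrix.mul_assoc, hx', Matrix.one_mul]
  have hxb : x.map bar * xᵀ = 1 := by
    have := hmap hx
    rwa [h.map_map] at this
  refine ⟨xᵀ * Bᵀ.map bar, xᵀ.map bar * B, ⟨?_, ?_⟩, ⟨?_, ?_⟩, ?_⟩
  · have h1 : B * x.map bar = k * (A * powDiag ϖ a) * l.map bar := by
      rw [hxa]
      simp only [hBk, Matrix.map_mul, h.map_powDiag, Matrix.mul_assoc, assoc hkb']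
    have h2 : xᵀ * Bᵀ.map bar = (B * x.map bar)ᵀ.map bar := by
      simp only [transpose_mul, Matrix.map_mul, transpose_map, h.map_map]
    rw [h2, h1]
    exact ((hk.mul hA2).mul (hl.map hb)).transpose.map hb
  · simp only [transpose_mul, Matrix.map_mul, transpose_transpose, transpose_map, h.map_map,
      Matrix.mul_assoc]
    rw [← transpose_map, assoc hBi, mul_eq_one_comm.1 hxb]
  · have h1 : xᵀ.map bar * B = l' * (powDiag ϖ (-a) * A) * k'.map bar := by
      rw [hinv]
      simp only [hBk, Matrix.mul_assoc, assoc hk'k]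
    rw [h1]
    exact (hl'.mul hA1).mul (hk'.map hb)
  · simp only [transpose_mul, Matrix.map_mul, transpose_transpose, transpose_map, h.map_map,
      Matrix.mul_assoc]
    rw [← transpose_map, ← transpose_map, assoc hB', hx']
  · simp only [Matrix.mul_assoc, assoc hx, hBi, Matrix.mul_one]

end Transpose

end DefiniteUnitary
end

noncomputable section

namespace DefiniteUnitary

/-! ### Unramified quadratic algebras -/

section Quadratic

open Matrix Polynomial

variable {L E : Type*} [Field L] [CommRing E] [Algebra L E] {A : ValuationSubring L} [Algebra A E]
  [IsScalarTower A L E] {ϖ : Lˣ} {bar : E →ₐ[L] E} {τ : E} {s N : L}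

variable (A ϖ bar τ s N) in
/-- `E = L ⊕ L τ` is an unramified quadratic algebra over the field of fractions `L` of a Henselian
discrete valuation ring, with conjugation `bar`. -/
structure IsUnramifiedQuadratic : Prop where
  isUniformizer : IsUniformizer A.toSubring ϖ
  exists_root : ∀ c ∈ A, ∀ δ ∈ A, ∃ y ∈ A, y + ϖ * c * y ^ 2 + δ = 0
  bar_bar : ∀ x, bar (bar x) = x
  add_bar : τ + bar τ = algebraMap L E s
  mul_bar : τ * bar τ = algebraMap L E N
  s_mem : s ∈ A
  N_mem : N ∈ A
  exists_disc_inv : ∃ d ∈ A, (s ^ 2 - 4 * N) * d = 1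
  exists_eq : ∀ x : E, ∃ a b : L, x = algebraMap L E a + algebraMap L E b * τ

lemma mem_of_sq_mem {x : L} (h : x ^ 2 ∈ A) : x ∈ A := by
  rcases A.mem_or_inv_mem x with hx | hx
  · exact hx
  · by_cases h0 : x = 0
    · rw [h0]
      exact zero_mem _
    · have := mul_mem h hx
      rwa [pow_two, mul_assoc, mul_inv_cancel₀ h0, mul_one] at this

variable (E) in
lemma algebraMap_mem_integralClosure [Nontrivial E] {a : L} :
    algebraMap L E a ∈ (integralClosure A E).toSubring ↔ a ∈ A := by
  change IsIntegral A (algebraMap L E a) ↔ _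
  rw [isIntegral_algebraMap_iff (algebraMap L E).injective, IsIntegrallyClosed.isIntegral_iff]
  constructor
  · rintro ⟨y, rfl⟩
    exact y.2
  · intro h
    exact ⟨⟨a, h⟩, rfl⟩

namespace IsUnramifiedQuadratic

lemma sq_eq (h : IsUnramifiedQuadratic A ϖ bar τ s N) :
    τ ^ 2 = algebraMap L E s * τ - algebraMap L E N := by
  rw [← h.add_bar, ← h.mul_bar]
  ring

lemma mem_integralClosure (h : IsUnramifiedQuadratic A ϖ bar τ s N) :
    τ ∈ (integralClosure A E).toSubring := by
  refine ⟨X ^ 2 - C (⟨s, h.s_mem⟩ : A) * X + C (⟨N, h.N_mem⟩ : A), by monicity!, ?_⟩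
  have hA : ∀ a : A, algebraMap A E a = algebraMap L E a := fun a =>
    IsScalarTower.algebraMap_apply A L E a
  simp only [eval₂_add, eval₂_sub, eval₂_mul, eval₂_X_pow, eval₂_X, eval₂_C, hA]
  rw [h.sq_eq]
  ring

lemma bar_mem_integralClosure {x : E} (hx : x ∈ (integralClosure A E).toSubring) :
    bar x ∈ (integralClosure A E).toSubring :=
  IsIntegral.map (bar.restrictScalars A) hx

lemma eq_zero_of_mul_sub [Nontrivial E] (h : IsUnramifiedQuadratic A ϖ bar τ s N) {b : L}
    (hb : algebraMap L E b * (τ - bar τ) = 0) : b = 0 := by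
  obtain ⟨d, -, hd⟩ := h.exists_disc_inv
  have h1 : algebraMap L E (b * (s ^ 2 - 4 * N)) = 0 := by
    rw [map_mul, map_sub, map_pow, map_mul, ← h.add_bar, ← h.mul_bar, map_ofNat]
    linear_combination (τ - bar τ) * hb
  have h2 := (algebraMap L E).injective (h1.trans (map_zero _).symm)
  linear_combination d * h2 - b * hd

/-- The square of `x - bar x` is `b ^ 2` times the unit discriminant, so integrality of `x` forces
that of `b`. -/
lemma mem_iff [Nontrivial E] (h : IsUnramifiedQuadratic A ϖ bar τ s N) {a b : L} :
    algebraMap L E a + algebraMap L E b * τ ∈ (integralClosure A E).toSubring ↔ a ∈ A ∧ b ∈ A := by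
  constructor
  · intro hx
    have hb : b ∈ A := by
      obtain ⟨d, hd, hd1⟩ := h.exists_disc_inv
      have h1 := sub_mem hx (bar_mem_integralClosure (bar := bar) hx)
      have h2 : (algebraMap L E a + algebraMap L E b * τ - bar (algebraMap L E a + algebraMap L E b * τ)) ^ 2 =
          algebraMap L E (b ^ 2 * (s ^ 2 - 4 * N)) := by
        simp only [map_add, map_mul, AlgHom.commutes, map_sub, map_pow, ← h.add_bar, ← h.mul_bar,
          map_ofNat]
        ring
      have h3 := pow_mem h1 2
      rw [h2, algebraMap_mem_integralClosure] at h3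
      refine mem_of_sq_mem (x := b) ?_
      have h4 := mul_mem h3 hd
      rwa [mul_assoc, hd1, mul_one] at h4
    refine ⟨?_, hb⟩
    rw [← algebraMap_mem_integralClosure E]
    have := sub_mem hx (mul_mem ((algebraMap_mem_integralClosure E).2 hb) h.mem_integralClosure)
    rwa [add_sub_cancel_right] at this
  · rintro ⟨ha, hb⟩
    exact add_mem ((algebraMap_mem_integralClosure E).2 ha)
      (mul_mem ((algebraMap_mem_integralClosure E).2 hb) h.mem_integralClosure)

lemma mul_bar_eq (h : IsUnramifiedQuadratic A ϖ bar τ s N) (a b : L) :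
    (algebraMap L E a + algebraMap L E b * τ) * bar (algebraMap L E a + algebraMap L E b * τ) =
      algebraMap L E (a ^ 2 + a * b * s + b ^ 2 * N) := by
  simp only [map_add, map_mul, AlgHom.commutes, map_pow, ← h.add_bar, ← h.mul_bar]
  ring

/-- If the norm of a primitive vector were a nonunit, `b` would be a unit and `-a / b` a root modulo
`ϖ` of the quadratic polynomial. As the discriminant is a unit, Hensel's lemma would lift it to a
root. -/
lemma exists_norm_inv (h : IsUnramifiedQuadratic A ϖ bar τ s N)
    (hns : ∀ ρ : L, ρ ^ 2 - s * ρ + N ≠ 0) {a b : L} (ha : a ∈ A) (hb : b ∈ A)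
    (hab : (∃ a' ∈ A, a * a' = 1) ∨ ∃ b' ∈ A, b * b' = 1) :
    ∃ n ∈ A, (a ^ 2 + a * b * s + b ^ 2 * N) * n = 1 := by
  have hu := h.isUniformizer
  have hs := h.s_mem
  have hN := h.N_mem
  by_contra hc
  obtain ⟨e, he, he1⟩ := hu.exists_eq_mul (x := a ^ 2 + a * b * s + b ^ 2 * N)
    (add_mem (add_mem (pow_mem ha 2) (mul_mem (mul_mem ha hb) hs)) (mul_mem (pow_mem hb 2) hN)) hc
  by_cases hb1 : ∃ b' ∈ A, b * b' = 1
  swap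
  · obtain ⟨b₁, hb₁, rfl⟩ := hu.exists_eq_mul hb hb1
    obtain ⟨a', ha', haa'⟩ := hab.resolve_right hb1
    refine hu.one_ne_mul (z := (e - (a * b₁ * s + ϖ * b₁ ^ 2 * N)) * a' ^ 2) (mul_mem (sub_mem he
      (add_mem (mul_mem (mul_mem ha hb₁) hs) (mul_mem (mul_mem hu.uniformizer_mem
        (pow_mem hb₁ 2)) hN))) (pow_mem ha' 2)) ?_
    linear_combination a' ^ 2 * he1 - (a * a' + 1) * haa'
  obtain ⟨β, hβ, hbβ⟩ := hb1
  obtain ⟨D, hD, hD1⟩ := h.exists_disc_inv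
  have h4 : (4 : L) ∈ A := ofNat_mem A 4
  obtain ⟨z, hz, hz1⟩ := hu.isUnit_one_sub (x := -(4 * e * β ^ 2 * D))
    (neg_mem (mul_mem (mul_mem (mul_mem h4 he) (pow_mem hβ 2)) hD))
  set r := -(a * β) with hr
  have hrA : r ∈ A := neg_mem (mul_mem ha hβ)
  have hq : r ^ 2 - s * r + N = ϖ * e * β ^ 2 := by
    rw [hr]
    linear_combination β ^ 2 * he1 - (N * (b * β + 1) + a * β * s) * hbβ
  set d := 2 * r - s with hd
  have hdA : d ∈ A := sub_mem (mul_mem (ofNat_mem A 2) hrA) hs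
  set d' := d * D * z with hd'
  have hd'A : d' ∈ A := mul_mem (mul_mem hdA hD) hz
  have hdd' : d * d' = 1 := by
    rw [hd', hd]
    linear_combination hz1 + z * hD1 + 4 * D * z * hq
  -- Expanding the polynomial at `r + ϖ y` and dividing by `ϖ d`, where `d` is its derivative at
  -- `r`, gives this equation.
  obtain ⟨y, hy, hy1⟩ := h.exists_root d' hd'A (e * β ^ 2 * d') (mul_mem (mul_mem he (pow_mem hβ 2)) hd'A)
  refine hns (r + ϖ * y) ?_
  linear_combination hq + ϖ * d * hy1 - ϖ * (ϖ * y ^ 2 + e * β ^ 2) * hdd'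

/-- The integral closure is `A ⊕ A τ`. Scaling by the coordinate of least valuation makes an element
primitive, and its norm is then a unit; so `ϖ` remains a uniformizer. -/
lemma isInert [Nontrivial E] (h : IsUnramifiedQuadratic A ϖ bar τ s N)
    (hns : ∀ ρ : L, ρ ^ 2 - s * ρ + N ≠ 0) :
    IsInert (bar : E →+* E) (integralClosure A E).toSubring (Units.map (algebraMap L E : L →* E) ϖ) where
  uniformizer_mem := (algebraMap_mem_integralClosure E).2 h.isUniformizer.uniformizer_mem
  inv_notMem := fun hc => h.isUniformizer.inv_notMem ((algebraMap_mem_integralClosure E).1 hc)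
  bar_bar := h.bar_bar
  bar_mem := fun _ => bar_mem_integralClosure
  bar_uniformizer := bar.commutes _
  exists_eq_zpow_mul := by
    intro x hx
    obtain ⟨a, b, rfl⟩ := h.exists_eq x
    have hM : (!![a, b] : Matrix (Fin 1) (Fin 2) L) ≠ 0 := by
      intro hM
      apply hx
      have h1 : a = 0 := congrFun (congrFun hM 0) 0
      have h2 : b = 0 := congrFun (congrFun hM 0) 1
      rw [h1, h2]
      simp
    obtain ⟨i, j, hij⟩ := exists_pivot h.isUniformizer.uniformizer_mem
      h.isUniformizer.exists_eq_zpow_mul hM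
    choose r hrA hr using hij
    have hp : (!![a, b] : Matrix (Fin 1) (Fin 2) L) i j ≠ 0 := by
      intro h0
      apply hM
      ext i' j'
      rw [hr, h0, zero_mul]
      rfl
    obtain ⟨k, u, hu, hu', hk⟩ := h.isUniformizer.exists_eq_zpow_mul _ hp
    have hr1 : r i j = 1 := by
      have := hr i j
      exact (mul_eq_left₀ hp).1 this.symm
    have ha : a = ↑(ϖ ^ k) * (u * r 0 0) := by
      rw [← mul_assoc, ← hk]
      exact hr 0 0
    have hb : b = ↑(ϖ ^ k) * (u * r 0 1) := by
      rw [← mul_assoc, ← hk]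
      exact hr 0 1
    have hr0 : r 0 0 = 1 ∨ r 0 1 = 1 := by
      obtain rfl : i = 0 := Subsingleton.elim _ _
      fin_cases j
      exacts [Or.inl hr1, Or.inr hr1]
    have haA := mul_mem hu (hrA 0 0)
    have hbA := mul_mem hu (hrA 0 1)
    obtain ⟨n, hn, hn1⟩ := h.exists_norm_inv hns haA hbA
      (hr0.imp (fun e => ⟨_, hu', by simp [e]⟩) (fun e => ⟨_, hu', by simp [e]⟩))
    set a₀ : L := u * r 0 0
    set b₀ : L := u * r 0 1
    have hmem := h.mem_iff.2 ⟨haA, hbA⟩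
    have hinv : (algebraMap L E a₀ + algebraMap L E b₀ * τ) *
        (bar (algebraMap L E a₀ + algebraMap L E b₀ * τ) * algebraMap L E n) = 1 := by
      rw [← mul_assoc, h.mul_bar_eq, ← map_mul, hn1, map_one]
    refine ⟨k, ⟨_, _, hinv, (mul_comm _ _).trans hinv⟩, hmem, mul_mem (bar_mem_integralClosure hmem)
      ((algebraMap_mem_integralClosure E).2 hn), ?_⟩
    rw [← _root_.map_zpow]
    change _ = algebraMap L E ↑(ϖ ^ k) * (algebraMap L E a₀ + algebraMap L E b₀ * τ)
    rw [mul_add, ← mul_assoc, ← map_mul, ← map_mul, ← ha, ← hb]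
  exists_trace_eq_one := by
    obtain ⟨D, hD, hD1⟩ := h.exists_disc_inv
    by_cases hs : ∃ s' ∈ A, s * s' = 1
    · obtain ⟨s', hs', hss'⟩ := hs
      refine ⟨algebraMap L E s' * τ, mul_mem ((algebraMap_mem_integralClosure E).2 hs')
        h.mem_integralClosure, ?_⟩
      change algebraMap L E s' * τ + bar (algebraMap L E s' * τ) = 1
      rw [map_mul, AlgHom.commutes, ← mul_add, h.add_bar, ← map_mul, mul_comm, hss', map_one]
    -- When `s` is not a unit, the unit discriminant `s ^ 2 - 4 N` forces `2` to be one, and `1 / 2`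
    -- has trace `1`.
    · obtain ⟨s₁, hs₁, rfl⟩ := h.isUniformizer.exists_eq_mul h.s_mem hs
      obtain ⟨z, hz, hz1⟩ := h.isUniformizer.isUnit_one_sub (x := ϖ * s₁ ^ 2 * D)
        (mul_mem (mul_mem h.isUniformizer.uniformizer_mem (pow_mem hs₁ 2)) hD)
      have h2 : (2 : L) * (-(2 * N * D * z)) = 1 := by linear_combination hz1 + z * hD1
      refine ⟨algebraMap L E (-(2 * N * D * z)), (algebraMap_mem_integralClosure E).2
        (neg_mem (mul_mem (mul_mem (mul_mem (ofNat_mem A 2) h.N_mem) hD) hz)), ?_⟩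
      change algebraMap L E _ + bar (algebraMap L E _) = 1
      rw [AlgHom.commutes, ← two_mul, ← map_ofNat (algebraMap L E), ← map_mul, h2, map_one]
  exists_root := by
    have hfix : ∀ c ∈ (integralClosure A E).toSubring, bar c = c → ∃ c' ∈ A, c = algebraMap L E c' := by
      intro c hc hcb
      obtain ⟨a, b, rfl⟩ := h.exists_eq c
      have hb : b = 0 := h.eq_zero_of_mul_sub (by
        rw [map_add, map_mul, AlgHom.commutes, AlgHom.commutes] at hcb
        linear_combination -hcb)
      exact ⟨a, (h.mem_iff.1 hc).1, by rw [hb]; simp⟩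
    intro c hc δ hδ hcb hδb
    obtain ⟨c, hc', rfl⟩ := hfix c hc hcb
    obtain ⟨δ, hδ', rfl⟩ := hfix δ hδ hδb
    obtain ⟨y, hy, hy1⟩ := h.exists_root c hc' δ hδ'
    refine ⟨algebraMap L E y, (algebraMap_mem_integralClosure E).2 hy, bar.commutes y, ?_⟩
    have := congrArg (algebraMap L E) hy1
    simp only [map_add, map_mul, map_pow, map_zero] at this
    exact this

/-- The split case. -/
lemma exists_transpose_eq_of_root [Nontrivial E] (h : IsUnramifiedQuadratic A ϖ bar τ s N) {ρ : L}
    (hρ : ρ ^ 2 - s * ρ + N = 0) {n : ℕ}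
    {x : Matrix (Fin n) (Fin n) E} (hx : x * xᵀ.map bar = 1) :
    ∃ k₁ k₂ : Matrix (Fin n) (Fin n) E,
      (IntegralEntries (integralClosure A E).toSubring k₁ ∧ k₁ * k₁ᵀ.map bar = 1) ∧
      (IntegralEntries (integralClosure A E).toSubring k₂ ∧ k₂ * k₂ᵀ.map bar = 1) ∧
      xᵀ = k₁ * x * k₂ := by
  have hρA : ρ ∈ A := by
    rcases A.mem_or_inv_mem ρ with hρA | hρA
    · exact hρA
    · by_cases h0 : ρ = 0
      · rw [h0]
        exact zero_mem _
      have h1 : ρ = s - N * ρ⁻¹ := by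
        field_simp
        linear_combination hρ
      rw [h1]
      exact sub_mem h.s_mem (mul_mem h.N_mem hρA)
  obtain ⟨D, hD, hD1⟩ := h.exists_disc_inv
  set d : L := (2 * ρ - s) * D with hd
  have hd1 : (2 * ρ - s) * d = 1 := by
    rw [hd]
    linear_combination hD1 + 4 * D * hρ
  have hdA : d ∈ A := mul_mem (sub_mem (mul_mem (ofNat_mem A 2) hρA) h.s_mem) hD
  -- The root splits `E` by two orthogonal idempotents `e` and `e'`, which `bar` exchanges. A matrix
  -- over `E` becomes a pair `(P, Q)`, and unitarity becomes `P * Qᵀ = 1`.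
  set e : E := algebraMap L E d * (τ - algebraMap L E (s - ρ)) with he
  set e' : E := algebraMap L E d * (algebraMap L E ρ - τ) with he'
  have hbe : bar e = e' := by
    rw [he, he', map_mul, map_sub, AlgHom.commutes, AlgHom.commutes, map_sub, ← h.add_bar]
    ring
  have hbe' : bar e' = e := by rw [← hbe, h.bar_bar]
  have hee : e + e' = 1 := by
    rw [he, he', ← mul_add, ← map_one (algebraMap L E), ← hd1]
    simp only [map_sub, map_mul, map_ofNat]
    ring
  have hee' : e * e' = 0 := by
    have h1 := congrArg (algebraMap L E) hρ
    simp only [map_add, map_mul, map_pow, map_zero, map_sub] at h1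
    have h2 := h.sq_eq
    rw [he, he', map_sub]
    linear_combination -(algebraMap L E d) ^ 2 * h2 + (algebraMap L E d) ^ 2 * h1
  have hsq : e * e = e := by linear_combination e * hee - hee'
  have hsq' : e' * e' = e' := by linear_combination e' * hee - hee'
  have heO : e ∈ (integralClosure A E).toSubring :=
    mul_mem ((algebraMap_mem_integralClosure E).2 hdA) (sub_mem h.mem_integralClosure
      ((algebraMap_mem_integralClosure E).2 (sub_mem h.s_mem hρA)))
  have heO' : e' ∈ (integralClosure A E).toSubring := hbe ▸ bar_mem_integralClosure heO
  let F : Matrix (Fin n) (Fin n) L → Matrix (Fin n) (Fin n) L → Matrix (Fin n) (Fin n) E :=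
    fun P Q => e • P.map (algebraMap L E) + e' • Q.map (algebraMap L E)
  have hFmul : ∀ P Q P' Q', F P Q * F P' Q' = F (P * P') (Q * Q') := by
    intro P Q P' Q'
    simp only [F, Matrix.add_mul, Matrix.mul_add, Matrix.smul_mul, Matrix.mul_smul, smul_add, smul_smul,
      hee', mul_comm e' e, hsq, hsq', Matrix.map_mul, zero_smul, add_zero, zero_add]
  have hF1 : F 1 1 = 1 := by
    simp [F, ← add_smul, hee]
  have hFt : ∀ P Q, (F P Q)ᵀ = F Pᵀ Qᵀ := fun P Q => by ext i j; simp [F]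
  have hFb : ∀ P Q, (F P Q).map bar = F Q P := fun P Q => by
    ext i j
    simp [F, hbe, hbe', add_comm]
  have hFinj : ∀ P Q, F P Q = 1 → P = 1 := by
    intro P Q hPQ
    have h1 : e • (P - 1).map (algebraMap L E) = 0 := by
      have h2 : e • F P Q = e • F 1 1 := by rw [hPQ, hF1]
      simp only [F, smul_add, smul_smul, hsq, hee', zero_smul, add_zero] at h2
      rw [Matrix.map_sub _ (map_sub _), smul_sub, h2, sub_self]
    rw [← sub_eq_zero]
    ext i j
    have h3 : e * algebraMap L E ((P - 1) i j) = 0 := congrFun (congrFun h1 i) j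
    have h4 := congrArg bar h3
    rw [map_mul, hbe, AlgHom.commutes, map_zero] at h4
    have h5 : algebraMap L E ((P - 1) i j) = 0 := by
      linear_combination h3 + h4 - algebraMap L E ((P - 1) i j) * hee
    exact (algebraMap L E).injective (h5.trans (map_zero _).symm)
  obtain ⟨P, Q, rfl⟩ : ∃ P Q, x = F P Q := by
    choose a b hab using fun i j => h.exists_eq (x i j)
    refine ⟨of fun i j => a i j + b i j * ρ, of fun i j => a i j + b i j * (s - ρ), ?_⟩
    have hτ : algebraMap L E ρ * e + algebraMap L E (s - ρ) * e' = τ := by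
      have h1 := congrArg (algebraMap L E) hd1
      simp only [map_sub, map_mul, map_ofNat, map_one] at h1
      rw [he, he', map_sub]
      linear_combination τ * h1
    ext i j
    rw [hab]
    simp only [F, Matrix.add_apply, Matrix.smul_apply, Matrix.map_apply, of_apply, smul_eq_mul,
      map_add, map_mul]
    linear_combination -algebraMap L E (a i j) * hee - algebraMap L E (b i j) * hτ
  rw [hFt, hFb, hFmul] at hx
  have hPQ := hFinj _ _ hx
  obtain ⟨l₁, l₂, a, hP⟩ := exists_smith h.isUniformizer.uniformizer_mem
    h.isUniformizer.exists_eq_zpow_mul hPQ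
  have hl : ∀ l : (Matrix (Fin n) (Fin n) A.toSubring)ˣ, ∃ k k' : Matrix (Fin n) (Fin n) L,
      IntegralEntries A.toSubring k ∧ IntegralEntries A.toSubring k' ∧ k * k' = 1 ∧ k' * k = 1 ∧
        l.1.map A.toSubring.subtype = k := by
    intro l
    refine ⟨l.1.map A.toSubring.subtype, l⁻¹.1.map A.toSubring.subtype, fun i j => (l.1 i j).2,
      fun i j => (l⁻¹.1 i j).2, ?_, ?_, rfl⟩
    · rw [← Matrix.map_mul, Units.mul_inv]
      simp
    · rw [← Matrix.map_mul, Units.inv_mul]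
      simp
  obtain ⟨k, k', hk, hk', hkk', hk'k, e₁⟩ := hl l₁
  obtain ⟨l, l', hl, hl', hll', hl'l, e₂⟩ := hl l₂
  rw [e₁, e₂] at hP
  have htr : ∀ {M N : Matrix (Fin n) (Fin n) L}, M * N = 1 → Nᵀ * Mᵀ = 1 := by
    intro M N hMN
    rw [← transpose_mul, hMN, transpose_one]
  have assoc : ∀ {M N : Matrix (Fin n) (Fin n) L}, M * N = 1 → ∀ X : Matrix (Fin n) (Fin n) L,
      M * (N * X) = X := by
    intro M N hMN X
    rw [← Matrix.mul_assoc, hMN, Matrix.one_mul]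
  have hFint : ∀ {P Q : Matrix (Fin n) (Fin n) L}, IntegralEntries A.toSubring P →
      IntegralEntries A.toSubring Q → IntegralEntries (integralClosure A E).toSubring (F P Q) :=
    fun hP hQ i j => add_mem (mul_mem heO ((algebraMap_mem_integralClosure E).2 (hP i j)))
      (mul_mem heO' ((algebraMap_mem_integralClosure E).2 (hQ i j)))
  -- The diagonal factor in `P = k δ l` is symmetric, so `Pᵀ = lᵀ δ kᵀ` is obtained from `P` by
  -- integral factors. The identity for `Q` follows by inverting.
  have hPt : Pᵀ = lᵀ * k' * P * (l' * kᵀ) := by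
    rw [hP]
    simp only [transpose_mul, diagonal_transpose, Matrix.mul_assoc, assoc hk'k, assoc hll']
  have hQP : Q * Pᵀ = 1 := by simpa using htr hPQ
  have hQt : Qᵀ = l' * kᵀ * Q * (lᵀ * k') := by
    have h1 : l' * kᵀ * Q * (lᵀ * k') * P = 1 := by
      calc _ = l' * kᵀ * (Q * Pᵀ) * k'ᵀ * l := by
            rw [hP]
            simp only [transpose_mul, diagonal_transpose, Matrix.mul_assoc, assoc hk'k,
              assoc (htr hk'k)]
        _ = 1 := by
            rw [hQP]
            simp only [Matrix.mul_one, Matrix.mul_assoc, assoc (htr hk'k), hl'l]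
    calc Qᵀ = l' * kᵀ * Q * (lᵀ * k') * P * Qᵀ := by rw [h1, Matrix.one_mul]
      _ = _ := by rw [Matrix.mul_assoc _ P, hPQ, Matrix.mul_one]
  have hu := hl.transpose.mul hk'
  have hw := hl'.mul hk.transpose
  refine ⟨F (lᵀ * k') (l' * kᵀ), F (l' * kᵀ) (lᵀ * k'), ⟨hFint hu hw, ?_⟩, ⟨hFint hw hu, ?_⟩, ?_⟩
  · rw [hFt, hFb, hFmul, ← hF1]
    simp only [transpose_mul, transpose_transpose, Matrix.mul_assoc, assoc hk'k, assoc (htr hk'k),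
      htr hl'l, hl'l]
  · rw [hFt, hFb, hFmul, ← hF1]
    simp only [transpose_mul, transpose_transpose, Matrix.mul_assoc, assoc hk'k, assoc (htr hk'k),
      htr hl'l, hl'l]
  · rw [hFt, hFmul, hFmul, ← hPt, ← hQt]

lemma exists_transpose_eq [Nontrivial E] (h : IsUnramifiedQuadratic A ϖ bar τ s N) {n : ℕ}
    {x : Matrix (Fin n) (Fin n) E} (hx : x * xᵀ.map bar = 1) :
    ∃ k₁ k₂ : Matrix (Fin n) (Fin n) E,
      (IntegralEntries (integralClosure A E).toSubring k₁ ∧ k₁ * k₁ᵀ.map bar = 1) ∧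
      (IntegralEntries (integralClosure A E).toSubring k₂ ∧ k₂ * k₂ᵀ.map bar = 1) ∧
      xᵀ = k₁ * x * k₂ := by
  by_cases hρ : ∃ ρ : L, ρ ^ 2 - s * ρ + N = 0
  · obtain ⟨ρ, hρ⟩ := hρ
    exact h.exists_transpose_eq_of_root hρ hx
  · exact (h.isInert fun ρ hρ' => hρ ⟨ρ, hρ'⟩).exists_transpose_eq hx

end IsUnramifiedQuadratic

end Quadratic

end DefiniteUnitary
end

noncomputable section

namespace DefiniteUnitary

/-! ### Hensel's lemma in a compact discrete valuation ring -/

section DiscreteValuationRing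

open Topology

variable {L : Type*} [Field L] {A : ValuationSubring L}

lemma isUniformizer_of_irreducible [IsDiscreteValuationRing A] {ϖ : A} (hϖ : Irreducible ϖ)
    (h0 : (ϖ : L) ≠ 0) : IsUniformizer A.toSubring (Units.mk0 (ϖ : L) h0) where
  uniformizer_mem := ϖ.2
  inv_notMem := fun h => by
    have h1 : ((Units.mk0 (ϖ : L) h0)⁻¹ : Lˣ) = (ϖ : L)⁻¹ := by simp
    rw [h1] at h
    exact hϖ.not_isUnit (IsUnit.of_mul_eq_one ⟨_, h⟩ (Subtype.ext (mul_inv_cancel₀ h0)))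
  exists_eq_zpow_mul := by
    have key : ∀ x : L, x ≠ 0 → x ∈ A → ∃ (k : ℕ) (u : Aˣ), x = (ϖ : L) ^ k * (u : A) := by
      intro x hx hxA
      obtain ⟨k, u, hk⟩ := IsDiscreteValuationRing.eq_unit_mul_pow_irreducible
        (x := (⟨x, hxA⟩ : A)) (fun h => hx (congrArg Subtype.val h)) hϖ
      refine ⟨k, u, ?_⟩
      have := congrArg Subtype.val hk
      simpa [mul_comm] using this
    intro x hx
    rcases A.mem_or_inv_mem x with hxA | hxA
    · obtain ⟨k, u, hk⟩ := key x hx hxA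
      refine ⟨k, Units.map (A.subtype : A →* L) u, u.1.2, ?_, by simpa using hk⟩
      rw [← map_inv]
      exact (u⁻¹).1.2
    · obtain ⟨k, u, hk⟩ := key x⁻¹ (inv_ne_zero hx) hxA
      refine ⟨-k, Units.map (A.subtype : A →* L) u⁻¹, (u⁻¹).1.2, ?_, ?_⟩
      · rw [← map_inv, inv_inv]
        exact u.1.2
      · rw [← inv_inv x, hk]
        simp [mul_comm]

/-- The integral approximate roots modulo `ϖ ^ k` form nested nonempty compact sets; a common point
has `f y` divisible by every power of `ϖ`. -/
lemma exists_root_of_isCompact [TopologicalSpace L] [IsTopologicalRing L] [T2Space L]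
    (hA : IsCompact (A : Set L)) {ϖ : Lˣ} (hϖ : IsUniformizer A.toSubring ϖ) {c δ : L}
    (hc : c ∈ A) (hδ : δ ∈ A) : ∃ y ∈ A, y + ϖ * c * y ^ 2 + δ = 0 := by
  let f : L → L := fun y => y + ϖ * c * y ^ 2 + δ
  have hf : Continuous f := by fun_prop
  let C : ℕ → Set L := fun k => A ∩ f ⁻¹' ((fun z => (ϖ : L) ^ k * z) '' A)
  have hcl : ∀ k, IsClosed (C k) := fun k =>
    hA.isClosed.inter (((hA.image (by fun_prop)).isClosed).preimage hf)
  have hπ : (ϖ : L) ∈ A := hϖ.uniformizer_mem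
  have hfA : ∀ y ∈ A, f y ∈ A := fun y hy =>
    add_mem (add_mem hy (mul_mem (mul_mem hπ hc) (pow_mem hy 2))) hδ
  have hanti : ∀ k, C (k + 1) ⊆ C k := by
    rintro k y ⟨hy, z, hz, hzy⟩
    exact ⟨hy, ϖ * z, mul_mem hπ hz, by
      rw [← hzy]
      ring⟩
  have hne : ∀ k, (C k).Nonempty := by
    intro k
    induction k with
    | zero => exact ⟨0, zero_mem A, f 0, hfA 0 (zero_mem A), by simp⟩
    | succ k ih =>
      obtain ⟨y, hy, z, hz, hzy⟩ := ih
      -- Newton's step with derivative `1` modulo `ϖ`: the new value is `ϖ c (f y - 2 y)` times `f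
      -- y`.
      refine ⟨y - f y, sub_mem hy (hfA y hy), z * c * (f y - 2 * y), mul_mem (mul_mem hz hc)
        (sub_mem (hfA y hy) (mul_mem (ofNat_mem A 2) hy)), ?_⟩
      change (ϖ : L) ^ (k + 1) * (z * c * (f y - 2 * y)) =
        y - f y + ϖ * c * (y - f y) ^ 2 + δ
      have h1 : f y = y + ϖ * c * y ^ 2 + δ := rfl
      have h2 : (ϖ : L) ^ k * z = f y := hzy
      rw [pow_succ]
      linear_combination ϖ * c * (f y - 2 * y) * h2 + h1
  obtain ⟨y, hy⟩ := IsCompact.nonempty_iInter_of_sequence_nonempty_isCompact_isClosed C hanti hne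
    (hA.inter_right (((hA.image (by fun_prop)).isClosed).preimage hf)) hcl
  rw [Set.mem_iInter] at hy
  refine ⟨y, (hy 0).1, ?_⟩
  by_contra h0
  obtain ⟨k, u, hu, hu', hk⟩ := hϖ.exists_eq_zpow_mul _ h0
  obtain ⟨z, hz, hzy⟩ := (hy (k.toNat + 1)).2
  have h1 : (ϖ : L) ^ (k.toNat + 1) * z = ↑(ϖ ^ k) * u := hzy.trans hk
  have h2 : ((ϖ ^ (k - (k.toNat + 1 : ℕ)) : Lˣ) : L) = z * ↑u⁻¹ := by
    rw [_root_.zpow_sub, Units.val_mul, zpow_natCast, ← Units.mul_left_inj u, mul_assoc z,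
      Units.inv_mul, mul_one, mul_right_comm, ← h1, ← Units.val_pow_eq_pow_val, mul_right_comm,
      Units.mul_inv, one_mul]
  have h3 := hϖ.nonneg_of_zpow_mem (h2 ▸ mul_mem hz hu')
  omega

end DiscreteValuationRing

/-! ### Conjugation at an unramified place -/

section Generator

variable {F K : Type*} [Field F] [NumberField F] [Field K] [NumberField K] [Algebra F K]
  [Algebra.IsQuadraticExtension F K] {c : K ≃ₐ[F] K}

lemma conj_conj (hc : c ≠ 1) (x : K) : c (c x) = x := by
  have h1 : Nat.card (K ≃ₐ[F] K) ≤ 2 := by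
    rw [← Algebra.IsQuadraticExtension.finrank_eq_two F K, Nat.card_eq_fintype_card]
    exact AlgEquiv.card_le
  have h2 : Nontrivial (K ≃ₐ[F] K) := ⟨⟨c, 1, hc⟩⟩
  have h3 : Nat.card (K ≃ₐ[F] K) = 2 := le_antisymm h1 Finite.one_lt_card
  have h4 : c ^ 2 = 1 := h3 ▸ pow_card_eq_one'
  rw [pow_two] at h4
  exact congrArg (fun e : K ≃ₐ[F] K => e x) h4

lemma exists_eq_add_mul {τ : K} (hτ : c τ ≠ τ) (x : K) :
    ∃ a b : F, x = algebraMap F K a + algebraMap F K b * τ := by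
  have hli : LinearIndependent F ![1, τ] := by
    rw [LinearIndependent.pair_iff]
    intro a b hab
    have hb : b = 0 := by
      by_contra hb
      have h1 : algebraMap F K a + algebraMap F K b * τ = 0 := by
        simpa [Algebra.smul_def] using hab
      have h2 := congrArg c h1
      rw [map_add, map_mul, AlgEquiv.commutes, AlgEquiv.commutes, map_zero] at h2
      have h3 : algebraMap F K b * (c τ - τ) = 0 := by linear_combination h2 - h1
      rcases mul_eq_zero.1 h3 with h4 | h4
      · exact hb ((map_eq_zero _).1 h4)
      · exact hτ (sub_eq_zero.1 h4)
    refine ⟨?_, hb⟩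
    rw [hb] at hab
    simpa [Algebra.smul_def] using hab
  have hspan := hli.span_eq_top_of_card_eq_finrank' (by
    rw [Fintype.card_fin, Algebra.IsQuadraticExtension.finrank_eq_two F K])
  have hx : x ∈ Submodule.span F (Set.range ![1, τ]) := hspan ▸ Submodule.mem_top
  rw [Matrix.range_cons_cons_empty, Submodule.mem_span_pair] at hx
  obtain ⟨a, b, rfl⟩ := hx
  exact ⟨a, b, by simp [Algebra.smul_def]⟩

lemma exists_algebraMap_of_conj_eq (hc : c ≠ 1) {x : 𝓞 K} (hx : c x = x) :
    ∃ y : 𝓞 F, algebraMap F K y = x := by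
  obtain ⟨τ, hτ⟩ : ∃ τ : K, c τ ≠ τ := by
    by_contra! h
    exact hc (AlgEquiv.ext h)
  obtain ⟨a, b, hab⟩ := exists_eq_add_mul hτ (x : K)
  have hb : b = 0 := by
    rw [hab, map_add, map_mul, AlgEquiv.commutes, AlgEquiv.commutes] at hx
    have h3 : algebraMap F K b * (c τ - τ) = 0 := by linear_combination hx
    rcases mul_eq_zero.1 h3 with h4 | h4
    · exact (map_eq_zero _).1 h4
    · exact absurd (sub_eq_zero.1 h4) hτ
  have ha : (x : K) = algebraMap F K a := by rw [hab, hb]; simp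
  have hint : IsIntegral ℤ a := by
    rw [← isIntegral_algebraMap_iff (algebraMap F K).injective, ← ha]
    exact x.2
  exact ⟨⟨a, hint⟩, ha.symm⟩

variable (c) in
/-- The conjugation of the ring of integers. -/
def conjInt : 𝓞 K ≃ₐ[𝓞 F] 𝓞 K := galRestrict (𝓞 F) F K (𝓞 K) c

lemma coe_conjInt (x : 𝓞 K) : ((conjInt c x : 𝓞 K) : K) = c x :=
  algebraMap_galRestrict_apply (𝓞 F) c x

/-- Conjugation is nontrivial modulo the primes above an unramified place. -/
lemma exists_conj_sub_notMem (hc : c ≠ 1) {v : HeightOneSpectrum (𝓞 F)} (hv : UnramifiedIn K v) :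
    ∃ τ : 𝓞 K, ((τ - conjInt c τ) ^ 2 : 𝓞 K) ∉ v.asIdeal.map (algebraMap (𝓞 F) (𝓞 K)) := by
  -- The square is the discriminant of `τ`, an element coming from `𝓞 F`. If it always lies in the
  -- ideal, conjugation is trivial modulo a prime `w` above `v`.
  by_contra! hall
  obtain ⟨w, hw, hwv⟩ := Ideal.exists_ideal_over_prime_of_isIntegral_of_isDomain (S := 𝓞 K) v.asIdeal
    (by
      rw [(RingHom.injective_iff_ker_eq_bot _).1 (FaithfulSMul.algebraMap_injective (𝓞 F) (𝓞 K))]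
      exact bot_le)
  have hlo : w.LiesOver v.asIdeal := ⟨hwv.symm⟩
  have hunr : Algebra.IsUnramifiedAt (𝓞 F) w := hv w hlo
  have hcw : ∀ x : 𝓞 K, x - conjInt c x ∈ w := fun x =>
    hw.mem_of_pow_mem 2 (Ideal.map_le_iff_le_comap.2 hwv.ge (hall x))
  let B := Localization.AtPrime w
  let f : 𝓞 K →ₐ[𝓞 F] B := (IsScalarTower.toAlgHom (𝓞 F) (𝓞 K) B).comp (conjInt c : 𝓞 K →ₐ[𝓞 F] 𝓞 K)
  have hfu : ∀ y : w.primeCompl, IsUnit (f y) := fun y =>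
    IsLocalization.map_units B (⟨conjInt c y, fun h => y.2 (by
      have := add_mem (hcw y) h
      rwa [sub_add_cancel] at this)⟩ : w.primeCompl)
  let g : B →ₐ[𝓞 F] B := IsLocalization.liftAlgHom (M := w.primeCompl) hfu
  let m := IsLocalRing.maximalIdeal B
  have hgeq : ∀ x : 𝓞 K, g (algebraMap (𝓞 K) B x) = algebraMap (𝓞 K) B (conjInt c x) := fun x =>
    IsLocalization.lift_eq _ x
  have hm : ⨅ i, m ^ i = ⊥ := Ideal.iInf_pow_eq_bot_of_isDomain m (Ideal.IsPrime.ne_top inferInstance)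
  have hcong : ∀ x : 𝓞 K, Ideal.Quotient.mk m (algebraMap (𝓞 K) B x) =
      Ideal.Quotient.mk m (algebraMap (𝓞 K) B (conjInt c x)) := by
    intro x
    rw [Ideal.Quotient.eq, ← map_sub]
    exact (IsLocalization.AtPrime.to_map_mem_maximal_iff B w _).2 (hcw x)
  -- Two algebra maps from a formally unramified algebra which agree modulo the maximal ideal are
  -- equal, since the powers of that ideal intersect in zero. So conjugation would be the identity.
  have hid : AlgHom.id (𝓞 F) B = g := by
    refine Algebra.FormallyUnramified.ext_of_iInf m hm fun x => ?_
    have : (Ideal.Quotient.mk m).comp (RingHom.id B) = (Ideal.Quotient.mk m).comp (g : B →+* B) := by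
      refine IsLocalization.ringHom_ext w.primeCompl (RingHom.ext fun x => ?_)
      exact (hcong x).trans (congrArg _ (hgeq x).symm)
    exact congrArg (fun e : B →+* B ⧸ m => e x) this
  have hinj : Function.Injective (algebraMap (𝓞 K) B) :=
    IsLocalization.injective B w.primeCompl_le_nonZeroDivisors
  have hfix : ∀ x : 𝓞 K, conjInt c x = x := fun x => hinj (by
    rw [← hgeq, ← hid]
    rfl)
  apply hc
  refine AlgEquiv.ext fun x => ?_
  obtain ⟨a, b, hb, rfl⟩ := IsFractionRing.div_surjective (A := 𝓞 K) x
  rw [map_div₀]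
  have h1 : ∀ x : 𝓞 K, c (algebraMap (𝓞 K) K x) = algebraMap (𝓞 K) K x := fun x => by
    rw [← coe_conjInt, hfix]
  rw [h1, h1]
  rfl

end Generator

end DefiniteUnitary
end

noncomputable section

namespace DefiniteUnitary

/-! ### Local anti-involutions at hyperspecial places -/

section LocalGelfand

open Matrix

variable {F K D : Type*} [Field F] [NumberField F] [Field K] [NumberField K] [Algebra F K]
  [Algebra.IsQuadraticExtension F K]
  [Ring D] [Algebra F D] [Algebra K D] [FiniteDimensional F D] {c : K ≃ₐ[F] K}
  {σ : AntiInvolution D c} {p : ℕ} {Kt : TameLevel σ p} {O : Type*} [CommRing O] {I : Ideal O}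
  {S : Finset (HeightOneSpectrum (𝓞 F))}

/-- The generator comes from an integer `τ` not congruent to its conjugate. Its discriminant is
prime to `v`, hence a unit in the completion. -/
lemma exists_isUnramifiedQuadratic (hc : c ≠ 1) {v : HeightOneSpectrum (𝓞 F)}
    (hv : UnramifiedIn K v) :
    ∃ (ϖ : (v.adicCompletion F)ˣ) (τ : v.adicCompletion F ⊗[F] K) (s N : v.adicCompletion F),
      IsUnramifiedQuadratic (v.adicCompletionIntegers F) ϖ (conjLoc c v) τ s N := by
  obtain ⟨ϖ, hϖ⟩ := IsDiscreteValuationRing.exists_irreducible (v.adicCompletionIntegers F)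
  have h0 : (ϖ : v.adicCompletion F) ≠ 0 := fun h => hϖ.ne_zero (Subtype.ext h)
  have hunif := isUniformizer_of_irreducible hϖ h0
  obtain ⟨τ, hτ⟩ := exists_conj_sub_notMem hc hv
  have hτ' : c (τ : K) ≠ τ := by
    intro h
    apply hτ
    have : τ - conjInt c τ = 0 := NumberField.RingOfIntegers.ext (by
      simp [coe_conjInt, h])
    rw [this]
    simp
  obtain ⟨s, hs⟩ := exists_algebraMap_of_conj_eq hc (x := τ + conjInt c τ) (by
    simp [coe_conjInt, conj_conj hc, add_comm])
  obtain ⟨N, hN⟩ := exists_algebraMap_of_conj_eq hc (x := τ * conjInt c τ) (by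
    simp [coe_conjInt, conj_conj hc, mul_comm])
  simp only [map_add, map_mul, coe_conjInt] at hs hN
  have hdisc : s ^ 2 - 4 * N ∉ v.asIdeal := by
    intro h
    apply hτ
    have h1 := Ideal.mem_map_of_mem (algebraMap (𝓞 F) (𝓞 K)) h
    convert h1 using 1
    refine NumberField.RingOfIntegers.ext ?_
    have h2 : algebraMap (𝓞 K) K (algebraMap (𝓞 F) (𝓞 K) (s ^ 2 - 4 * N)) =
        algebraMap F K (algebraMap (𝓞 F) F (s ^ 2 - 4 * N)) := by
      rw [← IsScalarTower.algebraMap_apply, ← IsScalarTower.algebraMap_apply]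
    refine Eq.trans ?_ h2.symm
    simp only [map_sub, map_pow, map_mul, map_ofNat, coe_conjInt, hs, hN]
    ring
  let Fv := v.adicCompletion F
  have hbar : ∀ (a : Fv) (x : K), conjLoc c v (a ⊗ₜ x) = a ⊗ₜ c x := fun a x => rfl
  have htm : ∀ x : F, (1 : Fv) ⊗ₜ[F] (algebraMap F K x) = algebraMap Fv (Fv ⊗[F] K) (algebraMap F Fv x) := by
    intro x
    rw [Algebra.algebraMap_eq_smul_one x, TensorProduct.tmul_smul, TensorProduct.smul_tmul',
      Algebra.TensorProduct.algebraMap_apply, Algebra.algebraMap_eq_smul_one,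
      algebraMap_smul]
  refine ⟨_, 1 ⊗ₜ (τ : K), algebraMap F Fv s, algebraMap F Fv N, hunif, fun c hc δ hδ =>
    exists_root_of_isCompact (isCompact_iff_compactSpace.2 (compactSpace_integers v)) hunif hc hδ,
    fun x => ?_, ?_, ?_, ?_, ?_, ?_, fun x => ?_⟩
  · induction x using TensorProduct.induction_on with
    | zero => simp
    | add x y hx hy => rw [map_add, map_add, hx, hy]
    | tmul a x => rw [hbar, hbar, conj_conj hc]
  · rw [hbar, ← TensorProduct.tmul_add, ← hs, htm]
  · rw [hbar, Algebra.TensorProduct.tmul_mul_tmul, one_mul, ← hN, htm]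
  · exact v.coe_mem_adicCompletionIntegers s
  · exact v.coe_mem_adicCompletionIntegers N
  · have hval : Valued.v (algebraMap F Fv (algebraMap (𝓞 F) F (s ^ 2 - 4 * N))) = 1 := by
      refine le_antisymm (v.coe_mem_adicCompletionIntegers (s ^ 2 - 4 * N)) (not_lt.1 fun hlt => hdisc ?_)
      rw [← v.valuation_lt_one_iff_mem (K := F), ← v.valuedAdicCompletion_eq_valuation']
      exact hlt
    have hne : algebraMap F Fv (algebraMap (𝓞 F) F (s ^ 2 - 4 * N)) ≠ 0 := fun h => by
      rw [h, map_zero] at hval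
      exact zero_ne_one hval
    refine ⟨(algebraMap F Fv (algebraMap (𝓞 F) F (s ^ 2 - 4 * N)))⁻¹, ?_, ?_⟩
    · rw [HeightOneSpectrum.mem_adicCompletionIntegers, map_inv₀, hval, inv_one]
    · have h1 : (algebraMap F Fv s) ^ 2 - 4 * algebraMap F Fv N =
          algebraMap F Fv (algebraMap (𝓞 F) F (s ^ 2 - 4 * N)) := by
        simp only [map_sub, map_pow, map_mul, map_ofNat]
      rw [h1, mul_inv_cancel₀ hne]
  · induction x using TensorProduct.induction_on with
    | zero => exact ⟨0, 0, by simp⟩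
    | add x y hx hy =>
      obtain ⟨a, b, rfl⟩ := hx
      obtain ⟨a', b', rfl⟩ := hy
      exact ⟨a + a', b + b', by rw [map_add, map_add]; ring⟩
    | tmul r x =>
      obtain ⟨a, b, rfl⟩ := exists_eq_add_mul hτ' x
      refine ⟨r * algebraMap F Fv a, r * algebraMap F Fv b, ?_⟩
      have h1 : ∀ y : K, r ⊗ₜ[F] y = algebraMap Fv (Fv ⊗[F] K) r * (1 ⊗ₜ y) := fun y => by
        rw [← Algebra.smul_def, TensorProduct.smul_tmul', smul_eq_mul, mul_one]
      have h2 : ∀ y z : K, (1 : Fv) ⊗ₜ[F] (y * z) = (1 ⊗ₜ y) * (1 ⊗ₜ z) := fun y z => by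
        rw [Algebra.TensorProduct.tmul_mul_tmul, one_mul]
      rw [h1, TensorProduct.tmul_add, h2, htm, htm, map_mul, map_mul]
      ring

/-- In the matrix model the anti-involution is transposition, which preserves the standard unitary
group. -/
lemma hasGelfandInvolution_of_isHyperspecial (hc : c ≠ 1) {n : ℕ} {v : HeightOneSpectrum (𝓞 F)}
    {H : Subgroup (ULoc σ v)} (hH : IsHyperspecial σ n v H) : HasGelfandInvolution H := by
  obtain ⟨hv, φ, hφ, hmem⟩ := hH
  obtain ⟨ϖ, τ, s, N, h⟩ := exists_isUnramifiedQuadratic hc hv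
  let Fv := v.adicCompletion F
  have hconj : ∀ x, conjLoc c v (conjLoc c v x) = x := h.bar_bar
  have hu : ∀ u : ULoc σ v, φ (U.val σ u) * (φ (U.val σ u))ᵀ.map (conjLoc c v) = 1 := fun u => by
    rw [← hφ, ← map_mul, U.val_mul_star, map_one]
  have hmk : ∀ x : Matrix (Fin n) (Fin n) (Fv ⊗[F] K), x * xᵀ.map (conjLoc c v) = 1 →
      ∃ u : ULoc σ v, φ (U.val σ u) = x := by
    intro x hx
    have h1 : φ.symm x * starR σ Fv (φ.symm x) = 1 := by
      apply φ.injective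
      rw [map_mul, hφ, φ.apply_symm_apply, hx, map_one]
    have h2 : starR σ Fv (φ.symm x) * φ.symm x = 1 := by
      apply φ.injective
      rw [map_mul, hφ, φ.apply_symm_apply, mul_eq_one_comm.1 hx, map_one]
    exact ⟨U.mk σ _ h1 h2, φ.apply_symm_apply x⟩
  have hinj : ∀ u u' : ULoc σ v, φ (U.val σ u) = φ (U.val σ u') → u = u' := fun u u' h =>
    U.ext σ (φ.injective h)
  choose ι hι using fun u : ULoc σ v => hmk (φ (U.val σ u))ᵀ (by
    rw [transpose_map (M := (φ (U.val σ u))ᵀ), ← transpose_mul, mul_eq_one_comm.1 (hu u),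
      transpose_one])
  refine ⟨ι, fun x y => hinj _ _ ?_, fun x => ?_⟩
  · rw [hι, U.val_mul, U.val_mul, map_mul, map_mul, hι, hι, transpose_mul]
  · obtain ⟨k₁, k₂, ⟨h1, h1'⟩, ⟨h2, h2'⟩, hk⟩ := h.exists_transpose_eq (hu x)
    obtain ⟨u₁, rfl⟩ := hmk k₁ h1'
    obtain ⟨u₂, rfl⟩ := hmk k₂ h2'
    refine ⟨u₁, (hmem u₁).2 h1, u₂, (hmem u₂).2 h2, hinj _ _ ?_⟩
    rw [hι, U.val_mul, U.val_mul, map_mul, map_mul, hk]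

lemma sphericalImage_commute (hc : c ≠ 1) {n : ℕ}
    (hS : ∀ v : {v : HeightOneSpectrum (𝓞 F) // ¬ Above p v}, v.1 ∉ S →
      IsHyperspecial σ n v.1 (Kt.loc v)) :
    ∀ a ∈ sphericalImage Kt O I S, ∀ b ∈ sphericalImage Kt O I S, a * b = b * a :=
  sphericalImage_comm fun v hv => hasGelfandInvolution_of_isHyperspecial hc (hS v hv)

end LocalGelfand

end DefiniteUnitary
end

/-! ### The proposition -/

open DefiniteUnitary

theorem mainTheorem9
    {F K D L : Type*}
    -- a CM field `K` with maximal totally real subfield `F`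
    [Field F] [NumberField F] [NumberField.IsTotallyReal F]
    [Field K] [NumberField K] [NumberField.IsTotallyComplex K]
    [Algebra F K] [Algebra.IsQuadraticExtension F K]
    (c : K ≃ₐ[F] K) (hc : c ≠ 1)
    -- a central simple `K`-algebra of dimension `n²` with an involution of the second kind
    [Ring D] [Algebra K D] [Algebra F D] [IsScalarTower F K D] [FiniteDimensional F D]
    [Algebra.IsCentral K D] [IsSimpleRing D] (n : ℕ) (hn : Module.finrank K D = n ^ 2)
    (σ : AntiInvolution D c)
    -- the unitary group is totally definite
    (hdef : CompactSpace (U σ (NumberField.InfiniteAdeleRing F)))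
    -- a finite extension `L` of `ℚ_p` with a uniformizer `ϖ`
    (p : ℕ) [Fact p.Prime]
    [NontriviallyNormedField L] [NormedAlgebra ℚ_[p] L] [FiniteDimensional ℚ_[p] L]
    [Algebra ℤ_[p] L] [IsScalarTower ℤ_[p] ℚ_[p] L]
    (ϖ : Int𝒪 p L) (hϖ : Irreducible ϖ)
    -- a tame level, hyperspecial outside the finite set `S`, sufficiently small
    (Kt : TameLevel σ p) (S : Finset (HeightOneSpectrum (𝓞 F)))
    (hS : ∀ v : {v : HeightOneSpectrum (𝓞 F) // ¬ Above p v}, v.1 ∉ S →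
      IsHyperspecial σ n v.1 (Kt.loc v))
    (hsmall : SufficientlySmall σ p Kt)
    -- an open pro-`p` subgroup `Kp` of `G(ℚ_p)`
    (Kp : Subgroup (GQp σ p))
    (hKp_open : IsOpen (Kp : Set (GQp σ p)))
    (hKp_compact : IsCompact (Kp : Set (GQp σ p)))
    (hKp_pro : IsProP p Kp) :
    (∃ r : ℕ, 0 < r ∧
      ∃ e : CompletedH0 Kt (Int𝒪 p L) (Ideal.span {ϖ})
          ≃L[Int𝒪 p L] (Fin r → C(Kp, Int𝒪 p L)),
        ∀ (k : Kp) (f : CompletedH0 Kt (Int𝒪 p L) (Ideal.span {ϖ})),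
          e (translation Kt (Int𝒪 p L) (Ideal.span {ϖ}) k f) =
            translateFun k (e f)) ∧
    ∃ hcomm : ∀ a b :
        bigHecke Kt (Int𝒪 p L) (Ideal.span {ϖ}) S, a * b = b * a,
      letI : CommRing
          (bigHecke Kt (Int𝒪 p L) (Ideal.span {ϖ}) S) :=
        { (inferInstance : Ring
            (bigHecke Kt (Int𝒪 p L) (Ideal.span {ϖ}) S)) with
          mul_comm := hcomm }
      ∀ (m : Ideal (bigHecke Kt (Int𝒪 p L) (Ideal.span {ϖ}) S))
        [m.IsMaximal],
        -- the localization map to the localization at `m` is split by `j`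
        ∃ j : LocalizedModule m.primeCompl
              (CompletedH0 Kt (Int𝒪 p L) (Ideal.span {ϖ}))
            →ₗ[bigHecke Kt (Int𝒪 p L) (Ideal.span {ϖ}) S]
              CompletedH0 Kt (Int𝒪 p L) (Ideal.span {ϖ}),
          (∀ y, LocalizedModule.mkLinearMap m.primeCompl _ (j y) = y) ∧
          Continuous (fun f => j (LocalizedModule.mkLinearMap m.primeCompl
            (CompletedH0 Kt (Int𝒪 p L) (Ideal.span {ϖ})) f)) ∧
          ∀ (g : GQp σ p)
            (f : CompletedH0 Kt (Int𝒪 p L) (Ideal.span {ϖ})),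
            j (LocalizedModule.mkLinearMap m.primeCompl _
              (translation Kt (Int𝒪 p L) (Ideal.span {ϖ}) g f)) =
            translation Kt (Int𝒪 p L) (Ideal.span {ϖ}) g
              (j (LocalizedModule.mkLinearMap m.primeCompl _ f)) := by
  have hI := isAdic_span hϖ
  refine ⟨?_, mul_comm_of_sphericalImage (sphericalImage_commute hc hS), ?_⟩
  · obtain ⟨r, hr, g, idx, kp, hrep, huniq⟩ := exists_representatives Kt hc hdef hsmall hKp_open
      hKp_compact hKp_pro
    obtain ⟨e, he⟩ := exists_continuousLinearEquiv hI hKp_open hKp_compact hrep huniq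
    refine ⟨r, hr, e, fun k f => ?_⟩
    ext i x
    -- Equivariance is checked modulo every power of `ϖ`: both sides are the value of the form at `g
    -- i * x * k`.
    refine congrArg Subtype.val (eq_of_forall_mk_eq hI fun s => ?_)
    have h1 : translateFun k (e f) i x = e f i (x * k) := rfl
    rw [h1, he, he, CompletedH0.mk_value, CompletedH0.mk_value, CompletedH0.reduce_translation,
      H0.translate_fn, mul_assoc]
    rfl
  · exact exists_localization_section hc hdef hKp_open hKp_compact hKp_pro hI hϖ.ne_zero
      (exists_pow_mem_span hϖ 1) (mul_comm_of_sphericalImage (sphericalImage_commute hc hS))
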